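/- Let $X$ be a separated noetherian scheme. A \emph{module-valued $X$-functor} is a contravariant functor $F$ from the category of all $X$-schemes to abelian groups, together with a $\Gamma(Y,\mathcal O_Y)$-module structure on $F(Y)$ for every $X$-scheme $Y$, such that for every morphism $Y_1\to Y_2$ of $X$-schemes the map $F(Y_2)\to F(Y_1)$ is a homomorphism of $\Gamma(Y_2,\mathcal O_{Y_2})$-modules; morphisms are natural transformations which are linear on each $Y$. For a quasi-coherent $\mathcal O_X$-module $\mathcal M$ let $\underline{\mathcal M}$ be the module-valued $X$-functor $Y\mapsto\Gamma(Y,\mathcal M_Y)$, where $\mathcal M_Y$ is the inverse image of $\mathcal M$ on $Y$. Given a class $S=S_0$ of objects of a category, let $S_{n+1}$ be the class of all limits of finite diagrams of objects in $S_n$; the objects in $\bigcup_n S_n$ are the \emph{iterated finite limits} of objects in $S$. A module-valued $X$-functor is \emph{module-quasi-coherent} (resp. \emph{module-coherent}) if it is an iterated finite limit, in the category of module-valued $X$-functors, of functors isomorphic to $\underline{\mathcal M}$ with $\mathcal M$ quasi-coherent (resp. coherent); the same definitions apply to every open subscheme of $X$. It is \emph{locally module-quasi-coherent} (resp. \emph{locally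 module-coherent}) if it is a sheaf for the Zariski topology and there is a finite open cover $U_1,\dots,U_n$ of $X$ such that each restriction $F|_{U_i}$ (the functor $T\mapsto F(T)$ on $U_i$-schemes $T$) is module-quasi-coherent (resp. module-coherent). Then: \begin{enumerate} \item Every locally module-quasi-coherent (resp. locally module-coherent) $X$-functor is module-quasi-coherent (resp. module-coherent). \item The category of module-coherent $X$-functors (a full subcategory of the module-valued $X$-functors, with the induced addition of morphisms) is abelian. \item For every module-coherent $X$-functor $F$ there is a homomorphism $\varphi:\mathcal M\to\mathcal N$ of coherent $\mathcal O_X$-modules such that $F$ is isomorphic to the kernel of $\underline{\mathcal M}\to\underline{\mathcal N}$, computed in the module-valued $X$-functors. \end{enumerate} -/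

import Mathlib

open CategoryTheory Limits AlgebraicGeometry Opposite

universe v u

noncomputable section

namespace CoherentFunctors

/-- `limitLevel S n` is the class of objects obtained from the class `S` by taking `n` times in
succession all limits (in the ambient category) of finite diagrams. -/
def limitLevel {C : Type u} [Category.{v} C] (S : ObjectProperty C) : ℕ → ObjectProperty C
  | 0 => S
  | n + 1 => fun F => ∃ (J : Type) (_ : SmallCategory J) (_ : FinCategory J),
      (limitLevel S n).limitsOfShape J F

/-- The iterated finite limits of objects in the class `S`. -/
def IsIteratedFiniteLimit {C : Type u} [Category.{v} C] (S : ObjectProperty C) :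
    ObjectProperty C :=
  fun F => ∃ n : ℕ, limitLevel S n F

/-- The presheaf of rings `Y ↦ Γ(Y, 𝒪_Y)` on the category of `X`-schemes. -/
def globalSections (X : Scheme.{u}) : (Over X)ᵒᵖ ⥤ RingCat.{u} :=
  (Over.forget X).op ⋙ Scheme.Γ ⋙ forget₂ CommRingCat RingCat

/-- Module-valued `X`-functors: an abelian group valued functor `F` on the opposite of the category
of all `X`-schemes, with a `Γ(Y, 𝒪_Y)`-module structure on each `F(Y)`, such that the transition
maps are semilinear. -/
abbrev ModuleFunctor (X : Scheme.{u}) := PresheafOfModules.{u} (globalSections X)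

/-- The restriction of a module-valued `X`-functor to an open subscheme `U`: the same values, on
the `U`-schemes regarded as `X`-schemes. -/
def ModuleFunctor.restrict {X : Scheme.{u}} (F : ModuleFunctor X) (U : X.Opens) :
    ModuleFunctor (U : Scheme.{u}) :=
  (PresheafOfModules.pushforward₀ (Over.map U.ι) (globalSections X)).obj F

/-- Being a sheaf for the Zariski topology on the category of all `X`-schemes. -/
def ModuleFunctor.IsZariskiSheaf {X : Scheme.{u}} (F : ModuleFunctor X) : Prop :=
  Presheaf.IsSheaf (Scheme.zariskiTopology.{u}.over X) F.presheaf

section Underline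

variable {X : Scheme.{u}}

/-- For a morphism `g : Z ⟶ Y` of `X`-schemes, the canonical map from the inverse image of `M` on
`Y` to the direct image under `g` of the inverse image of `M` on `Z`. It corresponds by adjunction
to the unit `M ⟶ (Z ⟶ X)_* (Z ⟶ X)^* M = (Y ⟶ X)_* g_* (Z ⟶ X)^* M`. -/
def comparison (M : X.Modules) {Z Y : Over X} (g : Z ⟶ Y) :
    (Scheme.Modules.pullback Y.hom).obj M ⟶
      (Scheme.Modules.pushforward g.left).obj ((Scheme.Modules.pullback Z.hom).obj M) :=
  ((Scheme.Modules.pullbackPushforwardAdjunction Y.hom).homEquiv M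
    ((Scheme.Modules.pushforward g.left).obj ((Scheme.Modules.pullback Z.hom).obj M))).symm
    ((Scheme.Modules.pullbackPushforwardAdjunction Z.hom).unit.app M ≫
      (Scheme.Modules.pushforwardCongr (Over.w g).symm).hom.app
        ((Scheme.Modules.pullback Z.hom).obj M) ≫
      (Scheme.Modules.pushforwardComp g.left Y.hom).inv.app
        ((Scheme.Modules.pullback Z.hom).obj M))

/-- The inverse image, on the preimage of `V` in `Y`, of a section of `M` on `V`. -/
def pullSection (M : X.Modules) (Y : Over X) (V : X.Opens) (x : Γ(M, V)) :
    Γ((Scheme.Modules.pullback Y.hom).obj M, Y.hom ⁻¹ᵁ V) :=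
  ((Scheme.Modules.pullbackPushforwardAdjunction Y.hom).unit.app M).app V x

lemma pullback_hom_ext (M : X.Modules) {Y : Over X} {P : Y.left.Modules}
    {α β : (Scheme.Modules.pullback Y.hom).obj M ⟶ P}
    (h : ∀ (V : X.Opens) (x : Γ(M, V)), α.app (Y.hom ⁻¹ᵁ V) (pullSection M Y V x) =
      β.app (Y.hom ⁻¹ᵁ V) (pullSection M Y V x)) : α = β := by
  apply ((Scheme.Modules.pullbackPushforwardAdjunction Y.hom).homEquiv M P).injective
  rw [Adjunction.homEquiv_unit, Adjunction.homEquiv_unit]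
  ext V x
  exact h V x

lemma comparison_pullSection (M : X.Modules) {Z Y : Over X} (g : Z ⟶ Y) (V : X.Opens)
    (x : Γ(M, V)) :
    ((comparison M g).app (Y.hom ⁻¹ᵁ V) (pullSection M Y V x) :
        Γ((Scheme.Modules.pullback Z.hom).obj M, g.left ⁻¹ᵁ Y.hom ⁻¹ᵁ V)) =
      ((Scheme.Modules.pullback Z.hom).obj M).presheaf.map
        (homOfLE (by rw [← Over.w g]; exact le_rfl)).op (pullSection M Z V x) := by
  have h := (Adjunction.homEquiv_unit (Scheme.Modules.pullbackPushforwardAdjunction Y.hom) M _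
    (comparison M g)).symm.trans (Equiv.apply_symm_apply _ _)
  exact congr(Scheme.Modules.Hom.app $h V x)

lemma map_eq_self (M : X.Modules) {U : X.Opens} (i : U ⟶ U) (x : Γ(M, U)) :
    M.presheaf.map i.op x = x := by
  obtain rfl : i = 𝟙 U := rfl
  simp

lemma map_map (M : X.Modules) {U V W : X.Opens} (i : V ⟶ U) (j : W ⟶ V) (x : Γ(M, U)) :
    M.presheaf.map j.op (M.presheaf.map i.op x) = M.presheaf.map (j ≫ i).op x := by
  simp

lemma app_map {M N : X.Modules} (φ : M ⟶ N) {U V : X.Opens} (i : V ⟶ U) (x : Γ(M, U)) :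
    φ.app V (M.presheaf.map i.op x) = N.presheaf.map i.op (φ.app U x) :=
  ConcreteCategory.congr_hom (φ.mapPresheaf.naturality i.op) x

lemma comparison_id_app (M : X.Modules) (Y : Over X)
    (x : Γ((Scheme.Modules.pullback Y.hom).obj M, ⊤)) :
    (comparison M (𝟙 Y)).app ⊤ x = x := by
  have : comparison M (𝟙 Y) =
      (Scheme.Modules.pushforwardId _).inv.app _ ≫
        (Scheme.Modules.pushforwardCongr (Over.id_left Y).symm).hom.app _ :=
    pullback_hom_ext _ fun V x => comparison_pullSection M (𝟙 Y) V x
  rw [this]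
  exact map_eq_self _ (𝟙 _) x

lemma comparison_comp_app (M : X.Modules) {W Z Y : Over X} (h : W ⟶ Z) (g : Z ⟶ Y)
    (x : Γ((Scheme.Modules.pullback Y.hom).obj M, ⊤)) :
    (comparison M (h ≫ g)).app ⊤ x = (comparison M h).app ⊤ ((comparison M g).app ⊤ x) := by
  have : comparison M (h ≫ g) = comparison M g ≫
      (Scheme.Modules.pushforward g.left).map (comparison M h) ≫
        (Scheme.Modules.pushforwardComp h.left g.left).hom.app _ ≫
          (Scheme.Modules.pushforwardCongr (Over.comp_left _ _ _ h g).symm).hom.app _ := by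
    apply pullback_hom_ext
    intro V x
    refine (comparison_pullSection M (h ≫ g) V x).trans ?_
    change _ = ((Scheme.Modules.pullback W.hom).obj M).presheaf.map (eqToHom (by rfl)).op
      ((comparison M h).app (g.left ⁻¹ᵁ Y.hom ⁻¹ᵁ V)
        ((comparison M g).app (Y.hom ⁻¹ᵁ V) (pullSection M Y V x)))
    rw [comparison_pullSection]
    have e : g.left ⁻¹ᵁ Y.hom ⁻¹ᵁ V ≤ Z.hom ⁻¹ᵁ V := by rw [← Over.w g]; exact le_rfl
    have nat := app_map (comparison M h) (homOfLE e) (pullSection M Z V x)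
    rw [nat, comparison_pullSection]
    refine (map_map ((Scheme.Modules.pullback W.hom).obj M) _ (homOfLE ?_) _).symm.trans
      (congrArg _ (map_map ((Scheme.Modules.pullback W.hom).obj M) _ (homOfLE ?_) _).symm)
    · exact le_rfl
    · exact fun y hy => e hy
  rw [this]
  exact map_eq_self ((Scheme.Modules.pullback W.hom).obj M) (𝟙 _) _

lemma comparison_naturality {M N : X.Modules} (φ : M ⟶ N) {Z Y : Over X} (g : Z ⟶ Y) :
    comparison M g ≫
        (Scheme.Modules.pushforward g.left).map ((Scheme.Modules.pullback Z.hom).map φ) =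
      (Scheme.Modules.pullback Y.hom).map φ ≫ comparison N g := by
  have key (Y : Over X) (V : X.Opens) (x : Γ(M, V)) :
      ((Scheme.Modules.pullback Y.hom).map φ).app (Y.hom ⁻¹ᵁ V) (pullSection M Y V x) =
        pullSection N Y V (φ.app V x) := by
    have h := (Scheme.Modules.pullbackPushforwardAdjunction Y.hom).unit.naturality φ
    exact congr(Scheme.Modules.Hom.app $h V x).symm
  apply pullback_hom_ext
  intro V x
  change ((Scheme.Modules.pullback Z.hom).map φ).app (g.left ⁻¹ᵁ Y.hom ⁻¹ᵁ V)
      ((comparison M g).app (Y.hom ⁻¹ᵁ V) (pullSection M Y V x)) =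
    (comparison N g).app (Y.hom ⁻¹ᵁ V)
      (((Scheme.Modules.pullback Y.hom).map φ).app (Y.hom ⁻¹ᵁ V) (pullSection M Y V x))
  rw [key, comparison_pullSection, comparison_pullSection, app_map, key]

/-- The abelian group valued functor `Y ↦ Γ(Y, M_Y)`, where `M_Y` is the inverse image of `M`. -/
def underlineAb (M : X.Modules) : (Over X)ᵒᵖ ⥤ Ab.{u} where
  obj Y := Γ((Scheme.Modules.pullback Y.unop.hom).obj M, ⊤)
  map g := (comparison M g.unop).app ⊤
  map_id Y := by ext x; exact comparison_id_app M Y.unop x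
  map_comp f g := by ext x; exact comparison_comp_app M g.unop f.unop x

instance (M : X.Modules) (Y : (Over X)ᵒᵖ) : Module ((globalSections X).obj Y)
    ((underlineAb M).obj Y) :=
  inferInstanceAs (Module Γ(Y.unop.left, ⊤) Γ((Scheme.Modules.pullback Y.unop.hom).obj M, ⊤))

variable (X) in
/-- The functor which sends an `𝒪_X`-module `M` to the module-valued `X`-functor
`Y ↦ Γ(Y, M_Y)`. -/
def underline : X.Modules ⥤ ModuleFunctor X where
  obj M := PresheafOfModules.ofPresheaf (underlineAb M) fun _ _ f r m =>
    (comparison M f.unop).app_smul (U := ⊤) r m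
  map {M N} φ := PresheafOfModules.homMk
    { app Y := ((Scheme.Modules.pullback Y.unop.hom).map φ).app ⊤
      naturality Y Z g := by
        ext x
        exact congr(Scheme.Modules.Hom.app $(comparison_naturality φ g.unop) ⊤ x) }
    fun Y r m => ((Scheme.Modules.pullback Y.unop.hom).map φ).app_smul (U := ⊤) r m
  map_id M := by
    ext Y x
    exact congr(Scheme.Modules.Hom.app $((Scheme.Modules.pullback Y.unop.hom).map_id M) ⊤ x)
  map_comp φ ψ := by
    ext Y x
    exact congr(Scheme.Modules.Hom.app $((Scheme.Modules.pullback Y.unop.hom).map_comp φ ψ) ⊤ x)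

end Underline

/-- Coherent `𝒪_X`-modules on a (locally) noetherian scheme `X`: the quasi-coherent modules of
finite type. -/
def IsCoherentModule {X : Scheme.{u}} (M : X.Modules) : Prop :=
  SheafOfModules.IsQuasicoherent M ∧ SheafOfModules.IsFiniteType M

/-- Module-valued `X`-functors isomorphic to `Y ↦ Γ(Y, M_Y)` for a quasi-coherent `M`. -/
def IsStrictlyModuleQuasicoherent (X : Scheme.{u}) : ObjectProperty (ModuleFunctor X) :=
  fun F => ∃ M : X.Modules, SheafOfModules.IsQuasicoherent M ∧ Nonempty (F ≅ (underline X).obj M)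

/-- Module-valued `X`-functors isomorphic to `Y ↦ Γ(Y, M_Y)` for a coherent `M`. -/
def IsStrictlyModuleCoherent (X : Scheme.{u}) : ObjectProperty (ModuleFunctor X) :=
  fun F => ∃ M : X.Modules, IsCoherentModule M ∧ Nonempty (F ≅ (underline X).obj M)

/-- Module-quasi-coherent `X`-functors. -/
def IsModuleQuasicoherent (X : Scheme.{u}) : ObjectProperty (ModuleFunctor X) :=
  IsIteratedFiniteLimit (IsStrictlyModuleQuasicoherent X)

/-- Module-coherent `X`-functors. -/
def IsModuleCoherent (X : Scheme.{u}) : ObjectProperty (ModuleFunctor X) :=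
  IsIteratedFiniteLimit (IsStrictlyModuleCoherent X)

/-- Locally module-quasi-coherent `X`-functors: Zariski sheaves whose restriction to each member of
some finite open cover of `X` is module-quasi-coherent. -/
def IsLocallyModuleQuasicoherent {X : Scheme.{u}} (F : ModuleFunctor X) : Prop :=
  F.IsZariskiSheaf ∧ ∃ (n : ℕ) (U : Fin n → X.Opens), (⨆ i, U i) = ⊤ ∧
    ∀ i, IsModuleQuasicoherent (U i : Scheme.{u}) (F.restrict (U i))

/-- Locally module-coherent `X`-functors: Zariski sheaves whose restriction to each member of
some finite open cover of `X` is module-coherent. -/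
def IsLocallyModuleCoherent {X : Scheme.{u}} (F : ModuleFunctor X) : Prop :=
  F.IsZariskiSheaf ∧ ∃ (n : ℕ) (U : Fin n → X.Opens), (⨆ i, U i) = ⊤ ∧
    ∀ i, IsModuleCoherent (U i : Scheme.{u}) (F.restrict (U i))

end CoherentFunctors

end

/-! Over an affine open `U` with ring `A`, the functor `underline M` sends an `A`-algebra `B` to `B
⊗ Γ(M, U)` (`toVal_isBaseChange`). Locally the theorem is therefore about the functors `K : B ↦
Ker(B ⊗ M → B ⊗ Q)` with `A` noetherian and `M`, `Q` finitely generated. Extended to all `A`-modules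
`W`, such a `K` is a quotient of a representable functor: the equational criterion for the vanishing
of tensors yields a finitely generated module carrying an element of `K` from which every other
element arises by a linear map. A natural transformation from `K` to `W ↦ W ⊗ P` is determined by
its value at this one element. Analysing that value shows that it is induced by a linear map `M →
P`, and that a linear map `M → P` vanishing on `K` factors through `M → Q`. Trivial square-zero
extensions `A ⊕ W` carry both facts from modules to algebras
(`exists_lTensor_eq_of_natural_algebra`, `exists_comp_eq_of_ker_lTensor_algebra_le`). The image of
`K` in `W ⊗ P` is again a kernel, namely of the map from `P` to a pushout, by right exactness
(`exists_ker_lTensor_eq_map_ker`).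

To globalize, let `j` be the inclusion of an affine open `U` of the separated scheme `X`. It is an
affine morphism, so `j_*` preserves quasi-coherence, and the value of `underline (j_* M)` at `Y` is
that of `underline M` at `U ×_X Y` (`ExtendsFrom.res_bijective`). Hence a morphism to `underline T`
from a functor that is a kernel inside `underline P` over `U` extends, after passing to `j_* j^* T`,
to a homomorphism defined on `P` (`IsKernelOn.exists_extension`). The modules produced in this way
are finitely generated over `U` only, and coherent submodules have to replace them
(`exists_coherent_submodule`). An inclusion `N → P` need not stay injective after base change, so an
identity in `P` need not hold in `N`. The remedy is to let `N` also contain the finitely generated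
modules through which the differences to be annihilated factor (`exists_overlap`,
`exists_coherent_kernel`). It follows that a Zariski sheaf which is locally a coherent kernel embeds
into some `underline M` with `M` coherent (`exists_coherent_embedding`), that the sheaf image of a
morphism to `underline M` is the zero locus of a homomorphism of coherent modules
(`exists_coherent_image`), and so that the sheaf is globally a coherent kernel
(`isCoherentKernel_of_hasKernelOn`). Being a kernel over an affine open is stable under finite
limits (`IsSectionwiseLimit.hasKernelOn`). This gives the third assertion and the coherent half of
the first.

For the abelian structure, kernels are finite limits, and the sheaf image of any morphism is the
kernel of a morphism to a coherent `underline N` (`IsModuleCoherent.exists_image`). Applying this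
twice gives cokernels; applying it once shows that monomorphisms are kernels and that epimorphisms
are locally surjective, hence cokernels.

The quasi-coherent half of the first assertion needs no extension of morphisms. A Zariski sheaf is
the kernel of the difference map between the products of its extensions from the members of a finite
affine cover and from their pairwise intersections. Extension from an affine open preserves limits
and carries `underline M` to `underline (j_* M)` (`isModuleQuasicoherent_of_isLocal`). -/

noncomputable section

namespace CoherentFunctors

/-! ### Kernels of `W ⊗ M → W ⊗ Q` as functors of the module `W` -/

section

section TensorKernels

open TensorProduct

variable {A : Type u} [CommRing A]

/-- The quotient of `A ^ r` by the submodule spanned by a family of vectors. -/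
abbrev RowQuotient {κ : Type} {r : ℕ} (c : κ → Fin r → A) : Type u :=
  (Fin r → A) ⧸ Submodule.span A (Set.range c)

/-- The image of the `j`-th basis vector in `RowQuotient c`. -/
def RowQuotient.gen {κ : Type} {r : ℕ} (c : κ → Fin r → A) (j : Fin r) : RowQuotient c :=
  Submodule.Quotient.mk (Pi.single j 1)

/-- The linear map out of `RowQuotient c` determined by the images of the generators. -/
def RowQuotient.desc {κ : Type} {r : ℕ} (c : κ → Fin r → A) {W : Type*} [AddCommGroup W]
    [Module A W] (v : Fin r → W) (h : ∀ k, ∑ j, c k j • v j = 0) : RowQuotient c →ₗ[A] W :=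
  Submodule.liftQ _ (Fintype.linearCombination A v) (by
    rw [Submodule.span_le]
    rintro _ ⟨k, rfl⟩
    simpa [Fintype.linearCombination_apply] using h k)

@[simp]
lemma RowQuotient.desc_gen {κ : Type} {r : ℕ} (c : κ → Fin r → A) {W : Type*} [AddCommGroup W]
    [Module A W] (v : Fin r → W) (h : ∀ k, ∑ j, c k j • v j = 0) (j : Fin r) :
    RowQuotient.desc c v h (RowQuotient.gen c j) = v j := by
  simp [RowQuotient.desc, RowQuotient.gen, Fintype.linearCombination_apply, Pi.single_apply]

lemma RowQuotient.sum_smul_gen {κ : Type} {r : ℕ} (c : κ → Fin r → A) (x : Fin r → A) :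
    ∑ j, x j • RowQuotient.gen c j = Submodule.Quotient.mk x := by
  have h : x = ∑ j, x j • (Pi.single j 1 : Fin r → A) := by
    ext i
    simp [Pi.single_apply]
  conv_rhs => rw [h, ← Submodule.mkQ_apply, map_sum]
  simp [RowQuotient.gen]

lemma RowQuotient.relation {κ : Type} {r : ℕ} (c : κ → Fin r → A) (k : κ) :
    ∑ j, c k j • RowQuotient.gen c j = 0 := by
  rw [RowQuotient.sum_smul_gen, Submodule.Quotient.mk_eq_zero]
  exact Submodule.subset_span ⟨k, rfl⟩

lemma RowQuotient.span_gen {κ : Type} {r : ℕ} (c : κ → Fin r → A) :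
    Submodule.span A (Set.range (RowQuotient.gen c)) = ⊤ := by
  rw [eq_top_iff]
  rintro x -
  obtain ⟨x, rfl⟩ := Submodule.Quotient.mk_surjective _ x
  rw [← RowQuotient.sum_smul_gen]
  exact Submodule.sum_mem _ fun j _ => Submodule.smul_mem _ _ (Submodule.subset_span ⟨j, rfl⟩)

/-- Right exactness of the tensor product: `RowQuotient c ⊗ P` is `P ^ r` modulo the image of `P ^
κ` under the matrix `c`. Only the map from the tensor product to this quotient is needed, and it is
built by hand from the generators. -/
lemma RowQuotient.exists_of_sum_tmul_eq_zero {κ : Type} [Fintype κ] {r : ℕ} (c : κ → Fin r → A)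
    {P : Type*} [AddCommGroup P] [Module A P] (z : Fin r → P)
    (h : ∑ j, RowQuotient.gen c j ⊗ₜ[A] z j = 0) : ∃ p : κ → P, ∀ j, z j = ∑ k, c k j • p k := by
  let β : (κ → P) →ₗ[A] (Fin r → P) :=
    LinearMap.pi fun j => ∑ k, c k j • LinearMap.proj k
  let g : RowQuotient c →ₗ[A] P →ₗ[A] (Fin r → P) ⧸ LinearMap.range β :=
    RowQuotient.desc c (fun j => (Submodule.mkQ _).comp (LinearMap.single A (fun _ => P) j)) (by
      intro k
      ext p
      simp only [LinearMap.sum_apply, LinearMap.smul_apply, LinearMap.comp_apply,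
        LinearMap.zero_apply, ← map_smul, ← map_sum]
      rw [Submodule.mkQ_apply, Submodule.Quotient.mk_eq_zero]
      classical
      refine ⟨Pi.single k p, ?_⟩
      ext j
      simp [β, Pi.single_apply])
  have h' := congrArg (TensorProduct.lift g) h
  simp only [map_sum, TensorProduct.lift.tmul, map_zero, g, RowQuotient.desc_gen,
    LinearMap.comp_apply] at h'
  rw [← map_sum, Submodule.mkQ_apply, Submodule.Quotient.mk_eq_zero] at h'
  obtain ⟨p, hp⟩ := h'
  refine ⟨p, fun j => ?_⟩
  have := congrFun hp j
  simpa [β, Pi.single_apply] using this.symm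

lemma exists_sum_tmul_of_span_eq_top_right {ι : Type*} [Fintype ι] {W M : Type*} [AddCommGroup W]
    [Module A W] [AddCommGroup M] [Module A M] (m : ι → M)
    (hm : Submodule.span A (Set.range m) = ⊤) (x : W ⊗[A] M) :
    ∃ w : ι → W, x = ∑ i, w i ⊗ₜ m i := by
  induction x with
  | zero => exact ⟨0, by simp⟩
  | add x y hx hy =>
    obtain ⟨w, rfl⟩ := hx
    obtain ⟨w', rfl⟩ := hy
    exact ⟨w + w', by simp [TensorProduct.add_tmul, Finset.sum_add_distrib]⟩
  | tmul w y =>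
    have hy : y ∈ Submodule.span A (Set.range m) := hm ▸ Submodule.mem_top
    obtain ⟨c, rfl⟩ := (Submodule.mem_span_range_iff_exists_fun A).1 hy
    exact ⟨fun i => c i • w, by simp [TensorProduct.tmul_sum, TensorProduct.smul_tmul]⟩

lemma exists_sum_tmul_of_span_eq_top_left {ι : Type*} [Fintype ι] {W M : Type*} [AddCommGroup W]
    [Module A W] [AddCommGroup M] [Module A M] (w : ι → W)
    (hw : Submodule.span A (Set.range w) = ⊤) (x : W ⊗[A] M) :
    ∃ m : ι → M, x = ∑ i, w i ⊗ₜ m i := by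
  obtain ⟨m, hm⟩ := exists_sum_tmul_of_span_eq_top_right w hw (TensorProduct.comm A W M x)
  refine ⟨m, (TensorProduct.comm A W M).injective ?_⟩
  simpa using hm

variable {M Q : Type u} [AddCommGroup M] [Module A M] [AddCommGroup Q] [Module A Q]

/-- Finitely many generators of `M`, their images in `Q` completed to generators of `Q`, and
generators of the module of relations between the latter. -/
structure KernelPresentation (φ : M →ₗ[A] Q) where
  /-- number of generators of `M` -/
  n : ℕ
  /-- number of additional generators of `Q` -/
  k : ℕ
  /-- number of relations -/
  r : ℕ
  /-- generators of `M` -/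
  m : Fin n → M
  /-- additional generators of `Q` -/
  d : Fin k → Q
  /-- coefficients of the relations -/
  a : Fin n → Fin r → A
  /-- coefficients of the relations at the additional generators -/
  b : Fin k → Fin r → A
  span_m : Submodule.span A (Set.range m) = ⊤
  span_d : Submodule.span A (Set.range (Sum.elim (φ ∘ m) d)) = ⊤
  rel (j : Fin r) : ∑ i, a i j • φ (m i) + ∑ l, b l j • d l = 0
  exists_of_rel (c : Fin n → A) (c' : Fin k → A)
    (h : ∑ i, c i • φ (m i) + ∑ l, c' l • d l = 0) :
    ∃ v : Fin r → A, (∀ i, c i = ∑ j, a i j * v j) ∧ ∀ l, c' l = ∑ j, b l j * v j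

lemma KernelPresentation.nonempty [IsNoetherianRing A] [Module.Finite A M] [Module.Finite A Q]
    (φ : M →ₗ[A] Q) : Nonempty (KernelPresentation φ) := by
  obtain ⟨n, m, hm⟩ := Module.Finite.exists_fin (R := A) (M := M)
  obtain ⟨k, d, hd⟩ := Module.Finite.exists_fin (R := A) (M := Q)
  let L : (Fin n ⊕ Fin k → A) →ₗ[A] Q := Fintype.linearCombination A (Sum.elim (φ ∘ m) d)
  have hL (c) : L c = ∑ i, c (.inl i) • φ (m i) + ∑ l, c (.inr l) • d l := by
    simp [L, Fintype.linearCombination_apply]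
  obtain ⟨r, s, hs⟩ := Submodule.fg_iff_exists_fin_generating_family.1
    (IsNoetherian.noetherian (LinearMap.ker L))
  refine ⟨⟨n, k, r, m, d, fun i j => s j (.inl i), fun l j => s j (.inr l), hm, ?_, ?_, ?_⟩⟩
  · rw [eq_top_iff, ← hd]
    apply Submodule.span_mono
    rintro _ ⟨l, rfl⟩
    exact ⟨.inr l, rfl⟩
  · intro j
    have : s j ∈ LinearMap.ker L := hs ▸ Submodule.subset_span ⟨j, rfl⟩
    rwa [LinearMap.mem_ker, hL] at this
  · intro c c' h
    have : Sum.elim c c' ∈ Submodule.span A (Set.range s) := by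
      rw [hs, LinearMap.mem_ker, hL]
      exact h
    obtain ⟨v, hv⟩ := (Submodule.mem_span_range_iff_exists_fun A).1 this
    refine ⟨v, fun i => ?_, fun l => ?_⟩
    · simpa [mul_comm] using (congrFun hv (.inl i)).symm
    · simpa [mul_comm] using (congrFun hv (.inr l)).symm

namespace KernelPresentation

variable {φ : M →ₗ[A] Q} (p : KernelPresentation φ)

-- By the equational criterion, a vanishing tensor comes from finitely many relations with
-- coefficients in `A` between the generators of `Q`. Each of these is a combination of the chosen
-- relations, and the coefficients of the combinations assemble to `v`. The additional generators
-- `d` carry the coefficient `0`, whence the equations with matrix `b`.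
include p in
lemma exists_of_sum_tmul_eq_zero {W : Type*} [AddCommGroup W] [Module A W] (w : Fin p.n → W)
    (h : ∑ i, w i ⊗ₜ[A] φ (p.m i) = 0) :
    ∃ v : Fin p.r → W, (∀ i, w i = ∑ j, p.a i j • v j) ∧ ∀ l, ∑ j, p.b l j • v j = 0 := by
  have h' : ∑ i, Sum.elim (φ ∘ p.m) p.d i ⊗ₜ[A] Sum.elim w (0 : Fin p.k → W) i = 0 := by
    have := congrArg (TensorProduct.comm A W Q) h
    simpa using this
  obtain ⟨κ, c, y, hy, hc⟩ :=
    TensorProduct.vanishesTrivially_of_sum_tmul_eq_zero A p.span_d h'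
  have hc' (t : Fin κ) := p.exists_of_rel (fun i => c (.inl i) t) (fun l => c (.inr l) t)
    (by simpa using hc t)
  choose v hv hv' using hc'
  refine ⟨fun j => ∑ t, v t j • y t, fun i => ?_, fun l => ?_⟩
  · have := hy (.inl i)
    simp only [Sum.elim_inl] at this
    simp only [this, hv, Finset.sum_smul, Finset.smul_sum, mul_smul]
    rw [Finset.sum_comm]
  · have := hy (.inr l)
    simp only [Sum.elim_inr, Pi.zero_apply] at this
    rw [this]
    simp only [hv', Finset.sum_smul, Finset.smul_sum, mul_smul]
    rw [Finset.sum_comm]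

/-- The module representing, up to a surjection, the functor `W ↦ Ker(W ⊗ M → W ⊗ Q)`. -/
abbrev Univ : Type u := RowQuotient p.b

/-- The universal element of the kernel. -/
def univ : p.Univ ⊗[A] M := ∑ i, (∑ j, p.a i j • RowQuotient.gen p.b j) ⊗ₜ p.m i

/-- The relation `p.rel` trades `∑ a i j • φ (m i)` for `-∑ b l j • d l`, and the rows of `b` are
zero in `Univ`. -/
lemma lTensor_univ : LinearMap.lTensor p.Univ φ p.univ = 0 := by
  have (j : Fin p.r) : ∑ i, p.a i j • φ (p.m i) = - ∑ l, p.b l j • p.d l :=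
    eq_neg_of_add_eq_zero_left (p.rel j)
  simp only [univ, map_sum, LinearMap.lTensor_tmul, TensorProduct.sum_tmul]
  rw [Finset.sum_comm]
  simp only [TensorProduct.smul_tmul, ← TensorProduct.tmul_sum, this, TensorProduct.tmul_neg]
  simp only [TensorProduct.tmul_sum, ← TensorProduct.smul_tmul, Finset.sum_neg_distrib]
  rw [Finset.sum_comm]
  simp only [← TensorProduct.sum_tmul, RowQuotient.relation, TensorProduct.zero_tmul,
    Finset.sum_const_zero, neg_zero]

/-- Linear maps from `Univ` to `W` are the solutions in `W` of the equations with matrix `b`. The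
universal element is only weakly universal: the map `g` need not be unique. -/
lemma exists_rTensor_univ {W : Type*} [AddCommGroup W] [Module A W] (x : W ⊗[A] M)
    (hx : LinearMap.lTensor W φ x = 0) :
    ∃ g : p.Univ →ₗ[A] W, x = LinearMap.rTensor M g p.univ := by
  obtain ⟨w, rfl⟩ := exists_sum_tmul_of_span_eq_top_right p.m p.span_m x
  obtain ⟨v, hv, hv'⟩ := p.exists_of_sum_tmul_eq_zero w (by simpa using hx)
  refine ⟨RowQuotient.desc _ v hv', ?_⟩
  simp [univ, ← hv]

end KernelPresentation

variable [IsNoetherianRing A] [Module.Finite A M] [Module.Finite A Q]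
  {P : Type u} [AddCommGroup P] [Module A P]

/-- A linear map which kills `Ker(W ⊗ M → W ⊗ Q)` for all `W` factors through `M → Q`. -/
theorem exists_comp_eq_of_ker_lTensor_le (φ : M →ₗ[A] Q) (ψ : M →ₗ[A] P)
    (h : ∀ (W : Type u) [AddCommGroup W] [Module A W] (x : W ⊗[A] M),
      LinearMap.lTensor W φ x = 0 → LinearMap.lTensor W ψ x = 0) :
    ∃ θ : Q →ₗ[A] P, θ.comp φ = ψ := by
  obtain ⟨p⟩ := KernelPresentation.nonempty φ
  have h0 := h _ p.univ p.lTensor_univ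
  simp only [KernelPresentation.univ, map_sum, LinearMap.lTensor_tmul, TensorProduct.sum_tmul] at h0
  rw [Finset.sum_comm] at h0
  simp only [TensorProduct.smul_tmul, ← TensorProduct.tmul_sum] at h0
  -- That `ψ` kills the universal element means `∑ a i j • ψ (m i) = ∑ b l j • s l`. Compared with
  -- `∑ a i j • φ (m i) = -∑ b l j • d l`, this forces the prescription `φ (m i) ↦ ψ (m i)`, `d l ↦
  -- -s l`.
  obtain ⟨s, hs⟩ := RowQuotient.exists_of_sum_tmul_eq_zero _ _ h0
  let L : (Fin p.n ⊕ Fin p.k → A) →ₗ[A] Q := Fintype.linearCombination A (Sum.elim (φ ∘ p.m) p.d)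
  let L' : (Fin p.n ⊕ Fin p.k → A) →ₗ[A] P := Fintype.linearCombination A (Sum.elim (ψ ∘ p.m) (-s))
  have hL : Function.Surjective L := by
    rw [← LinearMap.range_eq_top, Fintype.range_linearCombination, p.span_d]
  have hle : LinearMap.ker L ≤ LinearMap.ker L' := by
    intro c hc
    have hc' : ∑ i, c (.inl i) • φ (p.m i) + ∑ l, c (.inr l) • p.d l = 0 := by
      simpa [L, Fintype.linearCombination_apply] using hc
    obtain ⟨v, hv, hv'⟩ := p.exists_of_rel _ _ hc'
    have e1 : ∑ i, c (.inl i) • ψ (p.m i) = ∑ l, c (.inr l) • s l := by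
      simp only [hv, hv', Finset.sum_smul]
      rw [Finset.sum_comm, Finset.sum_comm (f := fun l j => (p.b l j * v j) • s l)]
      refine Finset.sum_congr rfl fun j _ => ?_
      simp only [mul_comm _ (v j), mul_smul, ← Finset.smul_sum, hs j]
    simp [L', Fintype.linearCombination_apply, e1]
  let e := L.quotKerEquivOfSurjective hL
  refine ⟨(Submodule.liftQ _ L' hle).comp e.symm.toLinearMap, ?_⟩
  have key (c) : (Submodule.liftQ _ L' hle) (e.symm (L c)) = L' c := by
    have : e.symm (L c) = Submodule.Quotient.mk c := by
      rw [LinearEquiv.symm_apply_eq]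
      rfl
    rw [this, Submodule.liftQ_apply]
  apply LinearMap.ext_on_range p.span_m
  intro i
  have := key (Pi.single (.inl i) 1)
  simpa [L, L', Fintype.linearCombination_apply, Pi.single_apply] using this

/-- A natural transformation from `W ↦ Ker(W ⊗ M → W ⊗ Q)` to `W ↦ W ⊗ P` is induced by a linear
map `M → P`. -/
theorem exists_lTensor_eq_of_natural (φ : M →ₗ[A] Q)
    (t : ∀ (W : Type u) [AddCommGroup W] [Module A W], W ⊗[A] M → W ⊗[A] P)
    (ht : ∀ (W W' : Type u) [AddCommGroup W] [Module A W] [AddCommGroup W'] [Module A W']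
      (g : W →ₗ[A] W') (x : W ⊗[A] M), LinearMap.lTensor W φ x = 0 →
      t W' (LinearMap.rTensor M g x) = LinearMap.rTensor P g (t W x)) :
    ∃ α : M →ₗ[A] P, ∀ (W : Type u) [AddCommGroup W] [Module A W] (x : W ⊗[A] M),
      LinearMap.lTensor W φ x = 0 → t W x = LinearMap.lTensor W α x := by
  obtain ⟨p⟩ := KernelPresentation.nonempty φ
  -- Additivity of `t` is not assumed; naturality along the zero map is enough.
  have t0 (W : Type u) [AddCommGroup W] [Module A W] : t W (0 : W ⊗[A] M) = 0 := by
    simpa using ht W W 0 0 (by simp)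
  obtain ⟨z, hz⟩ := exists_sum_tmul_of_span_eq_top_left _ (RowQuotient.span_gen p.b) (t _ p.univ)
  -- Imposing the rows of `a` besides those of `b` kills the universal element, hence its value
  -- under `t`. This expresses `z` through the rows of `a` and `b`. In `Univ ⊗ P` the part from `b`
  -- disappears, and the part from `a` is the universal element with `m i` replaced by `s (.inl i)`.
  let c : Fin p.n ⊕ Fin p.k → Fin p.r → A := Sum.elim p.a p.b
  let q : p.Univ →ₗ[A] RowQuotient c :=
    RowQuotient.desc _ (RowQuotient.gen c)
      (show ∀ l, ∑ j, p.b l j • RowQuotient.gen c j = 0 from fun l => RowQuotient.relation c (.inr l))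
  have hq : LinearMap.rTensor M q p.univ = 0 := by
    simp only [KernelPresentation.univ, map_sum, LinearMap.rTensor_tmul, map_smul, q,
      RowQuotient.desc_gen]
    refine Finset.sum_eq_zero fun i _ => ?_
    rw [show ∑ j, p.a i j • RowQuotient.gen c j = 0 from RowQuotient.relation c (.inl i),
      TensorProduct.zero_tmul]
  have hz0 : ∑ j, RowQuotient.gen c j ⊗ₜ[A] z j = 0 := by
    have := ht _ _ q p.univ p.lTensor_univ
    rw [hq, t0, hz] at this
    simpa [q] using this.symm
  obtain ⟨s, hs⟩ := RowQuotient.exists_of_sum_tmul_eq_zero _ _ hz0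
  have hs' (j) : z j = ∑ i, p.a i j • s (.inl i) + ∑ l, p.b l j • s (.inr l) := by
    simpa [c] using hs j
  have htu : t _ p.univ = ∑ i, (∑ j, p.a i j • RowQuotient.gen p.b j) ⊗ₜ s (.inl i) := by
    rw [hz]
    simp only [hs', TensorProduct.tmul_add, Finset.sum_add_distrib, TensorProduct.tmul_sum,
      ← TensorProduct.smul_tmul, TensorProduct.sum_tmul]
    rw [Finset.sum_comm, Finset.sum_comm (f := fun j l =>
      (p.b l j • RowQuotient.gen p.b j) ⊗ₜ[A] s (.inr l))]
    simp only [← TensorProduct.sum_tmul, RowQuotient.relation, TensorProduct.zero_tmul,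
      Finset.sum_const_zero, add_zero]
  let L : (Fin p.n → A) →ₗ[A] M := Fintype.linearCombination A p.m
  let L' : (Fin p.n → A) →ₗ[A] P := Fintype.linearCombination A (fun i => s (.inl i))
  have hL : Function.Surjective L := by
    rw [← LinearMap.range_eq_top, Fintype.range_linearCombination, p.span_m]
  have hle : LinearMap.ker L ≤ LinearMap.ker L' := by
    intro c hc
    have hc0 : ∑ i, c i • p.m i = 0 := by
      simpa [L, Fintype.linearCombination_apply] using hc
    obtain ⟨v, hv, hv'⟩ := p.exists_of_rel c 0 (by
      have := congrArg φ hc0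
      simpa using this)
    -- A relation `c` between the `m i` has the form `c = a v` with `b v = 0`. The map `g` given by
    -- `v` sends the universal element to `∑ c i ⊗ m i = 0`, and naturality turns this into `∑ c i •
    -- s (.inl i) = 0`: the map `m i ↦ s (.inl i)` is well defined.
    let g : p.Univ →ₗ[A] A := RowQuotient.desc _ v fun l => by simpa using (hv' l).symm
    have hg : LinearMap.rTensor M g p.univ = 0 := by
      simp only [KernelPresentation.univ, map_sum, LinearMap.rTensor_tmul, map_smul, g,
        RowQuotient.desc_gen, smul_eq_mul, ← hv]
      have h1 (i : Fin p.n) : c i ⊗ₜ[A] p.m i = (1 : A) ⊗ₜ (c i • p.m i) := by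
        rw [← TensorProduct.smul_tmul, smul_eq_mul, mul_one]
      simp only [h1, ← TensorProduct.tmul_sum, hc0, TensorProduct.tmul_zero]
    have h1 := ht _ _ g p.univ p.lTensor_univ
    rw [hg, t0, htu] at h1
    simp only [map_sum, LinearMap.rTensor_tmul, map_smul, g,
      RowQuotient.desc_gen, smul_eq_mul, ← hv] at h1
    have := congrArg (TensorProduct.lid A P) h1
    simpa [L', Fintype.linearCombination_apply] using this.symm
  let e := L.quotKerEquivOfSurjective hL
  let α : M →ₗ[A] P := (Submodule.liftQ _ L' hle).comp e.symm.toLinearMap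
  have hα (i) : α (p.m i) = s (.inl i) := by
    have h1 : e.symm (L (Pi.single i 1)) = Submodule.Quotient.mk (Pi.single i 1) := by
      rw [LinearEquiv.symm_apply_eq]
      rfl
    have h2 : L (Pi.single i 1) = p.m i := by
      simp [L, Fintype.linearCombination_apply, Pi.single_apply]
    rw [← h2, LinearMap.comp_apply, LinearEquiv.coe_coe, h1, Submodule.liftQ_apply]
    simp [L', Fintype.linearCombination_apply, Pi.single_apply]
  refine ⟨α, fun W _ _ x hx => ?_⟩
  obtain ⟨g, rfl⟩ := p.exists_rTensor_univ x hx
  rw [ht _ _ g p.univ p.lTensor_univ, htu]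
  simp [KernelPresentation.univ, hα]

end TensorKernels

end

/-! ### From functors on modules to functors on algebras -/

section

section AlgebraKernels

open TensorProduct

variable {A : Type u} [CommRing A] {M Q P : Type u} [AddCommGroup M] [Module A M]
  [AddCommGroup Q] [Module A Q] [AddCommGroup P] [Module A P]

lemma lTensor_rTensor_comm_apply {W W' : Type*} [AddCommGroup W] [Module A W] [AddCommGroup W']
    [Module A W'] (φ : M →ₗ[A] Q) (g : W →ₗ[A] W') (x : W ⊗[A] M) :
    LinearMap.lTensor W' φ (LinearMap.rTensor M g x) =
      LinearMap.rTensor Q g (LinearMap.lTensor W φ x) := by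
  rw [← LinearMap.comp_apply, ← LinearMap.comp_apply, LinearMap.lTensor_comp_rTensor,
    LinearMap.rTensor_comp_lTensor]

lemma lTensor_smul_algebra {B : Type*} [CommRing B] [Algebra A B] (φ : M →ₗ[A] Q) (b : B)
    (x : B ⊗[A] M) : LinearMap.lTensor B φ (b • x) = b • LinearMap.lTensor B φ x :=
  (LinearMap.baseChange B φ).map_smul b x

/-- The ring homomorphism from the trivial extension of `A` by an `A`-algebra `C` to the dual
numbers over `C`. -/
def trivExtToDual (A C : Type*) [CommRing A] [CommRing C] [Algebra A C] [Module Aᵐᵒᵖ C]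
    [IsCentralScalar A C] : TrivSqZeroExt A C →ₐ[A] TrivSqZeroExt C C where
  toFun x := TrivSqZeroExt.inl (algebraMap A C x.fst) + TrivSqZeroExt.inr x.snd
  map_one' := by ext <;> simp
  map_mul' x y := by
    ext
    · simp
    · simp only [TrivSqZeroExt.snd_add, TrivSqZeroExt.snd_mul, TrivSqZeroExt.snd_inl,
        TrivSqZeroExt.snd_inr, TrivSqZeroExt.fst_add, TrivSqZeroExt.fst_inl, TrivSqZeroExt.fst_inr,
        zero_add, add_zero, op_smul_eq_smul, smul_eq_mul, Algebra.smul_def]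
  map_zero' := by ext <;> simp
  map_add' x y := by ext <;> simp
  commutes' a := by
    ext <;> simp [TrivSqZeroExt.algebraMap_eq_inl']

/-- A natural transformation, on `A`-algebras `B`, from `Ker(B ⊗ M → B ⊗ Q)` to `B ⊗ P` which is
linear over `B` is induced by a linear map `M → P`. -/
theorem exists_lTensor_eq_of_natural_algebra [IsNoetherianRing A] [Module.Finite A M]
    [Module.Finite A Q] (φ : M →ₗ[A] Q)
    (t : ∀ (B : Type u) [CommRing B] [Algebra A B], B ⊗[A] M → B ⊗[A] P)
    (tsmul : ∀ (B : Type u) [CommRing B] [Algebra A B] (b : B) (x : B ⊗[A] M),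
      LinearMap.lTensor B φ x = 0 → t B (b • x) = b • t B x)
    (tnat : ∀ (B C : Type u) [CommRing B] [Algebra A B] [CommRing C] [Algebra A C]
      (g : B →ₐ[A] C) (x : B ⊗[A] M), LinearMap.lTensor B φ x = 0 →
      t C (LinearMap.rTensor M g.toLinearMap x) = LinearMap.rTensor P g.toLinearMap (t B x)) :
    ∃ α : M →ₗ[A] P, ∀ (B : Type u) [CommRing B] [Algebra A B] (x : B ⊗[A] M),
      LinearMap.lTensor B φ x = 0 → t B x = LinearMap.lTensor B α x := by
  -- The algebra structure on a trivial square-zero extension requires a right action, here the left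
  -- one again.
  let op (W : Type u) [AddCommGroup W] [Module A W] : Module Aᵐᵒᵖ W :=
    Module.compHom W ((RingHom.id A).fromOpposite mul_comm)
  have cen (W : Type u) [AddCommGroup W] [Module A W] : IsCentralScalar A W := ⟨fun _ _ => rfl⟩
  -- A module `W` is fed into `t` as the square-zero ideal of the algebra `A ⊕ W`.
  let t' (W : Type u) [AddCommGroup W] [Module A W] (x : W ⊗[A] M) : W ⊗[A] P :=
    LinearMap.rTensor P (TrivSqZeroExt.sndHom A W)
      (t (TrivSqZeroExt A W) (LinearMap.rTensor M (TrivSqZeroExt.inrHom A W) x))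
  obtain ⟨α, hα⟩ := exists_lTensor_eq_of_natural φ t' (by
    intro W W' _ _ _ _ g x hx
    have e1 : LinearMap.rTensor M (TrivSqZeroExt.inrHom A W') (LinearMap.rTensor M g x) =
        LinearMap.rTensor M (TrivSqZeroExt.map g).toLinearMap
          (LinearMap.rTensor M (TrivSqZeroExt.inrHom A W) x) := by
      rw [← LinearMap.rTensor_comp_apply, ← LinearMap.rTensor_comp_apply]
      congr 2
      ext <;> simp
    simp only [t']
    rw [e1, tnat _ _ _ _ (by rw [lTensor_rTensor_comm_apply, hx, map_zero]),
      ← LinearMap.rTensor_comp_apply, ← LinearMap.rTensor_comp_apply]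
    congr 2
    ext <;> simp)
  refine ⟨α, fun C _ _ x hx => ?_⟩
  rw [← hα C x hx]
  -- Over the dual numbers of `C`, the element `x` placed in the ideal is `ε` times `x` placed in
  -- `C`. Linearity of `t` over the dual numbers pulls `ε` out, which identifies `t' C` with `t C`.
  have e1 (x : C ⊗[A] M) : LinearMap.rTensor M (trivExtToDual A C).toLinearMap
      (LinearMap.rTensor M (TrivSqZeroExt.inrHom A C) x) =
      (TrivSqZeroExt.inr 1 : TrivSqZeroExt C C) •
        LinearMap.rTensor M (TrivSqZeroExt.inlAlgHom A C C).toLinearMap x := by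
    induction x with
    | zero => simp
    | add x y hx hy => simp only [map_add, smul_add, hx, hy]
    | tmul c m =>
      simp only [LinearMap.rTensor_tmul, TensorProduct.smul_tmul']
      congr 1
      ext <;> simp [trivExtToDual]
  have e2 (y : C ⊗[A] P) : LinearMap.rTensor P ((TrivSqZeroExt.sndHom C C).restrictScalars A)
      ((TrivSqZeroExt.inr 1 : TrivSqZeroExt C C) •
        LinearMap.rTensor P (TrivSqZeroExt.inlAlgHom A C C).toLinearMap y) = y := by
    induction y with
    | zero => simp
    | add x y hx hy => rw [map_add, smul_add, map_add, hx, hy]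
    | tmul c m =>
      simp only [LinearMap.rTensor_tmul, TensorProduct.smul_tmul']
      congr 1
      simp
  have e3 (y : TrivSqZeroExt A C ⊗[A] P) : LinearMap.rTensor P (TrivSqZeroExt.sndHom A C) y =
      LinearMap.rTensor P ((TrivSqZeroExt.sndHom C C).restrictScalars A)
        (LinearMap.rTensor P (trivExtToDual A C).toLinearMap y) := by
    rw [← LinearMap.rTensor_comp_apply]
    congr 2
    ext <;> simp [trivExtToDual]
  simp only [t']
  rw [e3, ← tnat _ _ _ _ (by rw [lTensor_rTensor_comm_apply, hx, map_zero]), e1,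
    tsmul _ _ _ (by rw [lTensor_rTensor_comm_apply, hx, map_zero]), tnat _ _ _ _ hx, e2]

/-- A linear map which kills `Ker(B ⊗ M → B ⊗ Q)` for all `A`-algebras `B` factors through
`M → Q`. -/
theorem exists_comp_eq_of_ker_lTensor_algebra_le [IsNoetherianRing A] [Module.Finite A M]
    [Module.Finite A Q] (φ : M →ₗ[A] Q) (ψ : M →ₗ[A] P)
    (h : ∀ (B : Type u) [CommRing B] [Algebra A B] (x : B ⊗[A] M),
      LinearMap.lTensor B φ x = 0 → LinearMap.lTensor B ψ x = 0) :
    ∃ θ : Q →ₗ[A] P, θ.comp φ = ψ := by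
  let op (W : Type u) [AddCommGroup W] [Module A W] : Module Aᵐᵒᵖ W :=
    Module.compHom W ((RingHom.id A).fromOpposite mul_comm)
  have cen (W : Type u) [AddCommGroup W] [Module A W] : IsCentralScalar A W := ⟨fun _ _ => rfl⟩
  -- `W ⊗ P` is a direct summand of `(A ⊕ W) ⊗ P`, so the hypothesis for the algebra `A ⊕ W` gives
  -- the one for the module `W`.
  refine exists_comp_eq_of_ker_lTensor_le φ ψ fun W _ _ x hx => ?_
  have h1 := h (TrivSqZeroExt A W) (LinearMap.rTensor M (TrivSqZeroExt.inrHom A W) x)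
    (by rw [lTensor_rTensor_comm_apply, hx, map_zero])
  rw [lTensor_rTensor_comm_apply] at h1
  have h2 := congrArg (LinearMap.rTensor P (TrivSqZeroExt.sndHom A W)) h1
  rw [← LinearMap.rTensor_comp_apply, map_zero] at h2
  have h3 : (TrivSqZeroExt.sndHom A W).comp (TrivSqZeroExt.inrHom A W) = LinearMap.id := by
    ext
    simp
  rwa [h3, LinearMap.rTensor_id_apply] at h2

/-- The image of `Ker(W ⊗ M → W ⊗ Q)` in `W ⊗ P` is the kernel of `W ⊗ P → W ⊗ T`, where `T` is the
pushout of `Q ← M → P`. -/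
theorem exists_ker_lTensor_eq_map_ker [Module.Finite A Q] [Module.Finite A P] (φ : M →ₗ[A] Q)
    (α : M →ₗ[A] P) :
    ∃ (T : Type u) (_ : AddCommGroup T) (_ : Module A T) (_ : Module.Finite A T) (τ : P →ₗ[A] T),
      ∀ (W : Type u) [AddCommGroup W] [Module A W] (y : W ⊗[A] P),
        LinearMap.lTensor W τ y = 0 ↔
          ∃ x : W ⊗[A] M, LinearMap.lTensor W φ x = 0 ∧ LinearMap.lTensor W α x = y := by
  -- With `T` the cokernel of `(φ, α)`, right exactness says that `y` dies in `W ⊗ T` exactly when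
  -- `(0, y)` comes from some `x`, that is, when `x` has image `0` under `φ` and `y` under `α`.
  let f : M →ₗ[A] Q × P := φ.prod α
  let q := (LinearMap.range f).mkQ
  refine ⟨(Q × P) ⧸ LinearMap.range f, inferInstance, inferInstance, inferInstance,
    q.comp (LinearMap.inr A Q P), fun W _ _ y => ?_⟩
  have hex := lTensor_exact W (LinearMap.exact_map_mkQ_range f) (Submodule.mkQ_surjective _)
  have hfst (x : W ⊗[A] M) : LinearMap.lTensor W (LinearMap.fst A Q P) (LinearMap.lTensor W f x) =
      LinearMap.lTensor W φ x := by
    rw [← LinearMap.lTensor_comp_apply]; rfl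
  have hsnd (x : W ⊗[A] M) : LinearMap.lTensor W (LinearMap.snd A Q P) (LinearMap.lTensor W f x) =
      LinearMap.lTensor W α x := by
    rw [← LinearMap.lTensor_comp_apply]; rfl
  have hfst' : LinearMap.lTensor W (LinearMap.fst A Q P)
      (LinearMap.lTensor W (LinearMap.inr A Q P) y) = 0 := by
    rw [← LinearMap.lTensor_comp_apply, LinearMap.fst_comp_inr, LinearMap.lTensor_zero]; rfl
  have hsnd' : LinearMap.lTensor W (LinearMap.snd A Q P)
      (LinearMap.lTensor W (LinearMap.inr A Q P) y) = y := by
    rw [← LinearMap.lTensor_comp_apply, LinearMap.snd_comp_inr, LinearMap.lTensor_id_apply]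
  rw [LinearMap.lTensor_comp_apply]
  refine (hex _).trans ⟨?_, ?_⟩
  · rintro ⟨x, hx⟩
    exact ⟨x, by rw [← hfst, hx, hfst'], by rw [← hsnd, hx, hsnd']⟩
  · rintro ⟨x, hx, rfl⟩
    refine ⟨x, ?_⟩
    have key (z : W ⊗[A] (Q × P)) : z =
        LinearMap.lTensor W (LinearMap.inl A Q P) (LinearMap.lTensor W (LinearMap.fst A Q P) z) +
        LinearMap.lTensor W (LinearMap.inr A Q P)
          (LinearMap.lTensor W (LinearMap.snd A Q P) z) := by
      rw [← LinearMap.lTensor_comp_apply, ← LinearMap.lTensor_comp_apply, ← LinearMap.add_apply,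
        ← LinearMap.lTensor_add]
      convert (LinearMap.lTensor_id_apply W (Q × P) z).symm using 3
      ext <;> simp
    rw [key (LinearMap.lTensor W f x), hfst, hx, map_zero, zero_add, hsnd]

end AlgebraKernels

end

/-! ### Sections of module-valued functors; inverse images and open immersions -/

section

variable {X : Scheme.{u}}

namespace ModuleFunctor

/-- The module of values of a module-valued `X`-functor on an `X`-scheme. -/
def Sec (F : ModuleFunctor X) (Y : Over X) : Type u := F.obj (op Y)

variable (F G H : ModuleFunctor X) {W Y Z : Over X}

instance : AddCommGroup (F.Sec Y) := inferInstanceAs (AddCommGroup (F.obj (op Y)))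

instance : Module Γ(Y.left, ⊤) (F.Sec Y) :=
  inferInstanceAs (Module ((globalSections X).obj (op Y)) (F.obj (op Y)))

/-- The transition map of a module-valued functor. -/
def res (g : Z ⟶ Y) : F.Sec Y →+ F.Sec Z where
  toFun x := F.map g.op x
  map_zero' := map_zero (F.map g.op).hom
  map_add' := map_add (F.map g.op).hom

lemma res_smul (g : Z ⟶ Y) (r : Γ(Y.left, ⊤)) (x : F.Sec Y) :
    F.res g (r • x) = g.left.appTop r • F.res g x :=
  F.map_smul g.op r x

@[simp]
lemma res_id (x : F.Sec Y) : F.res (𝟙 Y) x = x :=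
  ConcreteCategory.congr_hom (F.presheaf.map_id (op Y)) x

lemma res_comp (h : W ⟶ Z) (g : Z ⟶ Y) (x : F.Sec Y) : F.res (h ≫ g) x = F.res h (F.res g x) :=
  ConcreteCategory.congr_hom (F.presheaf.map_comp g.op h.op) x

lemma res_bijective (g : Z ⟶ Y) [IsIso g] : Function.Bijective (F.res g) := by
  refine Function.bijective_iff_has_inverse.2 ⟨F.res (inv g), fun x => ?_, fun x => ?_⟩
  · rw [← res_comp, IsIso.inv_hom_id, res_id]
  · rw [← res_comp, IsIso.hom_inv_id, res_id]

variable {F G H}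

/-- The value of a morphism of module-valued functors at an `X`-scheme. -/
def ev (t : F ⟶ G) (Y : Over X) : F.Sec Y →ₗ[Γ(Y.left, ⊤)] G.Sec Y := (t.app (op Y)).hom

lemma ev_res (t : F ⟶ G) (g : Z ⟶ Y) (x : F.Sec Y) : ev t Z (F.res g x) = G.res g (ev t Y x) :=
  PresheafOfModules.naturality_apply t g.op x

@[simp]
lemma ev_comp (t : F ⟶ G) (s : G ⟶ H) (x : F.Sec Y) : ev (t ≫ s) Y x = ev s Y (ev t Y x) := rfl

@[simp]
lemma ev_id (x : F.Sec Y) : ev (𝟙 F) Y x = x := rfl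

lemma hom_ext {t s : F ⟶ G} (h : ∀ (Y : Over X) (x : F.Sec Y), ev t Y x = ev s Y x) : t = s := by
  ext Y x
  exact h Y.unop x

/-- Construction of a morphism of module-valued functors from its values. -/
def mkHom (f : ∀ Y : Over X, F.Sec Y →ₗ[Γ(Y.left, ⊤)] G.Sec Y)
    (hf : ∀ {Y Z : Over X} (g : Z ⟶ Y) (x : F.Sec Y), f Z (F.res g x) = G.res g (f Y x)) :
    F ⟶ G where
  app Y := ModuleCat.ofHom (f Y.unop)
  naturality g := by
    ext x
    exact hf g.unop x

lemma isIso_of_bijective (t : F ⟶ G) (h : ∀ Y, Function.Bijective (ev t Y)) : IsIso t := by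
  let e (Y : Over X) := LinearEquiv.ofBijective (ev t Y) (h Y)
  refine ⟨mkHom (fun Y => (e Y).symm.toLinearMap) ?_, ?_, ?_⟩
  · intro Y Z g x
    obtain ⟨x, rfl⟩ := (e Y).surjective x
    simp only [LinearEquiv.coe_coe, LinearEquiv.symm_apply_apply]
    rw [LinearEquiv.symm_apply_eq]
    exact (ev_res t g x).symm
  · exact hom_ext fun Y x => (e Y).symm_apply_apply x
  · exact hom_ext fun Y x => (e Y).apply_symm_apply x

end ModuleFunctor

section Unit

open Scheme.Modules

variable {X Y Z : Scheme.{u}}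

/-- The unit of the adjunction between inverse and direct image, on sections. -/
def pullUnit (f : Y ⟶ X) (M : X.Modules) (V : X.Opens) (x : Γ(M, V)) :
    Γ((Scheme.Modules.pullback f).obj M, f ⁻¹ᵁ V) :=
  ((pullbackPushforwardAdjunction f).unit.app M).app V x

/-- For an open immersion `g`, the adjunction between `M ↦ (f^* M)|_Z` and `(f ∘ g)_*`. -/
def restrictCompAdjunction (g : Z ⟶ Y) [IsOpenImmersion g] (f : Y ⟶ X) :
    Scheme.Modules.pullback f ⋙ restrictFunctor g ⊣ pushforward (g ≫ f) :=
  ((pullbackPushforwardAdjunction f).comp (restrictAdjunction g)).ofNatIsoRight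
    (pushforwardComp g f)

/-- For an open immersion `g`, the isomorphism `(f ∘ g)^* M ≅ (f^* M)|_Z`. -/
def pullbackRestrictIso (g : Z ⟶ Y) [IsOpenImmersion g] (f : Y ⟶ X) :
    Scheme.Modules.pullback f ⋙ restrictFunctor g ≅ Scheme.Modules.pullback (g ≫ f) :=
  (restrictCompAdjunction g f).leftAdjointUniq (pullbackPushforwardAdjunction (g ≫ f))

/-- The isomorphism between two left adjoints of the same functor intertwines their units. This is
the only information about it that is used later, since inverse images of sections determine
morphisms out of an inverse image. -/
lemma pullbackRestrictIso_pullUnit (g : Z ⟶ Y) [IsOpenImmersion g] (f : Y ⟶ X) (M : X.Modules)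
    (V : X.Opens) (x : Γ(M, V)) :
    ((pullbackRestrictIso g f).hom.app M).app (g ⁻¹ᵁ f ⁻¹ᵁ V)
      (((Scheme.Modules.pullback f).obj M).presheaf.map (homOfLE (g.image_preimage_le (f ⁻¹ᵁ V))).op
        (pullUnit f M V x)) =
      pullUnit (g ≫ f) M V x := by
  have h := Adjunction.unit_leftAdjointUniq_hom_app
    (restrictCompAdjunction g f) (pullbackPushforwardAdjunction (g ≫ f)) M
  exact congr(Scheme.Modules.Hom.app $h V x)

/-- For an open immersion `i` to the target, the adjunction between `M ↦ g^* (M|_Y)` and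
`(i ∘ g)_*`. -/
def pullbackOpenAdjunction (g : Z ⟶ Y) (i : Y ⟶ X) [IsOpenImmersion i] :
    restrictFunctor i ⋙ Scheme.Modules.pullback g ⊣ pushforward (g ≫ i) :=
  ((restrictAdjunction i).comp (pullbackPushforwardAdjunction g)).ofNatIsoRight
    (pushforwardComp g i)

/-- For an open immersion `i`, the isomorphism `(i ∘ g)^* M ≅ g^* (M|_Y)`. -/
def pullbackOpenIso (g : Z ⟶ Y) (i : Y ⟶ X) [IsOpenImmersion i] :
    Scheme.Modules.pullback (g ≫ i) ≅ restrictFunctor i ⋙ Scheme.Modules.pullback g :=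
  (pullbackPushforwardAdjunction (g ≫ i)).leftAdjointUniq (pullbackOpenAdjunction g i)

lemma pullbackOpenIso_pullUnit (g : Z ⟶ Y) (i : Y ⟶ X) [IsOpenImmersion i] (M : X.Modules)
    (V : X.Opens) (x : Γ(M, V)) :
    ((pullbackOpenIso g i).hom.app M).app ((g ≫ i) ⁻¹ᵁ V) (pullUnit (g ≫ i) M V x) =
      pullUnit g (M.restrict i) (i ⁻¹ᵁ V)
        (M.presheaf.map (homOfLE (i.image_preimage_le V)).op x) := by
  have h := Adjunction.unit_leftAdjointUniq_hom_app
    (pullbackPushforwardAdjunction (g ≫ i)) (pullbackOpenAdjunction g i) M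
  exact congr(Scheme.Modules.Hom.app $h V x)

end Unit

section OpenImmersion

/-- For an open immersion `g`, the isomorphism `h^* M ≅ (f^* M)|_Z` if `h` is the composition of `f`
and `g`. -/
def pullbackRestrictIso' {X Y Z : Scheme.{u}} {g : Z ⟶ Y} [IsOpenImmersion g] {f : Y ⟶ X}
    {h : Z ⟶ X} (w : g ≫ f = h) :
    Scheme.Modules.pullback f ⋙ Scheme.Modules.restrictFunctor g ≅ Scheme.Modules.pullback h :=
  pullbackRestrictIso g f ≪≫ Scheme.Modules.pullbackCongr w

lemma pullbackRestrictIso'_pullUnit {X Y Z : Scheme.{u}} {g : Z ⟶ Y} [IsOpenImmersion g]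
    {f : Y ⟶ X} {h : Z ⟶ X} (w : g ≫ f = h) (M : X.Modules) (V : X.Opens) (x : Γ(M, V)) :
    ((pullbackRestrictIso' w).hom.app M).app (g ⁻¹ᵁ f ⁻¹ᵁ V)
      (((Scheme.Modules.pullback f).obj M).presheaf.map
        (homOfLE (g.image_preimage_le (f ⁻¹ᵁ V))).op (pullUnit f M V x)) =
      ((Scheme.Modules.pullback h).obj M).presheaf.map
        (homOfLE (by subst w; exact le_rfl)).op (pullUnit h M V x) := by
  subst w
  refine Eq.trans ?_ (map_eq_self ((Scheme.Modules.pullback (g ≫ f)).obj M) (𝟙 _) _).symm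
  exact pullbackRestrictIso_pullUnit g f M V x

/-- The isomorphism `M_Y|_Z ≅ M_Z` for an open immersion `Z ⟶ Y` of `X`-schemes. -/
def overRestrictIso (M : X.Modules) {Y Z : Over X} (g : Z ⟶ Y) [IsOpenImmersion g.left] :
    (Scheme.Modules.restrictFunctor g.left).obj ((Scheme.Modules.pullback Y.hom).obj M) ≅
      (Scheme.Modules.pullback Z.hom).obj M :=
  (pullbackRestrictIso' (X := X) (Y := Y.left) (Z := Z.left) (g := g.left) (f := Y.hom)
    (h := Z.hom) (Over.w g)).app M

lemma pullSection_eq_pullUnit (M : X.Modules) (Y : Over X) (V : X.Opens) (x : Γ(M, V)) :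
    pullSection M Y V x = pullUnit (X := X) Y.hom M V x := rfl

lemma overRestrictIso_hom (M : X.Modules) {Y Z : Over X} (g : Z ⟶ Y)
    [IsOpenImmersion g.left] : (overRestrictIso M g).hom =
    (pullbackRestrictIso' (X := X) (Y := Y.left) (Z := Z.left) (g := g.left) (f := Y.hom)
    (h := Z.hom) (Over.w g)).hom.app M := rfl

lemma overRestrictIso_pullSection (M : X.Modules) {Y Z : Over X} (g : Z ⟶ Y)
    [IsOpenImmersion g.left] (V : X.Opens) (x : Γ(M, V)) :
    (overRestrictIso M g).hom.app (g.left ⁻¹ᵁ Y.hom ⁻¹ᵁ V)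
      (((Scheme.Modules.pullback Y.hom).obj M).presheaf.map
        (homOfLE (g.left.image_preimage_le (Y.hom ⁻¹ᵁ V))).op (pullSection M Y V x)) =
    ((Scheme.Modules.pullback Z.hom).obj M).presheaf.map
        (homOfLE (by rw [← Over.w g]; exact le_rfl)).op (pullSection M Z V x) := by
  rw [overRestrictIso_hom, pullSection_eq_pullUnit, pullSection_eq_pullUnit]
  have := pullbackRestrictIso'_pullUnit (X := X) (Over.w g) M V x
  exact this

lemma restrictAdjunction_unit_comp_app {Y Z : Scheme.{u}} (g : Z ⟶ Y) [IsOpenImmersion g]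
    {N : Y.Modules} {P : Z.Modules} (e : (Scheme.Modules.restrictFunctor g).obj N ⟶ P)
    (W : Y.Opens) (x : Γ(N, W)) :
    ((Scheme.Modules.restrictAdjunction g).unit.app N ≫
        (Scheme.Modules.pushforward g).map e).app W x =
      e.app (g ⁻¹ᵁ W) (N.presheaf.map (homOfLE (g.image_preimage_le W)).op x) := rfl

/-- Morphisms out of an inverse image are determined on inverse images of sections
(`pullback_hom_ext`), where both sides give the inverse image under `Z ⟶ X`. -/
lemma comparison_eq (M : X.Modules) {Y Z : Over X} (g : Z ⟶ Y) [IsOpenImmersion g.left] :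
    comparison M g =
      (Scheme.Modules.restrictAdjunction g.left).unit.app
          ((Scheme.Modules.pullback Y.hom).obj M) ≫
        (Scheme.Modules.pushforward g.left).map (overRestrictIso M g).hom := by
  apply pullback_hom_ext
  intro V x
  have h := restrictAdjunction_unit_comp_app g.left (overRestrictIso M g).hom (Y.hom ⁻¹ᵁ V)
    (pullSection M Y V x)
  exact (comparison_pullSection M g V x).trans
    ((overRestrictIso_pullSection M g V x).symm.trans h.symm)

/-- The unit of restriction to `Z` is, on `W`, the restriction of sections from `W` to `W`
intersected with the image of `Z`, which is `W` itself. -/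
lemma comparison_app_bijective (M : X.Modules) {Y Z : Over X} (g : Z ⟶ Y)
    [IsOpenImmersion g.left] (W : Y.left.Opens) (hW : W ≤ g.left.opensRange) :
    Function.Bijective ((comparison M g).app W) := by
  rw [comparison_eq]
  have h1 : IsIso (((Scheme.Modules.pushforward g.left).map
      ((overRestrictIso M g).hom)).app W) := inferInstance
  have h2 : IsIso (((Scheme.Modules.restrictAdjunction g.left).unit.app
      ((Scheme.Modules.pullback Y.hom).obj M)).app W) := by
    rw [Scheme.Modules.restrictAdjunction_unit_app_app]
    have : IsIso (homOfLE (g.left.image_preimage_le W)) := by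
      have e : g.left ''ᵁ g.left ⁻¹ᵁ W = W := by
        rw [Scheme.Hom.image_preimage_eq_opensRange_inf]
        exact inf_eq_right.2 hW
      exact ⟨homOfLE e.ge, rfl, rfl⟩
    exact inferInstanceAs (IsIso (((Scheme.Modules.pullback Y.hom).obj M).presheaf.map _))
  exact ConcreteCategory.bijective_of_isIso
    (((Scheme.Modules.restrictAdjunction g.left).unit.app
      ((Scheme.Modules.pullback Y.hom).obj M)).app W ≫ ((Scheme.Modules.pushforward g.left).map
      ((overRestrictIso M g).hom)).app W)

end OpenImmersion

end

/-! ### Gluing of sections; `underline M` is a Zariski sheaf -/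

section

variable {X : Scheme.{u}}

namespace ModuleFunctor

/-- The sheaf condition for open covers, indexed by the points of the scheme. -/
def IsLocal (F : ModuleFunctor X) : Prop :=
  ∀ (Y : Over X) (Z : Y.left → Over X) (g : ∀ y, Z y ⟶ Y), (∀ y, IsOpenImmersion (g y).left) →
    (∀ y, y ∈ Set.range (g y).left) → ∀ s : ∀ y, F.Sec (Z y),
    (∀ (i j : Y.left) (W : Over X) (a : W ⟶ Z i) (b : W ⟶ Z j), a ≫ g i = b ≫ g j →
      F.res a (s i) = F.res b (s j)) → ∃! t : F.Sec Y, ∀ y, F.res (g y) t = s y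

/-- The forgetful functor on abelian groups is represented by `ULift ℤ`, so the sheaf condition
tested on this group is the sheaf condition for the underlying sets. -/
lemma IsZariskiSheaf.isLocal {F : ModuleFunctor X} (hF : F.IsZariskiSheaf) : F.IsLocal := by
  intro Y Z g hg hgs s hs
  have h2 := Presieve.isSheaf_iso _ (Functor.isoWhiskerLeft F.presheaf
    AddCommGrpCat.coyonedaObjIsoForget) (hF (AddCommGrpCat.of (ULift ℤ)))
  have h3 : Sieve.generate (Presieve.ofArrows Z g) ∈ (Scheme.zariskiTopology.{u}.over X) Y := by
    rw [GrothendieckTopology.mem_over_iff]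
    refine (congrArg (· ∈ Scheme.zariskiTopology.{u} Y.left) (Sieve.overEquiv_ofArrows Z g)).mpr ?_
    refine Precoverage.generate_mem_toGrothendieck ?_
    rw [Scheme.ofArrows_mem_precoverage_iff]
    exact ⟨fun x => ⟨x, hgs x⟩, hg⟩
  have h4 := (Presieve.isSheafFor_iff_generate _).2 (h2 _ h3)
  exact Presieve.isSheafFor_arrows_iff _ _ |>.1 h4 s hs

namespace IsLocal

variable {F : ModuleFunctor X} (hF : F.IsLocal)

include hF in
lemma eq_of_locally_eq {Y : Over X} {s t : F.Sec Y}
    (h : ∀ y : Y.left, ∃ (Z : Over X) (g : Z ⟶ Y), IsOpenImmersion g.left ∧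
      y ∈ Set.range g.left ∧ F.res g s = F.res g t) : s = t := by
  choose Z g hg hy he using h
  refine (hF Y Z g hg hy (fun y => F.res (g y) s) fun i j W a b w => ?_).unique (fun _ => rfl)
    fun y => (he y).symm
  rw [← res_comp, ← res_comp, w]

include hF in
/-- Gluing of sections which are locally determined by a property. -/
lemma exists_of_locally {Y : Over X} (P : ∀ {Z : Over X}, (Z ⟶ Y) → F.Sec Z → Prop)
    (hres : ∀ {Z W : Over X} (g : Z ⟶ Y) (h : W ⟶ Z) (s : F.Sec Z), P g s → P (h ≫ g) (F.res h s))
    (huniq : ∀ {Z : Over X} (g : Z ⟶ Y) (s t : F.Sec Z), P g s → P g t → s = t)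
    (hex : ∀ y : Y.left, ∃ (Z : Over X) (g : Z ⟶ Y), IsOpenImmersion g.left ∧
      y ∈ Set.range g.left ∧ ∃ s, P g s) :
    ∃ t : F.Sec Y, ∀ y : Y.left, ∃ (Z : Over X) (g : Z ⟶ Y), IsOpenImmersion g.left ∧
      y ∈ Set.range g.left ∧ P g (F.res g t) := by
  choose Z g hg hy s hs using hex
  obtain ⟨t, ht, -⟩ := hF Y Z g hg hy s fun i j W a b w =>
    huniq (a ≫ g i) _ _ (hres _ _ _ (hs i)) (w ▸ hres _ _ _ (hs j))
  exact ⟨t, fun y => ⟨Z y, g y, hg y, hy y, (ht y).symm ▸ hs y⟩⟩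

end IsLocal

end ModuleFunctor

section Underline

/-- The argument of `comparison_comp_app` on all open subsets instead of the whole scheme, as needed
to glue over an open cover of `Y`. -/
lemma comparison_app_comp (M : X.Modules) {W Z Y : Over X} (h : W ⟶ Z) (g : Z ⟶ Y)
    (V : Y.left.Opens) (x : Γ((Scheme.Modules.pullback Y.hom).obj M, V)) :
    (comparison M (h ≫ g)).app V x =
      (comparison M h).app (g.left ⁻¹ᵁ V) ((comparison M g).app V x) := by
  have : comparison M (h ≫ g) = comparison M g ≫
      (Scheme.Modules.pushforward g.left).map (comparison M h) ≫
        (Scheme.Modules.pushforwardComp h.left g.left).hom.app _ ≫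
          (Scheme.Modules.pushforwardCongr (Over.comp_left _ _ _ h g).symm).hom.app _ := by
    apply pullback_hom_ext
    intro V x
    refine (comparison_pullSection M (h ≫ g) V x).trans ?_
    change _ = ((Scheme.Modules.pullback W.hom).obj M).presheaf.map (eqToHom (by rfl)).op
      ((comparison M h).app (g.left ⁻¹ᵁ Y.hom ⁻¹ᵁ V)
        ((comparison M g).app (Y.hom ⁻¹ᵁ V) (pullSection M Y V x)))
    rw [comparison_pullSection]
    have e : g.left ⁻¹ᵁ Y.hom ⁻¹ᵁ V ≤ Z.hom ⁻¹ᵁ V := by rw [← Over.w g]; exact le_rfl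
    have nat := app_map (comparison M h) (homOfLE e) (pullSection M Z V x)
    rw [nat, comparison_pullSection]
    refine (map_map ((Scheme.Modules.pullback W.hom).obj M) _ (homOfLE ?_) _).symm.trans
      (congrArg _ (map_map ((Scheme.Modules.pullback W.hom).obj M) _ (homOfLE ?_) _).symm)
    · exact le_rfl
    · exact fun y hy => e hy
  rw [this]
  exact map_eq_self ((Scheme.Modules.pullback W.hom).obj M) (𝟙 _) _

lemma underline_res (M : X.Modules) {Z Y : Over X} (g : Z ⟶ Y)
    (x : Γ((Scheme.Modules.pullback Y.hom).obj M, ⊤)) :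
    ((underline X).obj M).res g x = (comparison M g).app ⊤ x := rfl

lemma comparison_map (M : X.Modules) {Z Y : Over X} (g : Z ⟶ Y) {U V : Y.left.Opens} (h : U ≤ V)
    (x : Γ((Scheme.Modules.pullback Y.hom).obj M, V)) :
    (comparison M g).app U (((Scheme.Modules.pullback Y.hom).obj M).presheaf.map (homOfLE h).op x) =
      ((Scheme.Modules.pullback Z.hom).obj M).presheaf.map
        (homOfLE (g.left.preimage_mono h)).op ((comparison M g).app V x) :=
  app_map (comparison M g) (homOfLE h) x

lemma map_bijective_of_eq {Y : Scheme.{u}} (M : Y.Modules) {U V : Y.Opens} (h : U ≤ V) (h' : V ≤ U) :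
    Function.Bijective (M.presheaf.map (homOfLE h).op) := by
  have : IsIso (homOfLE h) := ⟨homOfLE h', rfl, rfl⟩
  exact ConcreteCategory.bijective_of_isIso (M.presheaf.map (homOfLE h).op)

lemma comparison_app_of_comp (M : X.Modules) {W Z Y : Over X} {a : W ⟶ Z} {g : Z ⟶ Y} {w : W ⟶ Y}
    (ha : a ≫ g = w) {I U : Y.left.Opens} (hI : I ≤ U)
    (x : Γ((Scheme.Modules.pullback Y.hom).obj M, U))
    (s : Γ((Scheme.Modules.pullback Z.hom).obj M, ⊤))
    (hx : (comparison M g).app U x = ((Scheme.Modules.pullback Z.hom).obj M).presheaf.map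
      (homOfLE le_top : g.left ⁻¹ᵁ U ⟶ ⊤).op s) :
    (comparison M w).app I
        (((Scheme.Modules.pullback Y.hom).obj M).presheaf.map (homOfLE hI).op x) =
      ((Scheme.Modules.pullback W.hom).obj M).presheaf.map (homOfLE le_top).op
        ((comparison M a).app ⊤ s) := by
  subst ha
  have e := comparison_app_comp M a g I
    (((Scheme.Modules.pullback Y.hom).obj M).presheaf.map (homOfLE hI).op x)
  have e' := (comparison_map M g hI x).trans (congrArg _ hx)
  refine e.trans ((congrArg ((comparison M a).app (g.left ⁻¹ᵁ I))
    (e'.trans (map_map _ _ _ _))).trans ?_)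
  exact app_map (comparison M a) _ s

/-- Since `comparison` is bijective over the image of an open immersion, a section on `Z y` is the
same as a section of the single sheaf `M_Y` on the image of `Z y`, and these are glued in `M_Y`. -/
lemma underline_isLocal (M : X.Modules) : ((underline X).obj M).IsLocal := by
  intro Y Z g hg hy s hs
  let N := (Scheme.Modules.pullback Y.hom).obj M
  let U (y : Y.left) : Y.left.Opens := (g y).left.opensRange
  have htop (y) : (g y).left ⁻¹ᵁ U y = ⊤ := (g y).left.preimage_opensRange
  have hb (y) : Function.Bijective ((comparison M (g y)).app (U y)) :=
    comparison_app_bijective M (g y) (U y) le_rfl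
  let S : ∀ y, Γ((Scheme.Modules.pullback (Z y).hom).obj M, ⊤) := s
  choose sf hsf using fun y => (hb y).2 (((Scheme.Modules.pullback (Z y).hom).obj M).presheaf.map
    (homOfLE le_top : (g y).left ⁻¹ᵁ U y ⟶ ⊤).op (S y))
  have hcov : (⊤ : Y.left.Opens) ≤ iSup U := fun y _ =>
    TopologicalSpace.Opens.mem_iSup.2 ⟨y, hy y⟩
  have key (y) (t : Γ(N, ⊤)) : ((underline X).obj M).res (g y) t = s y ↔
      N.presheaf.map (homOfLE le_top : U y ⟶ ⊤).op t = sf y := by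
    rw [← (hb y).1.eq_iff, hsf, comparison_map, underline_res]
    exact ((map_bijective_of_eq _ _ (htop y).ge).1.eq_iff).symm
  have := TopCat.Sheaf.existsUnique_gluing' (C := Ab.{u}) ⟨N.presheaf, N.isSheaf⟩ U ⊤
    (fun y => homOfLE le_top) hcov sf ?_
  · exact (existsUnique_congr fun t => forall_congr' fun y => key y t).2 this
  -- Agreement on `U i ⊓ U j` is tested on this open subset as an `X`-scheme, which maps to both `Z
  -- i` and `Z j` over `Y`.
  · intro i j
    let I : Y.left.Opens := U i ⊓ U j
    let W : Over X := Over.mk (I.ι ≫ Y.hom)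
    let w : W ⟶ Y := Over.homMk I.ι
    have hw : IsOpenImmersion w.left := inferInstanceAs (IsOpenImmersion I.ι)
    have hI : I.ι.opensRange = I := I.opensRange_ι
    have lift (k : Y.left) (hk : I ≤ U k) : ∃ a : W ⟶ Z k, a ≫ g k = w := by
      have := hg k
      have h0 : Set.range I.ι ⊆ Set.range (g k).left := by
        rw [I.range_ι]; exact hk
      refine ⟨Over.homMk (IsOpenImmersion.lift (g k).left I.ι h0) ?_, ?_⟩
      · rw [← Over.w (g k), IsOpenImmersion.lift_fac_assoc]; rfl
      · ext1; exact IsOpenImmersion.lift_fac _ _ _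
    obtain ⟨a, ha⟩ := lift i inf_le_left
    obtain ⟨b, hb'⟩ := lift j inf_le_right
    apply (comparison_app_bijective M w I hI.ge).1
    refine (comparison_app_of_comp M ha inf_le_left (sf i) (S i) (hsf i)).trans ((congrArg _ (hs i j W a b (ha.trans hb'.symm))).trans ?_)
    exact (comparison_app_of_comp M hb' inf_le_right (sf j) (S j) (hsf j)).symm

end Underline

end

/-! ### Inverse images along morphisms of spectra -/

section

section SpecBaseChange

variable {R S : CommRingCat.{u}} (φ : R ⟶ S)

/-- The adjunction between `T ↦ (S ⊗ T)~` and taking global sections as an `R`-module. -/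
def extendTildeAdjunction : ModuleCat.extendScalars φ.hom ⋙ tilde.functor S ⊣
    moduleSpecΓFunctor (R := S) ⋙ ModuleCat.restrictScalars φ.hom :=
  (ModuleCat.extendRestrictScalarsAdj φ.hom).comp tilde.adjunction

/-- Global sections are compatible with direct images of modules on spectra. -/
def pushforwardΓIso : Scheme.Modules.pushforward (Spec.map φ) ⋙ moduleSpecΓFunctor (R := R) ≅
    moduleSpecΓFunctor (R := S) ⋙ ModuleCat.restrictScalars φ.hom :=
  Functor.isoWhiskerRight (pushforwardCompModulesSpecToSheafIso φ)
    (TopCat.Sheaf.forget _ _ ⋙ (evaluation _ _).obj (op ⊤))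

/-- The adjunction between `T ↦ (Spec φ)^* T~` and taking global sections as an `R`-module. -/
def tildePullbackAdjunction : tilde.functor R ⋙ Scheme.Modules.pullback (Spec.map φ) ⊣
    moduleSpecΓFunctor (R := S) ⋙ ModuleCat.restrictScalars φ.hom :=
  (tilde.adjunction.comp
    (Scheme.Modules.pullbackPushforwardAdjunction (Spec.map φ))).ofNatIsoRight (pushforwardΓIso φ)

/-- The isomorphism `(Spec φ)^* T~ ≅ (S ⊗ T)~`. -/
def tildePullbackIso : tilde.functor R ⋙ Scheme.Modules.pullback (Spec.map φ) ≅
    ModuleCat.extendScalars φ.hom ⋙ tilde.functor S :=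
  (tildePullbackAdjunction φ).leftAdjointUniq (extendTildeAdjunction φ)

/-- Compatibility of the isomorphism of left adjoints with the units, which are `t ↦` inverse image
of `t` on one side and `t ↦ 1 ⊗ t` on the other. -/
lemma tildePullbackIso_pullUnit (T : ModuleCat.{u} R) (t : T) :
    ((tildePullbackIso φ).hom.app T).app ⊤
        (pullUnit (Spec.map φ) (tilde T) ⊤ ((tilde.toOpen T ⊤).hom t)) =
      (tilde.toOpen ((ModuleCat.extendScalars φ.hom).obj T) ⊤).hom
        ((ModuleCat.extendRestrictScalarsAdj φ.hom).unit.app T t) := by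
  have h := Adjunction.unit_leftAdjointUniq_hom_app
    (tildePullbackAdjunction φ) (extendTildeAdjunction φ) T
  exact ConcreteCategory.congr_hom h t

open scoped ChangeOfRings in
lemma tildePullbackIso_pullUnit' (T : ModuleCat.{u} R) (t : T) :
    ((tildePullbackIso φ).hom.app T).app ⊤
        (pullUnit (Spec.map φ) (tilde T) ⊤ ((tilde.toOpen T ⊤).hom t)) =
      (tilde.toOpen ((ModuleCat.extendScalars φ.hom).obj T) ⊤).hom
        ((1 : S) ⊗ₜ[R, φ.hom] t) :=
  tildePullbackIso_pullUnit φ T t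

lemma pullUnit_naturality {X Y : Scheme.{u}} (f : Y ⟶ X) {M N : X.Modules} (α : M ⟶ N)
    (V : X.Opens) (x : Γ(M, V)) :
    ((Scheme.Modules.pullback f).map α).app (f ⁻¹ᵁ V) (pullUnit f M V x) =
      pullUnit f N V (α.app V x) := by
  have h := (Scheme.Modules.pullbackPushforwardAdjunction f).unit.naturality α
  exact congr(Scheme.Modules.Hom.app $h V x).symm

lemma fromTildeΓ_app_toOpen (N : (Spec R).Modules) (t : moduleSpecΓFunctor.obj N) :
    N.fromTildeΓ.app ⊤ ((tilde.toOpen (moduleSpecΓFunctor.obj N) ⊤).hom t) = t := by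
  have h := ConcreteCategory.congr_hom (Scheme.Modules.toOpen_fromTildeΓ_app N ⊤) t
  refine h.trans ?_
  exact map_eq_self N (𝟙 _) t

lemma Spec_smul_def {S : CommRingCat.{u}} (N : (Spec S).Modules) (s : S) (x : Γ(N, ⊤)) :
    s • x = (Scheme.ΓSpecIso S).inv s • x := by
  rw [Scheme.Modules.smul_Spec_def]
  congr 1

open scoped ChangeOfRings in
/-- Global sections of the inverse image of a quasi-coherent module along a morphism of spectra. -/
lemma exists_extendScalars_equiv (N : (Spec R).Modules) [N.IsQuasicoherent] :
    ∃ e : (ModuleCat.extendScalars φ.hom).obj (moduleSpecΓFunctor.obj N) →ₗ[S]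
        moduleSpecΓFunctor.obj ((Scheme.Modules.pullback (Spec.map φ)).obj N),
      Function.Bijective e ∧ ∀ t : Γ(N, ⊤),
        e ((1 : S) ⊗ₜ[R, φ.hom] (show moduleSpecΓFunctor.obj N from t)) =
          pullUnit (Spec.map φ) N ⊤ t := by
  let T := moduleSpecΓFunctor.obj N
  have : IsIso N.fromTildeΓ := Scheme.Modules.isIso_fromTildeΓ_of_isQuasicoherent N
  let i1 : tilde ((ModuleCat.extendScalars φ.hom).obj T) ≅
      (Scheme.Modules.pullback (Spec.map φ)).obj (tilde T) := ((tildePullbackIso φ).app T).symm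
  let i2 := (Scheme.Modules.pullback (Spec.map φ)).mapIso (asIso N.fromTildeΓ)
  let i3 := tilde.isoTop ((ModuleCat.extendScalars φ.hom).obj T) ≪≫
    moduleSpecΓFunctor.mapIso (i1 ≪≫ i2)
  refine ⟨i3.hom.hom, i3.toLinearEquiv.bijective, fun t => ?_⟩
  have h1 := tildePullbackIso_pullUnit' φ T t
  have h2 : i1.hom.app ⊤ ((tilde.toOpen ((ModuleCat.extendScalars φ.hom).obj T) ⊤).hom
        ((1 : S) ⊗ₜ[R, φ.hom] (show T from t))) =
      pullUnit (Spec.map φ) (tilde T) ⊤ ((tilde.toOpen T ⊤).hom t) := by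
    rw [← h1]
    exact congr(Scheme.Modules.Hom.app $(i1.inv_hom_id) ⊤ _)
  have h3 := pullUnit_naturality (Spec.map φ) N.fromTildeΓ ⊤ ((tilde.toOpen T ⊤).hom t)
  exact (congrArg (i2.hom.app ⊤) h2).trans
    (h3.trans (congrArg (pullUnit (Spec.map φ) N ⊤) (fromTildeΓ_app_toOpen N t)))

end SpecBaseChange

section Affine

variable {X : Scheme.{u}} {U : X.Opens} (hU : IsAffineOpen U)

lemma fromSpec_appIso_inv (r : Γ(X, U)) :
    (hU.fromSpec.appIso ⊤).inv ((Scheme.ΓSpecIso Γ(X, U)).inv r) =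
      X.presheaf.map (homOfLE (by simp) : hU.fromSpec ''ᵁ ⊤ ⟶ U).op r := by
  have h : (Scheme.ΓSpecIso Γ(X, U)).inv = X.presheaf.map (homOfLE (by simp) : hU.fromSpec ''ᵁ ⊤ ⟶ U).op ≫ (hU.fromSpec.appIso ⊤).hom := by
    rw [Scheme.Hom.appIso_hom, hU.fromSpec.naturality_assoc, hU.fromSpec_app_self,
      Category.assoc, ← Functor.map_comp, ← Functor.map_comp]
    exact (Category.comp_id _).symm.trans (congrArg _ ((Spec Γ(X, U)).presheaf.map_id _).symm)
  rw [h]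
  simp

/-- Sections of `M` on an affine open subscheme `U` as global sections on the spectrum. -/
def sectionsToSpec (M : X.Modules) :
    Γ(M, U) →ₗ[Γ(X, U)] (moduleSpecΓFunctor (R := Γ(X, U))).obj (M.restrict hU.fromSpec) where
  toFun x := M.presheaf.map (homOfLE (by simp) : hU.fromSpec ''ᵁ ⊤ ⟶ U).op x
  map_add' := map_add _
  map_smul' r x := by
    refine Eq.trans ?_ (Spec_smul_def (M.restrict hU.fromSpec) r _).symm
    refine (M.map_smul _ r x).trans ?_
    rw [← fromSpec_appIso_inv]
    rfl

lemma sectionsToSpec_bijective (M : X.Modules) :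
    Function.Bijective (sectionsToSpec hU M) :=
  map_bijective_of_eq M _ (by simp)

end Affine

end

/-! ### Values of `underline M` at affine schemes -/

section

variable {X : Scheme.{u}}

section Sections

/-- The inverse image on `Y` of a section of `M` on an open subset containing the image of `Y`. -/
def pulledSection (M : X.Modules) {U : X.Opens} (Y : Over X) (h : ⊤ ≤ Y.hom ⁻¹ᵁ U) :
    Γ(M, U) →+ ((underline X).obj M).Sec Y where
  toFun x := ((Scheme.Modules.pullback Y.hom).obj M).presheaf.map (homOfLE h).op
    (pullSection M Y U x)
  map_zero' := (congrArg _ (map_zero (((Scheme.Modules.pullbackPushforwardAdjunction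
    Y.hom).unit.app M).app U).hom)).trans (map_zero _)
  map_add' x y := (congrArg _ (map_add (((Scheme.Modules.pullbackPushforwardAdjunction
    Y.hom).unit.app M).app U).hom x y)).trans (map_add _ _ _)

lemma pulledSection_smul (M : X.Modules) {U : X.Opens} (Y : Over X) (h : ⊤ ≤ Y.hom ⁻¹ᵁ U)
    (r : Γ(X, U)) (x : Γ(M, U)) :
    pulledSection M Y h (r • x) = Y.hom.appLE U ⊤ h r • pulledSection M Y h x := by
  have h1 := ((Scheme.Modules.pullbackPushforwardAdjunction Y.hom).unit.app M).app_smul r x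
  have h2 := ((Scheme.Modules.pullback Y.hom).obj M).map_smul (homOfLE h) (Y.hom.app U r)
    (pullSection M Y U x)
  exact (congrArg _ h1).trans h2

lemma res_pulledSection (M : X.Modules) {U : X.Opens} {Y Z : Over X} (h : ⊤ ≤ Y.hom ⁻¹ᵁ U)
    (g : Z ⟶ Y) (h' : ⊤ ≤ Z.hom ⁻¹ᵁ U) (x : Γ(M, U)) :
    ((underline X).obj M).res g (pulledSection M Y h x) = pulledSection M Z h' x := by
  have h1 := app_map (comparison M g) (homOfLE h) (pullSection M Y U x)
  have h2 := comparison_pullSection M g U x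
  refine (underline_res M g _).trans (h1.trans ((congrArg _ h2).trans ?_))
  exact map_map ((Scheme.Modules.pullback Z.hom).obj M) _ _ _

lemma ev_pulledSection {M N : X.Modules} (α : M ⟶ N) {U : X.Opens} (Y : Over X)
    (h : ⊤ ≤ Y.hom ⁻¹ᵁ U) (x : Γ(M, U)) :
    ModuleFunctor.ev ((underline X).map α) Y (pulledSection M Y h x) =
      pulledSection N Y h (α.app U x) := by
  have h1 := app_map ((Scheme.Modules.pullback Y.hom).map α) (homOfLE h) (pullSection M Y U x)
  refine h1.trans (congrArg _ ?_)
  have h2 := (Scheme.Modules.pullbackPushforwardAdjunction Y.hom).unit.naturality α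
  exact congr(Scheme.Modules.Hom.app $h2 U x).symm

lemma pulledSection_map (M : X.Modules) {U V : X.Opens} (i : V ≤ U) (Y : Over X)
    (h : ⊤ ≤ Y.hom ⁻¹ᵁ V) (h' : ⊤ ≤ Y.hom ⁻¹ᵁ U) (x : Γ(M, U)) :
    pulledSection M Y h (M.presheaf.map (homOfLE i).op x) = pulledSection M Y h' x := by
  have h1 := app_map ((Scheme.Modules.pullbackPushforwardAdjunction Y.hom).unit.app M)
    (homOfLE i) x
  refine (congrArg _ h1).trans ?_
  exact map_map ((Scheme.Modules.pullback Y.hom).obj M) _ _ _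

end Sections

section Values

variable {U : X.Opens} (hU : IsAffineOpen U) (B : Type u) [CommRing B] [Algebra Γ(X, U) B]

/-- The spectrum of an algebra over the ring of functions on an affine open subscheme, as an
`X`-scheme. -/
def specOver : Over X :=
  Over.mk (Spec.map (CommRingCat.ofHom (algebraMap Γ(X, U) B)) ≫ hU.fromSpec)

lemma top_le_specOver : ⊤ ≤ (specOver hU B).hom ⁻¹ᵁ U := by
  intro y _
  have : hU.fromSpec (Spec.map (CommRingCat.ofHom (algebraMap Γ(X, U) B)) y) ∈
    Set.range hU.fromSpec := ⟨_, rfl⟩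
  rw [hU.range_fromSpec] at this
  exact this

/-- The value of a module-valued functor at an algebra over the ring of functions on an affine
open subscheme. -/
def ModuleFunctor.val (F : ModuleFunctor X) : Type u := F.Sec (specOver hU B)

namespace ModuleFunctor

variable (F G : ModuleFunctor X)

instance : AddCommGroup (F.val hU B) := inferInstanceAs (AddCommGroup (F.Sec _))

instance : Module B (F.val hU B) :=
  letI : Module Γ(Spec (.of B), ⊤) (F.val hU B) :=
    inferInstanceAs (Module Γ((specOver hU B).left, ⊤) (F.Sec (specOver hU B)))
  Module.compHom (F.val hU B) (Scheme.ΓSpecIso (.of B)).inv.hom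

instance : Module Γ(X, U) (F.val hU B) := Module.compHom (F.val hU B) (algebraMap Γ(X, U) B)

instance : IsScalarTower Γ(X, U) B (F.val hU B) := .of_algebraMap_smul fun _ _ => rfl

end ModuleFunctor

lemma specOver_appLE (r : Γ(X, U)) :
    (specOver hU B).hom.appLE U ⊤ (top_le_specOver hU B) r =
      (Scheme.ΓSpecIso (.of B)).inv (algebraMap Γ(X, U) B r) := by
  have h0 := Scheme.ΓSpecIso_inv_naturality (CommRingCat.ofHom (algebraMap Γ(X, U) B))
  have h1 : (⊤ : (Spec Γ(X, U)).Opens) ≤ hU.fromSpec ⁻¹ᵁ U := by simp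
  have h2 := Scheme.Hom.appLE_comp_appLE (Spec.map (CommRingCat.ofHom (algebraMap Γ(X, U) B)))
    hU.fromSpec U ⊤ ⊤ h1 le_top
  have h3 : hU.fromSpec.appLE U ⊤ h1 = (Scheme.ΓSpecIso Γ(X, U)).inv := by
    rw [Scheme.Hom.appLE, hU.fromSpec_app_self, Category.assoc, ← Functor.map_comp]
    exact (congrArg _ ((Spec Γ(X, U)).presheaf.map_id _)).trans (Category.comp_id _)
  rw [h3] at h2
  have h4 : (Spec.map (CommRingCat.ofHom (algebraMap Γ(X, U) B))).appLE ⊤ ⊤ le_top =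
    (Spec.map (CommRingCat.ofHom (algebraMap Γ(X, U) B))).appTop :=
    (congrArg _ ((Spec (.of B)).presheaf.map_id _)).trans (Category.comp_id _)
  rw [h4] at h2
  exact (ConcreteCategory.congr_hom (h0.trans h2) r).symm

/-- Inverse images of sections on `U`, as a linear map to the value at an algebra. -/
def toVal (M : X.Modules) : Γ(M, U) →ₗ[Γ(X, U)] ((underline X).obj M).val hU B where
  toFun := pulledSection M (specOver hU B) (top_le_specOver hU B)
  map_add' := map_add _
  map_smul' r x := by
    refine (pulledSection_smul M _ _ r x).trans ?_
    rw [specOver_appLE]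
    rfl

open scoped ChangeOfRings TensorProduct in
/-- The value of `Y ↦ Γ(Y, M_Y)` at an algebra `B` over the ring of functions on `U` is
`B ⊗ Γ(M, U)`. -/
lemma toVal_isBaseChange (M : X.Modules) [M.IsQuasicoherent] : IsBaseChange B (toVal hU B M) := by
  let φ : Γ(X, U) ⟶ CommRingCat.of B := CommRingCat.ofHom (algebraMap Γ(X, U) B)
  let N := M.restrict hU.fromSpec
  have hN : N.IsQuasicoherent := Scheme.Modules.isQuasicoherent_restrictFunctor hU.fromSpec M
  obtain ⟨e, he, het⟩ := exists_extendScalars_equiv φ N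
  -- The inverse image along `Spec B ⟶ Spec Γ(X, U) ⟶ X` becomes the inverse image of `N` along the
  -- first map, which reduces the claim to the computation for morphisms of spectra.
  let j := (pullbackOpenIso (Spec.map φ) hU.fromSpec).app M
  have hj : Function.Bijective (j.hom.app ⊤) := ConcreteCategory.bijective_of_isIso (j.hom.app ⊤)
  have hjt (x : Γ(M, U)) : j.hom.app ⊤ (toVal hU B M x) =
      pullUnit (Spec.map φ) N ⊤ (sectionsToSpec hU M x) := by
    have h1 := app_map j.hom (homOfLE (top_le_specOver hU B)) (pullSection M (specOver hU B) U x)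
    have h2 := pullbackOpenIso_pullUnit (Spec.map φ) hU.fromSpec M U x
    have h3 : (⊤ : (Spec Γ(X, U)).Opens) ≤ hU.fromSpec ⁻¹ᵁ U := by simp
    have h4 := app_map ((Scheme.Modules.pullbackPushforwardAdjunction (Spec.map φ)).unit.app N)
      (homOfLE h3) (M.presheaf.map (homOfLE (hU.fromSpec.image_preimage_le U)).op x)
    have h5 := map_map M (homOfLE (hU.fromSpec.image_preimage_le U))
      (homOfLE (hU.fromSpec.image_mono h3)) x
    exact h1.trans ((congrArg _ h2).trans (h4.symm.trans
      (congrArg (pullUnit (Spec.map φ) N ⊤) h5)))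
  -- The extension of scalars uses `B` with restricted scalars, the base change uses `B` as an
  -- algebra; the identity map compares the two module structures.
  let idB : B →ₗ[Γ(X, U)] (ModuleCat.restrictScalars φ.hom).obj (ModuleCat.of B B) :=
    { toFun := fun b => b
      map_add' := fun _ _ => rfl
      map_smul' := fun a b => Algebra.smul_def a b }
  have hid : Function.Bijective idB := Function.bijective_id
  let g := TensorProduct.congr (LinearEquiv.ofBijective idB hid)
    (LinearEquiv.ofBijective _ (sectionsToSpec_bijective hU M))
  let l := TensorProduct.AlgebraTensorModule.lift
    (((LinearMap.toSpanSingleton B (_ →ₗ[Γ(X, U)] _) (toVal hU B M))))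
  suffices h : Function.Bijective l by
    exact IsBaseChange.of_equiv (LinearEquiv.ofBijective l h) fun x =>
      (one_smul B (toVal hU B M x))
  have key (t : B ⊗[Γ(X, U)] Γ(M, U)) : j.hom.app ⊤ (l t) = e (g t) := by
    induction t with
    | zero =>
      rw [map_zero, map_zero]
      exact (map_zero (j.hom.app ⊤).hom).trans (map_zero e).symm
    | add x y hx hy =>
      rw [map_add, map_add]
      exact (map_add (j.hom.app ⊤).hom _ _).trans
        ((congrArg₂ (· + ·) hx hy).trans (map_add e _ _).symm)
    | tmul b x =>
      let w : (ModuleCat.extendScalars φ.hom).obj (moduleSpecΓFunctor.obj N) :=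
        (1 : B) ⊗ₜ[Γ(X, U), φ.hom] (sectionsToSpec hU M x)
      have h1 : g (b ⊗ₜ[Γ(X, U)] x) = (show CommRingCat.of B from b) • w := by
        refine Eq.trans ?_ (ModuleCat.ExtendScalars.smul_tmul φ.hom b 1 _).symm
        rw [mul_one]
        rfl
      have h2 : l (b ⊗ₜ[Γ(X, U)] x) = b • toVal hU B M x := rfl
      rw [h1, h2]
      refine Eq.trans ?_ (map_smul e b _).symm
      refine Eq.trans ?_ (congrArg ((show CommRingCat.of B from b) • ·) (het _).symm)
      refine Eq.trans ?_ (Spec_smul_def ((Scheme.Modules.pullback (Spec.map φ)).obj N) b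
        (pullUnit (Spec.map φ) N ⊤ (sectionsToSpec hU M x))).symm
      refine (j.hom.app_smul (U := ⊤) ((Scheme.ΓSpecIso (.of B)).inv b) (toVal hU B M x)).trans ?_
      exact congrArg _ (hjt x)
  have h3 : Function.Bijective fun t => j.hom.app ⊤ (l t) := by
    rw [show (fun t => j.hom.app ⊤ (l t)) = e ∘ g from funext key]
    exact he.comp g.bijective
  exact (Function.Bijective.of_comp_iff' hj l).1 h3

end Values

end

/-! ### Quasi-coherence as localization of sections on affine opens -/

section

section Localizing

/-- Elementwise form of the condition that restricting sections of `P` from `U` to basic open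
subsets is localization. -/
def LocalizesOn {X : Scheme.{u}} (P : X.Modules) (U : X.Opens) : Prop :=
  ∀ f : Γ(X, U), (∀ x : Γ(P, U), P.presheaf.map (homOfLE (X.basicOpen_le f)).op x = 0 →
      ∃ n : ℕ, f ^ n • x = 0) ∧
    ∀ y : Γ(P, X.basicOpen f), ∃ (n : ℕ) (x : Γ(P, U)),
      P.presheaf.map (homOfLE (X.basicOpen_le f)).op x =
        (X.presheaf.map (homOfLE (X.basicOpen_le f)).op f) ^ n • y

/-- The basic open subset of `Spec R` defined by an element of `R`. -/
def specBasicOpen {R : CommRingCat.{u}} (f : R) : (Spec R).Opens := PrimeSpectrum.basicOpen f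

/-- Of the three conditions for a localization at `f`, the invertibility of `f` on sections over the
basic open subset holds for every module, which leaves the two listed. -/
lemma isIso_fromTildeΓ_iff_forall {R : CommRingCat.{u}} (N : (Spec R).Modules) :
    IsIso N.fromTildeΓ ↔ ∀ f : R,
      (∀ x : Γ(N, ⊤), N.presheaf.map (homOfLE le_top : specBasicOpen f ⟶ ⊤).op x = 0 →
        ∃ n : ℕ, f ^ n • x = 0) ∧
      ∀ y : Γ(N, specBasicOpen f), ∃ (n : ℕ) (x : Γ(N, ⊤)),
        N.presheaf.map (homOfLE le_top : specBasicOpen f ⟶ ⊤).op x = f ^ n • y := by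
  rw [isIso_fromTildeΓ_iff_isLocalizing]
  refine forall_congr' fun f => ⟨fun h => ?_, fun h => ?_⟩
  · have h' : IsLocalizedModule.Away f _ := h
    refine ⟨fun x hx => ?_, fun y => ?_⟩
    · obtain ⟨⟨_, n, rfl⟩, hn⟩ := (IsLocalizedModule.eq_zero_iff (.powers f) ((modulesSpecToSheaf.obj
        N).obj.map (PrimeSpectrum.basicOpen f).leTop.op).hom).mp hx
      exact ⟨n, hn⟩
    · obtain ⟨n, x, hx⟩ := h'.surj _ _ y
      exact ⟨n, x, hx.symm⟩
  · refine IsLocalizedModule.Away.mk_of_addCommGroup ?_ ?_ ?_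
    · exact Scheme.Modules.isUnit_algebraMap_end_of_le_basicOpen f le_rfl
    · intro y
      obtain ⟨n, x, hx⟩ := h.2 y
      exact ⟨n, x, hx.symm⟩
    · intro x hx
      exact h.1 x hx

variable {X : Scheme.{u}} {U : X.Opens} (hU : IsAffineOpen U)

lemma fromSpec_appIso_inv_map (V : (Spec Γ(X, U)).Opens) (r : Γ(X, U)) :
    (hU.fromSpec.appIso V).inv ((Spec Γ(X, U)).presheaf.map V.leTop.op
        ((Scheme.ΓSpecIso Γ(X, U)).inv r)) =
      X.presheaf.map (homOfLE ((hU.fromSpec.image_mono le_top).trans (by simp)) :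
        hU.fromSpec ''ᵁ V ⟶ U).op r := by
  have h := ConcreteCategory.congr_hom (hU.fromSpec.appIso_inv_naturality V.leTop.op)
    ((Scheme.ΓSpecIso Γ(X, U)).inv r)
  refine h.trans ((congrArg _ (fromSpec_appIso_inv hU r)).trans ?_)
  exact ConcreteCategory.congr_hom (X.presheaf.map_comp _ _).symm r

lemma restrict_fromSpec_smul (P : X.Modules) (V : (Spec Γ(X, U)).Opens) (r : Γ(X, U))
    (z : Γ(P.restrict hU.fromSpec, V)) :
    r • z = (show Γ(P.restrict hU.fromSpec, V) from
      X.presheaf.map (homOfLE ((hU.fromSpec.image_mono le_top).trans (by simp)) :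
        hU.fromSpec ''ᵁ V ⟶ U).op r • (show Γ(P, hU.fromSpec ''ᵁ V) from z)) := by
  rw [← fromSpec_appIso_inv_map]
  rfl

/-- Sections on `U` and on `X.basicOpen f` are transported to the spectrum by bijective restriction
maps that respect the powers of `f`; the two elementwise conditions then match term by term. -/
lemma localizesOn_iff (P : X.Modules) :
    LocalizesOn P U ↔ IsIso (P.restrict hU.fromSpec).fromTildeΓ := by
  rw [isIso_fromTildeΓ_iff_forall]
  refine forall_congr' fun f => ?_
  let D := specBasicOpen f
  have e : hU.fromSpec ''ᵁ D = X.basicOpen f := hU.fromSpec_image_basicOpen f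
  let a : Γ(P, U) → Γ(P.restrict hU.fromSpec, ⊤) := sectionsToSpec hU P
  have ha : Function.Bijective a := sectionsToSpec_bijective hU P
  have ha' (n) (x) : a (f ^ n • x) = f ^ n • a x := map_smul (sectionsToSpec hU P) _ _
  let b : Γ(P, X.basicOpen f) →+ Γ(P.restrict hU.fromSpec, D) :=
    (P.presheaf.map (homOfLE e.le).op).hom
  have hb : Function.Bijective b := map_bijective_of_eq P _ e.ge
  have hab (x) : b (P.presheaf.map (homOfLE (X.basicOpen_le f)).op x) =
      (P.restrict hU.fromSpec).presheaf.map (homOfLE le_top : D ⟶ ⊤).op (a x) :=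
    (map_map P (homOfLE (X.basicOpen_le f)) (homOfLE e.le) x).trans
      (map_map P (homOfLE (by simp) : hU.fromSpec ''ᵁ ⊤ ⟶ U)
        (homOfLE (hU.fromSpec.image_mono le_top) : hU.fromSpec ''ᵁ D ⟶ _) x).symm
  have hb' (n : ℕ) (y : Γ(P, X.basicOpen f)) :
      b ((X.presheaf.map (homOfLE (X.basicOpen_le f)).op f) ^ n • y) = f ^ n • b y := by
    refine (P.map_smul _ _ y).trans ?_
    rw [restrict_fromSpec_smul, map_pow, ← map_pow, ← map_pow]
    congr 1
    exact ConcreteCategory.congr_hom (X.presheaf.map_comp _ _).symm _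
  refine and_congr ?_ ?_
  · refine Iff.trans ?_ ha.2.forall.symm
    refine forall_congr' fun x => ?_
    rw [← hab, map_eq_zero_iff b hb.1]
    refine imp_congr_right fun _ => exists_congr fun n => ?_
    rw [← ha']
    exact ((map_eq_zero_iff (sectionsToSpec hU P) ha.1)).symm
  · refine Iff.trans ?_ hb.2.forall.symm
    refine forall_congr' fun y => exists_congr fun n => ?_
    refine Iff.trans ?_ ha.2.exists.symm
    refine exists_congr fun x => ?_
    rw [← hab, ← hb', hb.1.eq_iff]

end Localizing

end

/-! ### Presentations from affine covers -/

section

section Presentations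

variable {X : Scheme.{u}} {U : X.Opens} (hU : IsAffineOpen U)

/-- Modules on the spectrum of the ring of functions on an affine open `U`, as modules on `U`. -/
def specToOver : (Spec Γ(X, U)).Modules ⥤ SheafOfModules (X.ringCatSheaf.over U) :=
  Scheme.Modules.restrictFunctor hU.isoSpec.hom ⋙ (Scheme.Modules.overEquiv U).inverse

instance : (Scheme.Modules.restrictFunctor hU.isoSpec.hom).IsLeftAdjoint := inferInstance
instance : PreservesColimitsOfSize.{u, u} (specToOver hU) := by
  unfold specToOver; infer_instance

/-- The restriction of a module to an affine open `U` through the spectrum. -/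
def specToOverIso : Scheme.Modules.restrictFunctor hU.fromSpec ⋙ specToOver hU ≅
    SheafOfModules.overFunctor X.ringCatSheaf U :=
  (Functor.associator _ _ _).symm ≪≫ Functor.isoWhiskerRight
    ((Scheme.Modules.restrictFunctorComp _ _).symm ≪≫
      (Scheme.Modules.restrictFunctorCongr hU.isoSpec_hom_fromSpec) ≪≫
        (Scheme.Modules.overFunctorEquiv U).symm) _ ≪≫ Functor.associator _ _ _ ≪≫
    Functor.isoWhiskerLeft _ (Scheme.Modules.overEquiv U).unitIso.symm ≪≫ Functor.rightUnitor _

/-- The restriction of functions to an affine open `U` corresponds to the structure sheaf of the spectrum. -/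
def specToOverUnit : SheafOfModules.unit _ ≅ (specToOver hU).obj (SheafOfModules.unit _) :=
  (Scheme.Modules.overEquiv U).unitIso.app (SheafOfModules.unit _) ≪≫
    (Scheme.Modules.overEquiv U).inverse.mapIso
      (Scheme.Modules.restrictUnitIso hU.isoSpec.hom).symm

/-- The functor `specToOver`, on the underlying category of sheaves of modules. -/
def specToOver' :
    SheafOfModules (Spec Γ(X, U)).ringCatSheaf ⥤ SheafOfModules (X.ringCatSheaf.over U) :=
  specToOver hU

instance : PreservesColimitsOfSize.{u, u} (specToOver' hU) :=
  show PreservesColimitsOfSize.{u, u} (specToOver hU) from inferInstance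

/-- A presentation over an affine open obtained from one over its spectrum. -/
def presentationOver {P : X.Modules} (p : (P.restrict hU.fromSpec).Presentation) :
    (SheafOfModules.over P U).Presentation :=
  SheafOfModules.Presentation.ofIsIso.{u, u, u} ((specToOverIso hU).app P).hom
    (p.map (specToOver' hU) (specToOverUnit hU))

/-- A presentation of a quasi-coherent module on a spectrum with a given set of generators. -/
def presentationOfSpan {R : CommRingCat.{u}} (N : (Spec R).Modules) [IsIso N.fromTildeΓ]
    (s : Set (moduleSpecΓFunctor.obj N)) (hs : Submodule.span R s = ⊤) : N.Presentation :=
  have : IsIso (C := SheafOfModules (Spec R).ringCatSheaf) N.fromTildeΓ :=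
    inferInstanceAs (IsIso N.fromTildeΓ)
  SheafOfModules.Presentation.ofIsIso.{u, u, u} N.fromTildeΓ
    (presentationTilde (moduleSpecΓFunctor.obj N) s hs _ (Submodule.span_eq _))

/-- Quasi-coherence data obtained from an affine open cover. -/
def quasicoherentDataOfCover {P : X.Modules} {ι : Type u} {U : ι → X.Opens}
    (hU : ∀ i, IsAffineOpen (U i)) (hcov : iSup U = ⊤)
    (p : ∀ i, (P.restrict (hU i).fromSpec).Presentation) :
    SheafOfModules.QuasicoherentData (R := X.ringCatSheaf) P where
  I := ι
  X := U
  coversTop := (Opens.coversTop_iff (T := X) U).2 hcov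
  presentation i := presentationOver (hU i) (p i)

/-- On each spectrum the module is the tilde of its global sections, which has a presentation with
all sections as generators and all relations between them. -/
lemma isQuasicoherent_of_localizesOn {P : X.Modules} {ι : Type u} {U : ι → X.Opens}
    (hU : ∀ i, IsAffineOpen (U i)) (hcov : iSup U = ⊤) (h : ∀ i, LocalizesOn P (U i)) :
    P.IsQuasicoherent := by
  have h' i := (localizesOn_iff (hU i) P).1 (h i)
  exact (quasicoherentDataOfCover hU hcov fun i =>
    presentationOfSpan _ Set.univ Submodule.span_univ).isQuasicoherent

/-- The presentations are built on finite generating sets; finite type does not ask for finitely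
many relations. -/
lemma isCoherentModule_of_localizesOn {P : X.Modules} {ι : Type u} {U : ι → X.Opens}
    (hU : ∀ i, IsAffineOpen (U i)) (hcov : iSup U = ⊤) (h : ∀ i, LocalizesOn P (U i))
    (hf : ∀ i, Module.Finite Γ(X, U i) Γ(P, U i)) : IsCoherentModule P := by
  refine ⟨isQuasicoherent_of_localizesOn hU hcov h, ?_⟩
  have h' i := (localizesOn_iff (hU i) P).1 (h i)
  have hg (i) : Module.Finite Γ(X, U i) (moduleSpecΓFunctor.obj (P.restrict (hU i).fromSpec)) :=
    Module.Finite.of_surjective _ (sectionsToSpec_bijective (hU i) P).2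
  choose s hs using fun i => (hg i).fg_top
  let q := quasicoherentDataOfCover hU hcov fun i =>
    presentationOfSpan (P.restrict (hU i).fromSpec) (s i : Set _) (hs i)
  have hq : SheafOfModules.LocalGeneratorsData.IsFiniteType (R := X.ringCatSheaf)
      q.localGeneratorsData := by
    refine SheafOfModules.LocalGeneratorsData.IsFiniteType.mk (R := X.ringCatSheaf) ?_
    intro i
    refine SheafOfModules.GeneratingSections.IsFiniteType.mk ?_
    exact (s i).finite_toSet.to_subtype
  exact SheafOfModules.IsFiniteType.mk (R := X.ringCatSheaf) ⟨q.localGeneratorsData, hq⟩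

lemma localizesOn_of_isQuasicoherent (P : X.Modules) [P.IsQuasicoherent] (hU : IsAffineOpen U) :
    LocalizesOn P U := by
  have : (P.restrict hU.fromSpec).IsQuasicoherent :=
    Scheme.Modules.isQuasicoherent_restrictFunctor hU.fromSpec P
  exact (localizesOn_iff hU P).2 (Scheme.Modules.isIso_fromTildeΓ_of_isQuasicoherent _)

end Presentations

end

/-! ### Finite generation of sections of coherent modules -/

section

section FiniteType

variable {X : Scheme.{u}}

/-- The epimorphism from a finite free module is the tilde of a linear map, as tilde is full, and
this linear map is surjective because tilde is faithful and so reflects epimorphisms. -/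
lemma finite_of_generatingSections {R : CommRingCat.{u}} (N : (Spec R).Modules)
    [h : IsIso N.fromTildeΓ] (G : SheafOfModules.GeneratingSections (R := (Spec R).ringCatSheaf) N)
    (hG : Finite G.I) : Module.Finite R (moduleSpecΓFunctor.obj N) := by
  let T := moduleSpecΓFunctor.obj N
  let L : (Spec R).Modules := SheafOfModules.free (R := (Spec R).ringCatSheaf) G.I
  let p : L ⟶ N := G.π
  have hp : Epi p := G.epi
  let e : tilde T ≅ N := @asIso _ _ _ _ N.fromTildeΓ h
  let e' : tilde (ModuleCat.of R (G.I →₀ R)) ≅ L := tildeFinsupp G.I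
  let q : (tilde.functor R).obj (ModuleCat.of R (G.I →₀ R)) ⟶ (tilde.functor R).obj T :=
    e'.hom ≫ p ≫ e.inv
  have hq : Epi q := by
    have : Epi (p ≫ e.inv) := epi_comp _ _
    exact epi_comp e'.hom (p ≫ e.inv)
  obtain ⟨f, hf⟩ := (tilde.functor R).map_surjective q
  have : Epi f := by
    rw [← hf] at hq
    exact (tilde.functor R).epi_of_epi_map hq
  exact Module.Finite.of_surjective f.hom ((ModuleCat.epi_iff_surjective f).1 this)

/-- Restriction of modules on an open `W` to the spectrum of an affine open contained in it. -/
def overToSpec {W V : X.Opens} (hV : IsAffineOpen V) (h : V ≤ W) :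
    SheafOfModules (X.ringCatSheaf.over W) ⥤ SheafOfModules (Spec Γ(X, V)).ringCatSheaf :=
  (Scheme.Modules.overEquiv W).functor ⋙
    Scheme.Modules.restrictFunctor (hV.isoSpec.inv ≫ X.homOfLE h)

instance {W V : X.Opens} (hV : IsAffineOpen V) (h : V ≤ W) :
    PreservesColimitsOfSize.{u, u} (overToSpec hV h) :=
  show PreservesColimitsOfSize.{u, u} ((Scheme.Modules.overEquiv W).functor ⋙
    Scheme.Modules.restrictFunctor (hV.isoSpec.inv ≫ X.homOfLE h)) from inferInstance

/-- The functor `overToSpec` applied to the restriction of a module to `W`. -/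
def overToSpecIso {W V : X.Opens} (hV : IsAffineOpen V) (h : V ≤ W) :
    SheafOfModules.overFunctor X.ringCatSheaf W ⋙ overToSpec hV h ≅
      Scheme.Modules.restrictFunctor hV.fromSpec :=
  (Functor.associator _ _ _).symm ≪≫
    Functor.isoWhiskerRight (Scheme.Modules.overFunctorEquiv _) _ ≪≫
    (Scheme.Modules.restrictFunctorComp _ _).symm ≪≫
    (Scheme.Modules.restrictFunctorCongr (by simp [IsAffineOpen.isoSpec_inv_ι]))

/-- The functor `overToSpec` preserves the structure sheaf. -/
def overToSpecUnit {W V : X.Opens} (hV : IsAffineOpen V) (h : V ≤ W) :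
    SheafOfModules.unit _ ≅ (overToSpec hV h).obj (SheafOfModules.unit _) :=
  (Scheme.Modules.restrictUnitIso (hV.isoSpec.inv ≫ X.homOfLE h)).symm

/-- Generating sections over `W` restricted to the spectrum of an affine open of `W`. -/
def generatingSectionsSpec {W V : X.Opens} (hV : IsAffineOpen V) (h : V ≤ W) (M : X.Modules)
    (G : SheafOfModules.GeneratingSections (SheafOfModules.over (R := X.ringCatSheaf) M W)) :
    SheafOfModules.GeneratingSections (R := (Spec Γ(X, V)).ringCatSheaf)
      (M.restrict hV.fromSpec) :=
  let e : (overToSpec hV h).obj (SheafOfModules.over (R := X.ringCatSheaf) M W) ≅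
    (show SheafOfModules (Spec Γ(X, V)).ringCatSheaf from M.restrict hV.fromSpec) :=
      (overToSpecIso hV h).app M
  have : Epi e.hom := IsIso.epi_of_iso e.hom
  SheafOfModules.GeneratingSections.ofEpi (G.map (overToSpec hV h) (overToSpecUnit hV h)) e.hom

lemma finite_sections_of_generatingSections {W V : X.Opens} (hV : IsAffineOpen V) (h : V ≤ W)
    (M : X.Modules) [M.IsQuasicoherent]
    (G : SheafOfModules.GeneratingSections (SheafOfModules.over (R := X.ringCatSheaf) M W))
    (hG : Finite G.I) : Module.Finite Γ(X, V) Γ(M, V) := by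
  have : (M.restrict hV.fromSpec).IsQuasicoherent :=
    Scheme.Modules.isQuasicoherent_restrictFunctor hV.fromSpec M
  have := Scheme.Modules.isIso_fromTildeΓ_of_isQuasicoherent (M.restrict hV.fromSpec)
  have := finite_of_generatingSections _ (generatingSectionsSpec hV h M G) hG
  exact Module.Finite.of_surjective
    (LinearEquiv.ofBijective _ (sectionsToSpec_bijective hV M)).symm.toLinearMap
    (LinearEquiv.surjective _)

/-- Sections over a basic open subset as a module over the functions on the larger open. -/
instance moduleBasicOpen {U : X.Opens} (M : X.Modules) (f : Γ(X, U)) :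
    Module Γ(X, U) Γ(M, X.basicOpen f) :=
  Module.compHom _ (algebraMap Γ(X, U) Γ(X, X.basicOpen f))

instance {U : X.Opens} (M : X.Modules) (f : Γ(X, U)) :
    IsScalarTower Γ(X, U) Γ(X, X.basicOpen f) Γ(M, X.basicOpen f) :=
  .of_algebraMap_smul fun _ _ => rfl

/-- Restriction to a basic open subset as a linear map over the functions on the larger open. -/
def restrictBasicOpen {U : X.Opens} (M : X.Modules) (f : Γ(X, U)) :
    Γ(M, U) →ₗ[Γ(X, U)] Γ(M, X.basicOpen f) where
  toFun := M.presheaf.map (homOfLE (X.basicOpen_le f)).op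
  map_add' := map_add _
  map_smul' r x := M.map_smul (homOfLE (X.basicOpen_le f)) r x

lemma restrictBasicOpen_isLocalizedModule {U : X.Opens} (hU : IsAffineOpen U) (M : X.Modules)
    (h : LocalizesOn M U) (f : Γ(X, U)) :
    IsLocalizedModule.Away f (restrictBasicOpen M f) := by
  have := hU.isLocalization_basicOpen f
  refine IsLocalizedModule.Away.mk_of_addCommGroup ?_ ?_ ?_
  · have h1 := IsLocalization.Away.algebraMap_isUnit (S := Γ(X, X.basicOpen f)) f
    have h2 := h1.map (algebraMap Γ(X, X.basicOpen f) (Module.End Γ(X, X.basicOpen f)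
      Γ(M, X.basicOpen f)))
    rw [Module.End.isUnit_iff] at h2 ⊢
    exact h2
  · intro y
    obtain ⟨n, x, hx⟩ := (h f).2 y
    refine ⟨n, x, Eq.trans ?_ hx.symm⟩
    exact congrArg (· • y) (map_pow (algebraMap Γ(X, U) Γ(X, X.basicOpen f)) f n)
  · exact (h f).1

/-- `U` is covered by basic open subsets on each of which finitely many given sections generate.
Sections of `M` localize on `U`, and finite generation of a module can be checked on such a cover.
-/
lemma IsCoherentModule.finite {M : X.Modules} (hM : IsCoherentModule M) {U : X.Opens}
    (hU : IsAffineOpen U) : Module.Finite Γ(X, U) Γ(M, U) := by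
  have := hM.1
  obtain ⟨σ, hσ⟩ := SheafOfModules.IsFiniteType.exists_localGeneratorsData (R := X.ringCatSheaf) M
    (self := hM.2)
  have hcov := (Opens.coversTop_iff (T := X) σ.X).1 σ.coversTop
  have h1 (x : U) : ∃ f : Γ(X, U), Module.Finite Γ(X, X.basicOpen f) Γ(M, X.basicOpen f) ∧
      x.1 ∈ X.basicOpen f := by
    obtain ⟨i, hi⟩ := TopologicalSpace.Opens.mem_iSup.1 (hcov.ge (TopologicalSpace.Opens.mem_top x.1))
    obtain ⟨f, hf, hx⟩ := hU.exists_basicOpen_le ⟨x.1, hi⟩ x.2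
    exact ⟨f, finite_sections_of_generatingSections (hU.basicOpen f) hf M (σ.generators i)
      (hσ.isFiniteType i).finite, hx⟩
  choose f hf hx using h1
  have hspan : Ideal.span (Set.range f) = ⊤ := by
    rw [← hU.self_le_iSup_basicOpen_iff]
    intro x hxU
    exact TopologicalSpace.Opens.mem_iSup.2 ⟨⟨_, ⟨x, hxU⟩, rfl⟩, hx ⟨x, hxU⟩⟩
  have (g : Set.range f) : IsLocalization.Away g.1 Γ(X, X.basicOpen g.1) :=
    hU.isLocalization_basicOpen g.1
  have (g : Set.range f) := restrictBasicOpen_isLocalizedModule hU M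
    (localizesOn_of_isQuasicoherent M hU) g.1
  refine Module.Finite.of_localizationSpan' (Set.range f) hspan
    (Mₚ := fun g => Γ(M, X.basicOpen g.1)) (Rₚ := fun g => Γ(X, X.basicOpen g.1))
    (fun g => restrictBasicOpen M g.1) ?_
  rintro ⟨_, x, rfl⟩
  exact hf x

end FiniteType

end

/-! ### Values as tensor products, with their functoriality -/

section

open scoped TensorProduct

variable {X : Scheme.{u}} {U : X.Opens} (hU : IsAffineOpen U)

section Values

variable {B B' : Type u} [CommRing B] [CommRing B'] [Algebra Γ(X, U) B] [Algebra Γ(X, U) B']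

/-- The morphism of `X`-schemes given by a homomorphism of algebras. -/
def specOverMap (f : B →ₐ[Γ(X, U)] B') : specOver hU B' ⟶ specOver hU B :=
  Over.homMk (Spec.map (CommRingCat.ofHom f.toRingHom)) (by
    have h : CommRingCat.ofHom (algebraMap Γ(X, U) B) ≫ CommRingCat.ofHom f.toRingHom =
        CommRingCat.ofHom (algebraMap Γ(X, U) B') := by
      ext x
      exact f.commutes x
    change Spec.map _ ≫ Spec.map _ ≫ hU.fromSpec = Spec.map _ ≫ hU.fromSpec
    rw [← h, Spec.map_comp, Category.assoc])

namespace ModuleFunctor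

variable (F G : ModuleFunctor X)

/-- The functoriality of the values of a module-valued functor at algebras. -/
def valMap (f : B →ₐ[Γ(X, U)] B') : F.val hU B →+ F.val hU B' := F.res (specOverMap hU f)

lemma valMap_smul (f : B →ₐ[Γ(X, U)] B') (b : B) (x : F.val hU B) :
    F.valMap hU f (b • x) = f b • F.valMap hU f x := by
  have h := ConcreteCategory.congr_hom
    (Scheme.ΓSpecIso_inv_naturality (CommRingCat.ofHom f.toRingHom)) b
  refine (F.res_smul (specOverMap hU f) _ _).trans ?_
  exact congrArg (· • (show F.Sec (specOver hU B') from F.valMap hU f x)) h.symm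

variable {F G}

/-- The value of a morphism of module-valued functors at an algebra. -/
def valEv (t : F ⟶ G) (B : Type u) [CommRing B] [Algebra Γ(X, U) B] :
    F.val hU B →ₗ[B] G.val hU B where
  toFun := ev t (specOver hU B)
  map_add' := map_add _
  map_smul' _ _ := map_smul (ev t (specOver hU B)) _ _

lemma valEv_valMap (t : F ⟶ G) (f : B →ₐ[Γ(X, U)] B') (x : F.val hU B) :
    valEv hU t B' (F.valMap hU f x) = G.valMap hU f (valEv hU t B x) :=
  ev_res t (specOverMap hU f) x

end ModuleFunctor

variable (U) in
/-- A morphism of modules on sections, as a linear map. -/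
def appₗ {M N : X.Modules} (φ : M ⟶ N) : Γ(M, U) →ₗ[Γ(X, U)] Γ(N, U) where
  toFun := φ.app U
  map_add' := map_add _
  map_smul' r x := φ.app_smul r x

open ModuleFunctor

/-- The value of `Y ↦ Γ(Y, M_Y)` at an algebra `B` over the ring of functions on `U`. -/
def valEquiv (B : Type u) [CommRing B] [Algebra Γ(X, U) B] (M : X.Modules) [M.IsQuasicoherent] :
    B ⊗[Γ(X, U)] Γ(M, U) ≃ₗ[B] ((underline X).obj M).val hU B :=
  (toVal_isBaseChange hU B M).equiv

lemma valEquiv_tmul (M : X.Modules) [M.IsQuasicoherent] (b : B) (x : Γ(M, U)) :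
    valEquiv hU B M (b ⊗ₜ x) = b • toVal hU B M x :=
  IsBaseChange.equiv_tmul _ b x

lemma valMap_valEquiv (f : B →ₐ[Γ(X, U)] B') (M : X.Modules) [M.IsQuasicoherent]
    (t : B ⊗[Γ(X, U)] Γ(M, U)) :
    ((underline X).obj M).valMap hU f (valEquiv hU B M t) =
      valEquiv hU B' M (LinearMap.rTensor Γ(M, U) f.toLinearMap t) := by
  induction t with
  | zero => simp only [map_zero]
  | add x y hx hy => simp only [map_add, hx, hy]
  | tmul b x =>
    rw [valEquiv_tmul, valMap_smul, LinearMap.rTensor_tmul, valEquiv_tmul]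
    congr 1
    exact res_pulledSection M _ _ _ x

lemma valEv_valEquiv {M N : X.Modules} [M.IsQuasicoherent] [N.IsQuasicoherent] (φ : M ⟶ N)
    (t : B ⊗[Γ(X, U)] Γ(M, U)) :
    valEv hU ((underline X).map φ) B (valEquiv hU B M t) =
      valEquiv hU B N (LinearMap.lTensor B (appₗ U φ) t) := by
  induction t with
  | zero => simp only [map_zero]
  | add x y hx hy => simp only [map_add, hx, hy]
  | tmul b x =>
    rw [valEquiv_tmul, map_smul, LinearMap.lTensor_tmul, valEquiv_tmul]
    congr 1
    exact ev_pulledSection φ _ _ x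

end Values

section Cover

/-- Every point of an `X`-scheme has an open neighbourhood which is the spectrum of an algebra over
the functions on a given affine open neighbourhood of the image of the point. -/
lemma exists_specOver (Y : Over X) (y : Y.left) (hy : Y.hom y ∈ U) :
    ∃ (B : Type u) (_ : CommRing B) (_ : Algebra Γ(X, U) B) (g : specOver hU B ⟶ Y),
      IsOpenImmersion g.left ∧ y ∈ Set.range g.left := by
  obtain ⟨W, hW, hyW, hWU⟩ := (Y.left.isBasis_affineOpens).exists_subset_of_mem_open
    (show y ∈ Y.hom ⁻¹ᵁ U from hy) (Y.hom ⁻¹ᵁ U).isOpen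
  obtain ⟨W, hW', rfl⟩ := hW
  let alg : Algebra Γ(X, U) Γ(Y.left, W) := (Y.hom.appLE U W hWU).hom.toAlgebra
  have hW' : IsAffineOpen W := hW'
  refine ⟨Γ(Y.left, W), inferInstance, alg, Over.homMk hW'.fromSpec ?_, ?_, ?_⟩
  · exact (IsAffineOpen.SpecMap_appLE_fromSpec Y.hom hU hW' hWU).symm
  · exact inferInstanceAs (IsOpenImmersion hW'.fromSpec)
  · change y ∈ Set.range hW'.fromSpec
    rw [hW'.range_fromSpec]
    exact hyW

end Cover

end

/-! ### Direct images and change of the affine open -/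

section

open scoped TensorProduct

section DirectImage

variable {X S : Scheme.{u}}

/-- The preimage of the basic open subset of `r` is the basic open subset of the pullback of `r`, so
both conditions are those for `M` on `f ⁻¹ᵁ W`. -/
lemma LocalizesOn.pushforward (f : S ⟶ X) (M : S.Modules) {W : X.Opens}
    (h : LocalizesOn M (f ⁻¹ᵁ W)) : LocalizesOn ((Scheme.Modules.pushforward f).obj M) W := by
  intro r
  have e : f ⁻¹ᵁ X.basicOpen r = S.basicOpen (f.app W r) := Scheme.preimage_basicOpen f r
  obtain ⟨h1, h2⟩ := h (f.app W r)
  have hb := map_bijective_of_eq M e.ge e.le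
  have hc (x : Γ(M, f ⁻¹ᵁ W)) : M.presheaf.map (homOfLE e.ge).op
      (((Scheme.Modules.pushforward f).obj M).presheaf.map (homOfLE (X.basicOpen_le r)).op x) =
      M.presheaf.map (homOfLE (S.basicOpen_le _)).op x :=
    map_map M _ _ x
  refine ⟨fun x hx => ?_, fun y => ?_⟩
  · obtain ⟨n, hn⟩ := h1 x ((hc x).symm.trans ((congrArg _ hx).trans (map_zero _)))
    refine ⟨n, Eq.trans ?_ hn⟩
    change f.app W (r ^ n) • (show Γ(M, f ⁻¹ᵁ W) from x) = _
    rw [map_pow]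
  · obtain ⟨n, x, hx⟩ := h2 (M.presheaf.map (homOfLE e.ge).op y)
    refine ⟨n, x, hb.1 ((hc x).trans (hx.trans ?_))⟩
    have h3 := M.map_smul (homOfLE e.ge)
      (f.app (X.basicOpen r) ((X.presheaf.map (homOfLE (X.basicOpen_le r)).op r) ^ n))
      (show Γ(M, f ⁻¹ᵁ X.basicOpen r) from y)
    refine Eq.trans ?_ h3.symm
    rw [map_pow, map_pow]
    congr 2
    have h4 := ConcreteCategory.congr_hom (f.naturality (homOfLE (X.basicOpen_le r)).op) r
    refine Eq.trans ?_ (congrArg (S.presheaf.map (homOfLE e.ge).op) h4).symm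
    have h5 := ConcreteCategory.congr_hom (S.presheaf.map_comp
      (homOfLE (f.preimage_mono (X.basicOpen_le r))).op (homOfLE e.ge).op) (f.app W r)
    exact h5

lemma isQuasicoherent_of_forall_localizesOn {P : X.Modules}
    (h : ∀ U : X.Opens, IsAffineOpen U → LocalizesOn P U) : P.IsQuasicoherent :=
  isQuasicoherent_of_localizesOn (ι := X.affineOpens) (U := fun U => U.1) (fun U => U.2)
    (iSup_affineOpens_eq_top X) (fun U => h U.1 U.2)

instance isQuasicoherent_pushforward (f : S ⟶ X) [IsAffineHom f] (M : S.Modules)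
    [M.IsQuasicoherent] : ((Scheme.Modules.pushforward f).obj M).IsQuasicoherent :=
  isQuasicoherent_of_forall_localizesOn fun _ hU =>
    (localizesOn_of_isQuasicoherent M (hU.preimage f)).pushforward f M

/-- Here separatedness enters: a morphism from an affine scheme to a separated scheme is affine.
Direct images from affine opens are therefore quasi-coherent. -/
instance isAffineHom_fromSpec [X.IsSeparated] {V : X.Opens} (hV : IsAffineOpen V) :
    IsAffineHom hV.fromSpec :=
  IsAffineHom.of_comp hV.fromSpec (terminal.from X)

lemma isAffineOpen_inf [X.IsSeparated] {U V : X.Opens} (hU : IsAffineOpen U)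
    (hV : IsAffineOpen V) : IsAffineOpen (U ⊓ V) := hU.inf hV

end DirectImage

section OverOpen

variable {X : Scheme.{u}}

/-- An open subset of an `X`-scheme, as an `X`-scheme. -/
def overOpen (Y : Over X) (O : Y.left.Opens) : Over X := Over.mk (O.ι ≫ Y.hom)

/-- The inclusion of an open subset of an `X`-scheme. -/
def overOpenι (Y : Over X) (O : Y.left.Opens) : overOpen Y O ⟶ Y := Over.homMk O.ι

instance (Y : Over X) (O : Y.left.Opens) : IsOpenImmersion (overOpenι Y O).left :=
  inferInstanceAs (IsOpenImmersion O.ι)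

lemma range_overOpenι (Y : Over X) (O : Y.left.Opens) :
    Set.range (overOpenι Y O).left = O := by
  exact O.range_ι

lemma exists_over_lift {Y Z T : Over X} (i : Z ⟶ Y) [IsOpenImmersion i.left] (a : T ⟶ Y)
    (h : Set.range a.left ⊆ Set.range i.left) : ∃ b : T ⟶ Z, b ≫ i = a := by
  have e : IsOpenImmersion.lift i.left a.left h ≫ i.left = a.left :=
    IsOpenImmersion.lift_fac i.left a.left h
  refine ⟨Over.homMk (IsOpenImmersion.lift i.left a.left h) ?_, ?_⟩
  · rw [← Over.w i, reassoc_of% e, Over.w a]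
  · ext1
    exact e

lemma over_openImmersion_cancel {Y Z T : Over X} (i : Z ⟶ Y) [IsOpenImmersion i.left] {a b : T ⟶ Z}
    (h : a ≫ i = b ≫ i) : a = b := by
  ext1
  rw [← cancel_mono i.left]
  exact congrArg CommaMorphism.left h

lemma over_hom_apply {Y Z : Over X} (g : Z ⟶ Y) (z : Z.left) : Y.hom (g.left z) = Z.hom z := by
  rw [← Over.w g]
  rfl

end OverOpen

section ChangeOfOpen

variable {X : Scheme.{u}} {U V : X.Opens} (hU : IsAffineOpen U) (hV : IsAffineOpen V) (h : V ≤ U)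

variable {B B' : Type u} [CommRing B] [CommRing B'] [Algebra Γ(X, U) B] [Algebra Γ(X, V) B']
  (f : B →+* B')
  (hf : ∀ a : Γ(X, U), f (algebraMap Γ(X, U) B a) =
    algebraMap Γ(X, V) B' (X.presheaf.map (homOfLE h).op a))

/-- The morphism of `X`-schemes between spectra of algebras over functions on different affine open
subsets. -/
def specOverRestrict : specOver hV B' ⟶ specOver hU B :=
  Over.homMk (Spec.map (CommRingCat.ofHom f)) (by
    have h1 : CommRingCat.ofHom (algebraMap Γ(X, U) B) ≫ CommRingCat.ofHom f =
        X.presheaf.map (homOfLE h).op ≫ CommRingCat.ofHom (algebraMap Γ(X, V) B') := by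
      ext x
      exact hf x
    change Spec.map _ ≫ Spec.map _ ≫ hU.fromSpec = Spec.map _ ≫ hV.fromSpec
    rw [← hU.map_fromSpec hV (homOfLE h).op, ← Spec.map_comp_assoc, h1, Spec.map_comp_assoc])

lemma res_specOverRestrict_smul (F : ModuleFunctor X) (b : B) (x : F.val hU B) :
    F.res (specOverRestrict hU hV h f hf) (b • x : F.val hU B) =
      (f b • (show F.val hV B' from F.res (specOverRestrict hU hV h f hf) x) : F.val hV B') := by
  have h' := ConcreteCategory.congr_hom
    (Scheme.ΓSpecIso_inv_naturality (CommRingCat.ofHom f)) b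
  refine (F.res_smul (specOverRestrict hU hV h f hf) _ _).trans ?_
  exact congrArg (· • (show F.Sec (specOver hV B') from
    F.res (specOverRestrict hU hV _ f hf) x)) h'.symm

lemma res_specOverRestrict_toVal (M : X.Modules) (x : Γ(M, U)) :
    ((underline X).obj M).res (specOverRestrict hU hV h f hf) (toVal hU B M x) =
      toVal hV B' M (M.presheaf.map (homOfLE h).op x) := by
  refine (res_pulledSection M (top_le_specOver hU B) (specOverRestrict hU hV h f hf)
    ((top_le_specOver hV B').trans ((specOver hV B').hom.preimage_mono h)) x).trans ?_
  exact (pulledSection_map M h _ _ _ x).symm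

/-- Restriction of functions as an algebra structure. -/
@[reducible] def restrictAlgebra : Algebra Γ(X, U) Γ(X, V) :=
  (X.presheaf.map (homOfLE h).op).hom.toAlgebra

/-- With `A`, `A'` the rings of `U`, `V`, the restriction is `B ⊗_A Γ(M, U) → (A' ⊗_A B) ⊗_{A'} Γ(M,
V)`. The target is `B ⊗_A Γ(M, V)` by cancellation of base change, so the bijection `Γ(M, U) → Γ(M,
V)` of `A`-modules suffices, without flatness. -/
lemma bijective_res_specOverRestrict (M : X.Modules) [M.IsQuasicoherent]
    (hM : Function.Bijective (M.presheaf.map (homOfLE h).op)) :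
    letI := restrictAlgebra h
    Function.Bijective (((underline X).obj M).res
      (specOverRestrict hU hV h (B := B) (B' := Γ(X, V) ⊗[Γ(X, U)] B)
        Algebra.TensorProduct.includeRight.toRingHom
        (fun a => (Algebra.TensorProduct.includeRight.commutes a).trans rfl))) := by
  let _ := restrictAlgebra h
  let _ : Module Γ(X, U) Γ(M, V) := Module.compHom _ (algebraMap Γ(X, U) Γ(X, V))
  have : IsScalarTower Γ(X, U) Γ(X, V) Γ(M, V) := .of_algebraMap_smul fun _ _ => rfl
  let ρ₀ : Γ(M, U) →ₗ[Γ(X, U)] Γ(M, V) :=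
    { toFun := M.presheaf.map (homOfLE h).op
      map_add' := map_add _
      map_smul' r x := M.map_smul (homOfLE h) r x }
  let ρ : Γ(M, U) ≃ₗ[Γ(X, U)] Γ(M, V) := LinearEquiv.ofBijective ρ₀ hM
  set g := specOverRestrict hU hV h (B := B) (B' := Γ(X, V) ⊗[Γ(X, U)] B)
        Algebra.TensorProduct.includeRight.toRingHom
        (fun a => (Algebra.TensorProduct.includeRight.commutes a).trans rfl)
  let σ : ((underline X).obj M).val hU B →+
    ((underline X).obj M).val hV (Γ(X, V) ⊗[Γ(X, U)] B) := ((underline X).obj M).res g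
  let e1 : B ⊗[Γ(X, U)] Γ(M, U) ≃+ ((underline X).obj M).val hU B := (valEquiv hU B M).toAddEquiv
  let e2 : B ⊗[Γ(X, U)] Γ(M, U) ≃+ Γ(M, V) ⊗[Γ(X, U)] B :=
    ((TensorProduct.congr (.refl _ B) ρ).trans (TensorProduct.comm _ _ _)).toAddEquiv
  let e3 : Γ(M, V) ⊗[Γ(X, V)] (Γ(X, V) ⊗[Γ(X, U)] B) ≃+ Γ(M, V) ⊗[Γ(X, U)] B :=
    (TensorProduct.AlgebraTensorModule.cancelBaseChange Γ(X, U) Γ(X, V) Γ(X, V)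
      Γ(M, V) B).toAddEquiv
  let e4 : Γ(M, V) ⊗[Γ(X, V)] (Γ(X, V) ⊗[Γ(X, U)] B) ≃+
      ((underline X).obj M).val hV (Γ(X, V) ⊗[Γ(X, U)] B) :=
    ((TensorProduct.comm _ _ _).toAddEquiv).trans
      (valEquiv hV (Γ(X, V) ⊗[Γ(X, U)] B) M).toAddEquiv
  have key (t : B ⊗[Γ(X, U)] Γ(M, U)) :
      σ (e1 t) = e4 (e3.symm (e2 t)) := by
    induction t with
    | zero => simp only [map_zero]
    | add x y hx hy => simp only [map_add, hx, hy]
    | tmul b x =>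
      have h1 : e1 (b ⊗ₜ x) = b • toVal hU B M x := valEquiv_tmul hU M b x
      have h2 : e2 (b ⊗ₜ x) = ρ x ⊗ₜ b := rfl
      have h3 : e3.symm (ρ x ⊗ₜ b) = ρ x ⊗ₜ (1 ⊗ₜ b) := by
        rw [AddEquiv.symm_apply_eq]
        refine Eq.symm ((TensorProduct.AlgebraTensorModule.cancelBaseChange_tmul ..).trans ?_)
        rw [one_smul]
      have h4 : e4 (ρ x ⊗ₜ (1 ⊗ₜ b)) = ((1 : Γ(X, V)) ⊗ₜ[Γ(X, U)] b) •
        toVal hV (Γ(X, V) ⊗[Γ(X, U)] B) M (ρ x) := valEquiv_tmul hV M _ _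
      rw [h1, h2, h3, h4]
      refine (res_specOverRestrict_smul hU hV h _ _ ((underline X).obj M) b _).trans ?_
      exact congrArg (HSMul.hSMul ((1 : Γ(X, V)) ⊗ₜ[Γ(X, U)] b))
        (res_specOverRestrict_toVal (B := B) (B' := Γ(X, V) ⊗[Γ(X, U)] B) hU hV h
          Algebra.TensorProduct.includeRight.toRingHom
          (fun a => (Algebra.TensorProduct.includeRight.commutes a).trans rfl) M x)
  have h5 : Function.Bijective (fun t => σ (e1 t)) := by
    simp only [key]
    exact (e2.trans (e3.symm.trans e4)).bijective
  exact (Function.Bijective.of_comp_iff _ e1.bijective).1 h5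

/-- The spectrum of `Γ(X, V) ⊗ B` is the fibre product of the spectrum of `B` with `V` over `U`;
open immersions are stable under base change. -/
lemma isOpenImmersion_specOverRestrict :
    letI := restrictAlgebra h
    IsOpenImmersion (specOverRestrict hU hV h (B := B) (B' := Γ(X, V) ⊗[Γ(X, U)] B)
        Algebra.TensorProduct.includeRight.toRingHom
        (fun a => (Algebra.TensorProduct.includeRight.commutes a).trans rfl)).left ∧
    (specOver hU B).hom ⁻¹' V ⊆ Set.range (specOverRestrict hU hV h (B := B)
        (B' := Γ(X, V) ⊗[Γ(X, U)] B)
        Algebra.TensorProduct.includeRight.toRingHom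
        (fun a => (Algebra.TensorProduct.includeRight.commutes a).trans rfl)).left := by
  let _ := restrictAlgebra h
  have h1 : Spec.map (X.presheaf.map (homOfLE h).op) ≫ hU.fromSpec = hV.fromSpec :=
    hU.map_fromSpec hV (homOfLE h).op
  have h2 : IsOpenImmersion (Spec.map (X.presheaf.map (homOfLE h).op)) := by
    have : IsOpenImmersion (Spec.map (X.presheaf.map (homOfLE h).op) ≫ hU.fromSpec) := by
      rw [h1]; infer_instance
    exact IsOpenImmersion.of_comp _ hU.fromSpec
  have h3 := isPullback_SpecMap_of_isPushout _ _ _ _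
    (CommRingCat.isPushout_tensorProduct Γ(X, U) Γ(X, V) B)
  refine ⟨?_, ?_⟩
  · exact MorphismProperty.of_isPullback (P := @IsOpenImmersion) h3 h2
  · intro y hy
    have h5 : hU.fromSpec (Spec.map (CommRingCat.ofHom (algebraMap Γ(X, U) B)) y) ∈ V := hy
    rw [← SetLike.mem_coe, ← hV.range_fromSpec] at h5
    obtain ⟨z, hz⟩ := h5
    rw [← h1] at hz
    have h6 : Spec.map (X.presheaf.map (homOfLE h).op) z =
      Spec.map (CommRingCat.ofHom (algebraMap Γ(X, U) B)) y :=
      hU.fromSpec.isOpenEmbedding.injective hz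
    obtain ⟨t, -, ht⟩ := Scheme.exists_preimage_of_isPullback h3 z y h6
    exact ⟨t, ht⟩

/-- The part of the spectrum of an algebra over the functions on `U` that lies over `V ≤ U`. -/
lemma exists_specOver_of_le (B : Type u) [CommRing B] [Algebra Γ(X, U) B] :
    ∃ (B' : Type u) (_ : CommRing B') (_ : Algebra Γ(X, V) B')
      (g : specOver hV B' ⟶ specOver hU B), IsOpenImmersion g.left ∧
      (specOver hU B).hom ⁻¹' V ⊆ Set.range g.left ∧
      ∀ (M : X.Modules) [M.IsQuasicoherent],
        Function.Bijective (M.presheaf.map (homOfLE h).op) →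
        Function.Bijective (((underline X).obj M).res g) := by
  let _ := restrictAlgebra h
  exact ⟨Γ(X, V) ⊗[Γ(X, U)] B, inferInstance, inferInstance, _,
    (isOpenImmersion_specOverRestrict hU hV h).1, (isOpenImmersion_specOverRestrict hU hV h).2,
    fun M _ => bijective_res_specOverRestrict hU hV h M⟩

lemma specOver_hom_mem (B : Type u) [CommRing B] [Algebra Γ(X, U) B] (y : (specOver hU B).left) :
    (specOver hU B).hom y ∈ U := top_le_specOver hU B (TopologicalSpace.Opens.mem_top y)

end ChangeOfOpen

/-! ### Modules that are direct images from an affine open -/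

section ExtendsFrom

variable {X : Scheme.{u}}

/-- A module `P` is the direct image of its restriction to `V`, as far as sections on affine
open subsets are concerned. -/
def ExtendsFrom (P : X.Modules) (V : X.Opens) : Prop :=
  ∀ W : X.Opens, IsAffineOpen W →
    Function.Bijective (P.presheaf.map (homOfLE (inf_le_left : W ⊓ V ≤ W)).op)

open ModuleFunctor

variable [X.IsSeparated] {P : X.Modules} [P.IsQuasicoherent] {V : X.Opens} (hV : IsAffineOpen V)
  (hP : ExtendsFrom P V)

-- Locally `Y` is the spectrum of an algebra over the ring of an affine open `U`. Its part over the
-- affine open `U ⊓ V` factors through `Z`, and restriction to that part is bijective because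
-- sections of `P` on `U` and on `U ⊓ V` agree.
include hV hP in
lemma ExtendsFrom.res_injective {Y Z : Over X} (g : Z ⟶ Y) [IsOpenImmersion g.left]
    (hg : Y.hom ⁻¹' V ⊆ Set.range g.left) : Function.Injective (((underline X).obj P).res g) := by
  rw [injective_iff_map_eq_zero]
  intro x hx
  refine (underline_isLocal P).eq_of_locally_eq fun y => ?_
  obtain ⟨U, hU, hyU, -⟩ := X.isBasis_affineOpens.exists_subset_of_mem_open
    (Set.mem_univ (Y.hom y)) isOpen_univ
  obtain ⟨U, hU', rfl⟩ := hU
  have hU : IsAffineOpen U := hU'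
  obtain ⟨B, _, _, a, ha, hy⟩ := exists_specOver hU Y y hyU
  refine ⟨_, a, ha, hy, ?_⟩
  obtain ⟨B', _, _, g₀, hg₀, hr, hb⟩ := exists_specOver_of_le hU (isAffineOpen_inf hU hV)
    inf_le_left B
  obtain ⟨b, hb'⟩ := exists_over_lift g (g₀ ≫ a) (by
    rintro _ ⟨z, rfl⟩
    refine hg ?_
    change Y.hom ((g₀ ≫ a).left z) ∈ V
    rw [over_hom_apply]
    exact (specOver_hom_mem (isAffineOpen_inf hU hV) B' z).2)
  apply (hb P (hP U hU)).1
  rw [← res_comp, ← res_comp, ← hb', res_comp, hx, map_zero, map_zero]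

include hV hP in
/-- A section is zero if it vanishes on all schemes over `V`. -/
lemma ExtendsFrom.eq_zero {Y : Over X} (x : ((underline X).obj P).Sec Y)
    (h : ∀ (Z : Over X) (g : Z ⟶ Y), (∀ z, Z.hom z ∈ V) → ((underline X).obj P).res g x = 0) :
    x = 0 := by
  refine (injective_iff_map_eq_zero _).1 (hP.res_injective hV (overOpenι Y (Y.hom ⁻¹ᵁ V)) ?_) x
    (h _ _ fun z => ?_)
  · rw [range_overOpenι]; rfl
  · rw [← over_hom_apply (overOpenι Y (Y.hom ⁻¹ᵁ V))]
    have : (overOpenι Y (Y.hom ⁻¹ᵁ V)).left z ∈ Set.range (overOpenι Y (Y.hom ⁻¹ᵁ V)).left := ⟨z, rfl⟩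
    rw [range_overOpenι] at this
    exact this

-- The value at `Y` depends only on the part of `Y` over `V`. Surjectivity comes from gluing the
-- unique local extensions of `s`.
include hV hP in
lemma ExtendsFrom.res_bijective {Y Z : Over X} (g : Z ⟶ Y) [IsOpenImmersion g.left]
    (hg : Y.hom ⁻¹' V ⊆ Set.range g.left) (hZ : ∀ z, Z.hom z ∈ V) :
    Function.Bijective (((underline X).obj P).res g) := by
  refine ⟨hP.res_injective hV g hg, fun s => ?_⟩
  let F := (underline X).obj P
  have lift {W T : Over X} (c : T ⟶ W) (hT : ∀ z, T.hom z ∈ V) {Z' : Over X} (i : Z' ⟶ W)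
      [IsOpenImmersion i.left] (hi : W.hom ⁻¹' V ⊆ Set.range i.left) : ∃ b : T ⟶ Z', b ≫ i = c := by
    refine exists_over_lift i c ?_
    rintro _ ⟨z, rfl⟩
    refine hi ?_
    change W.hom (c.left z) ∈ V
    rw [over_hom_apply]
    exact hT z
  have over_of {T Z' : Over X} (c : T ⟶ Z') (hZ' : ∀ z, Z'.hom z ∈ V) (z : T.left) :
      T.hom z ∈ V := by
    rw [← over_hom_apply c]; exact hZ' _
  -- The property to be glued is agreement with `s` on every scheme that maps compatibly to `W` and
  -- to `Z`. It is stable under restriction, and it determines `t` by the injectivity already shown.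
  refine ((underline_isLocal P).exists_of_locally (Y := Y)
    (fun {W} a t => ∀ (T : Over X) (c : T ⟶ W) (b : T ⟶ Z), b ≫ g = c ≫ a →
      F.res c t = F.res b s) ?_ ?_ ?_).elim fun t ht => ?_
  · intro W W' a h t ht T c b hb
    rw [← res_comp]
    exact ht T (c ≫ h) b (by rw [hb, Category.assoc])
  · intro W a t t' ht ht'
    have hr : W.hom ⁻¹' V ⊆ Set.range (overOpenι W (W.hom ⁻¹ᵁ V)).left := by
      rw [range_overOpenι]; rfl
    refine hP.res_injective hV (overOpenι W (W.hom ⁻¹ᵁ V)) hr ?_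
    obtain ⟨b, hb⟩ := lift (overOpenι W (W.hom ⁻¹ᵁ V) ≫ a) (fun z => by
      rw [← over_hom_apply (overOpenι W (W.hom ⁻¹ᵁ V))]
      have : (overOpenι W (W.hom ⁻¹ᵁ V)).left z ∈
        Set.range (overOpenι W (W.hom ⁻¹ᵁ V)).left := ⟨z, rfl⟩
      rw [range_overOpenι] at this
      exact this) g hg
    exact (ht _ _ b hb).trans (ht' _ _ b hb).symm
  · intro y
    obtain ⟨U, hU, hyU, -⟩ := X.isBasis_affineOpens.exists_subset_of_mem_open
      (Set.mem_univ (Y.hom y)) isOpen_univ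
    obtain ⟨U, hU', rfl⟩ := hU
    have hU : IsAffineOpen U := hU'
    obtain ⟨B, _, _, a, ha, hy⟩ := exists_specOver hU Y y hyU
    refine ⟨_, a, ha, hy, ?_⟩
    have hUV := isAffineOpen_inf hU hV
    obtain ⟨B', _, _, g₀, hg₀, hr, hb⟩ := exists_specOver_of_le hU hUV inf_le_left B
    have hmem := fun z => (specOver_hom_mem hUV B' z).2
    obtain ⟨b, hb'⟩ := lift (g₀ ≫ a) hmem g hg
    obtain ⟨t, ht⟩ := (hb P (hP U hU)).2 (F.res b s)
    refine ⟨t, fun T c b' hc => ?_⟩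
    obtain ⟨d, rfl⟩ := lift c (over_of b' hZ) g₀ (fun x hx => hr ⟨specOver_hom_mem hU B x, hx⟩)
    rw [res_comp, ht, ← res_comp]
    congr 1
    refine congrArg _ (over_openImmersion_cancel g ?_)
    rw [hc, Category.assoc, Category.assoc, hb']
  · refine ⟨t, (underline_isLocal P).eq_of_locally_eq fun z => ?_⟩
    obtain ⟨W, a, ha, ⟨w, hw⟩, hat⟩ := ht (g.left z)
    let O : Z.left.Opens := g.left ⁻¹ᵁ a.left.opensRange
    obtain ⟨c, hc⟩ := exists_over_lift a (overOpenι Z O ≫ g) (by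
      rintro _ ⟨x, rfl⟩
      have : (overOpenι Z O).left x ∈ Set.range (overOpenι Z O).left := ⟨x, rfl⟩
      rw [range_overOpenι] at this
      exact this)
    refine ⟨_, overOpenι Z O, inferInstance, ?_, ?_⟩
    · rw [range_overOpenι]
      exact ⟨w, hw⟩
    · rw [← hat _ c (overOpenι Z O) hc.symm, ← res_comp, ← res_comp, hc]

end ExtendsFrom

section LocalBijective

variable {X : Scheme.{u}} {F G : ModuleFunctor X} {U : X.Opens} (hU : IsAffineOpen U)

open ModuleFunctor

lemma ev_bijective_of_valEv_bijective (hF : F.IsLocal) (hG : G.IsLocal) (t : F ⟶ G)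
    (h : ∀ (B : Type u) [CommRing B] [Algebra Γ(X, U) B], Function.Bijective (valEv hU t B))
    {Y : Over X} (hY : ∀ y, Y.hom y ∈ U) : Function.Bijective (ev t Y) := by
  have inj {Y : Over X} (hY : ∀ y, Y.hom y ∈ U) : Function.Injective (ev t Y) := by
    intro x x' hx
    refine hF.eq_of_locally_eq fun y => ?_
    obtain ⟨B, _, _, a, ha, hy⟩ := exists_specOver hU Y y (hY y)
    refine ⟨_, a, ha, hy, (h B).1 ?_⟩
    exact (ev_res t a x).trans ((congrArg _ hx).trans (ev_res t a x').symm)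
  refine ⟨inj hY, fun s => ?_⟩
  refine (hF.exists_of_locally (Y := Y) (fun {W} a x => ev t W x = G.res a s) ?_ ?_ ?_).elim fun x hx => ?_
  · intro Z W a b x hx
    rw [ev_res, hx, res_comp]
  · intro Z a x x' hx hx'
    refine inj (fun z => ?_) (hx.trans hx'.symm)
    rw [← over_hom_apply a]
    exact hY _
  · intro y
    obtain ⟨B, _, _, a, ha, hy⟩ := exists_specOver hU Y y (hY y)
    exact ⟨_, a, ha, hy, (h B).2 _⟩
  · refine ⟨x, hG.eq_of_locally_eq fun y => ?_⟩
    obtain ⟨W, a, ha, hy, h⟩ := hx y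
    exact ⟨W, a, ha, hy, by rw [← ev_res, h]⟩

-- Over `U` the values are `B ⊗ Γ(-, U)`, and an isomorphism on `Γ(-, U)` stays one after tensoring;
-- locality passes from algebras to all schemes over `U`.
include hU in
lemma ev_underline_map_bijective {M N : X.Modules} [M.IsQuasicoherent] [N.IsQuasicoherent]
    (φ : M ⟶ N) (h : Function.Bijective (φ.app U)) {Y : Over X} (hY : ∀ y, Y.hom y ∈ U) :
    Function.Bijective (ev ((underline X).map φ) Y) := by
  refine ev_bijective_of_valEv_bijective hU (underline_isLocal M) (underline_isLocal N) _
    (fun B _ _ => ?_) hY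
  have h1 : Function.Bijective (LinearMap.lTensor B (appₗ U φ)) :=
    (LinearEquiv.lTensor B (LinearEquiv.ofBijective (appₗ U φ) h)).bijective
  have h2 := (valEquiv hU B N).bijective.comp h1
  have h3 : (fun t => valEv hU ((underline X).map φ) B (valEquiv hU B M t)) =
      (fun t => valEquiv hU B N (LinearMap.lTensor B (appₗ U φ) t)) :=
    funext (valEv_valEquiv hU φ)
  exact (Function.Bijective.of_comp_iff (valEv hU ((underline X).map φ) B)
    (valEquiv hU B M).bijective).1 (h3 ▸ h2 : Function.Bijective
      (fun t => valEv hU ((underline X).map φ) B (valEquiv hU B M t)))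

end LocalBijective

end

/-! ### The quasi-coherent module on `X` attached to a module over the ring of an affine open -/

section

section ExtendModule

lemma exists_hom_tilde {R : CommRingCat.{u}} (N : (Spec R).Modules) [N.IsQuasicoherent]
    (Q : ModuleCat.{u} R) (α : moduleSpecΓFunctor.obj N ⟶ Q) :
    ∃ ψ : N ⟶ tilde Q, ∀ t : moduleSpecΓFunctor.obj N,
      ψ.app ⊤ t = (tilde.toOpen Q ⊤).hom (α.hom t) := by
  have hN' : IsIso N.fromTildeΓ := Scheme.Modules.isIso_fromTildeΓ_of_isQuasicoherent N
  refine ⟨inv N.fromTildeΓ ≫ tilde.map α, fun t => ?_⟩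
  have h1 : (inv N.fromTildeΓ).app ⊤ t =
      (tilde.toOpen (moduleSpecΓFunctor.obj N) ⊤).hom t := by
    have h2 := congrArg ((inv N.fromTildeΓ).app ⊤) (fromTildeΓ_app_toOpen N t)
    refine h2.symm.trans ?_
    have h3 : N.fromTildeΓ ≫ inv N.fromTildeΓ = 𝟙 _ := IsIso.hom_inv_id _
    exact congr(Scheme.Modules.Hom.app $h3 ⊤ _)
  refine (congrArg ((tilde.map α).app ⊤) h1).trans ?_
  exact ConcreteCategory.congr_hom (tilde.toOpen_map_app α ⊤) t

variable {X : Scheme.{u}} {U : X.Opens} (hU : IsAffineOpen U)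

/-- The direct image on `X` of the quasi-coherent module on an affine open subset given by a module
over the ring of functions. -/
def extendModule (Q : Type u) [AddCommGroup Q] [Module Γ(X, U) Q] : X.Modules :=
  (Scheme.Modules.pushforward hU.fromSpec).obj (tilde (ModuleCat.of Γ(X, U) Q))

variable (Q : Type u) [AddCommGroup Q] [Module Γ(X, U) Q]

instance [X.IsSeparated] : (extendModule hU Q).IsQuasicoherent :=
  isQuasicoherent_pushforward hU.fromSpec _

/-- `W` and `W ⊓ U` have the same preimage in the spectrum, which maps into `U`. -/
lemma extendsFrom_extendModule : ExtendsFrom (extendModule hU Q) U := fun W _ =>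
  map_bijective_of_eq (tilde (ModuleCat.of Γ(X, U) Q))
    (hU.fromSpec.preimage_mono (inf_le_left : W ⊓ U ≤ W))
    (fun x hx => ⟨hx, by
      have : hU.fromSpec x ∈ Set.range hU.fromSpec := ⟨x, rfl⟩
      rwa [hU.range_fromSpec] at this⟩)

/-- The sections of `extendModule hU Q` on `U` given by elements of `Q`. -/
def toExtendModule : Q →+ Γ(extendModule hU Q, U) where
  toFun q := (tilde.toOpen (ModuleCat.of Γ(X, U) Q) (hU.fromSpec ⁻¹ᵁ U)).hom q
  map_zero' := map_zero _
  map_add' := map_add _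

lemma toExtendModule_eq (q : Q) : toExtendModule hU Q q =
    (tilde (ModuleCat.of Γ(X, U) Q)).presheaf.map
      (homOfLE (le_top : hU.fromSpec ⁻¹ᵁ U ≤ ⊤)).op
      ((tilde.toOpen (ModuleCat.of Γ(X, U) Q) ⊤).hom q) := rfl

lemma toExtendModule_bijective : Function.Bijective (toExtendModule hU Q) :=
  (map_bijective_of_eq (tilde (ModuleCat.of Γ(X, U) Q)) (V := ⊤) le_top (by simp)).comp
    (ConcreteCategory.bijective_of_isIso (tilde.toOpen (ModuleCat.of Γ(X, U) Q) ⊤))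

lemma toExtendModule_smul (r : Γ(X, U)) (q : Q) :
    toExtendModule hU Q (r • q) = r • toExtendModule hU Q q := by
  rw [toExtendModule_eq, toExtendModule_eq]
  have h0 := (tilde.toOpen (ModuleCat.of Γ(X, U) Q) ⊤).hom.map_smul r q
  refine (congrArg _ (h0.trans (Spec_smul_def (tilde (ModuleCat.of Γ(X, U) Q)) r _))).trans ?_
  refine ((tilde (ModuleCat.of Γ(X, U) Q)).map_smul _ _ _).trans ?_
  refine congrArg (· • (show Γ(tilde (ModuleCat.of Γ(X, U) Q), hU.fromSpec ⁻¹ᵁ U) from _)) ?_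
  change _ = hU.fromSpec.app U r
  rw [hU.fromSpec_app_self]
  rfl

/-- The sections of `extendModule hU Q` on `U`. -/
def extendModuleEquiv : Q ≃ₗ[Γ(X, U)] Γ(extendModule hU Q, U) :=
  LinearEquiv.ofBijective
    (show Q →ₗ[Γ(X, U)] Γ(extendModule hU Q, U) from
    { toFun := toExtendModule hU Q
      map_add' := map_add _
      map_smul' := toExtendModule_smul hU Q }) (toExtendModule_bijective hU Q)

/-- Homomorphisms into `extendModule hU Q` given by linear maps on sections over `U`. -/
lemma exists_hom_extendModule (N : X.Modules) [N.IsQuasicoherent] (α : Γ(N, U) →ₗ[Γ(X, U)] Q) :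
    ∃ ψ : N ⟶ extendModule hU Q, ∀ x, ψ.app U x = extendModuleEquiv hU Q (α x) := by
  have hN : (N.restrict hU.fromSpec).IsQuasicoherent :=
    Scheme.Modules.isQuasicoherent_restrictFunctor hU.fromSpec N
  let e := LinearEquiv.ofBijective (sectionsToSpec hU N) (sectionsToSpec_bijective hU N)
  obtain ⟨ψ', hψ'⟩ := exists_hom_tilde (N.restrict hU.fromSpec) (ModuleCat.of Γ(X, U) Q)
    (ModuleCat.ofHom (R := Γ(X, U)) (X := (moduleSpecΓFunctor (R := Γ(X, U))).obj
      (N.restrict hU.fromSpec)) (α ∘ₗ e.symm.toLinearMap))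
  refine ⟨(Scheme.Modules.restrictAdjunction hU.fromSpec).unit.app N ≫
    (Scheme.Modules.pushforward hU.fromSpec).map ψ', fun x => ?_⟩
  refine (restrictAdjunction_unit_comp_app hU.fromSpec ψ' U x).trans ?_
  have h1 := app_map ψ' (homOfLE (le_top : hU.fromSpec ⁻¹ᵁ U ≤ ⊤)) (sectionsToSpec hU N x)
  have h2 : (N.restrict hU.fromSpec).presheaf.map
      (homOfLE (le_top : hU.fromSpec ⁻¹ᵁ U ≤ ⊤)).op (sectionsToSpec hU N x) =
    N.presheaf.map (homOfLE (hU.fromSpec.image_preimage_le U)).op x := map_map N _ _ x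
  refine (congrArg (ψ'.app _) h2).symm.trans (h1.trans ?_)
  refine Eq.trans ?_ (toExtendModule_eq hU Q (α x)).symm
  refine congrArg _ ((hψ' _).trans ?_)
  exact congrArg (fun y => (tilde.toOpen (ModuleCat.of Γ(X, U) Q) ⊤).hom (α y))
    (e.symm_apply_apply x)

end ExtendModule

end

/-! ### Kernels, finite biproducts and spans of sections -/

section

section Sections

variable {X : Scheme.{u}}

/-- The functor of sections of modules on an open subset. -/
def sectionsFunctor (W : X.Opens) : X.Modules ⥤ Ab.{u} :=
  Scheme.Modules.toPresheaf X ⋙ (evaluation _ _).obj (op W)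

instance (W : X.Opens) : PreservesFiniteLimits (sectionsFunctor W) :=
  have : PreservesFiniteLimits (Scheme.Modules.toPresheaf X) :=
    PreservesLimits.preservesFiniteLimits _
  have : PreservesFiniteLimits ((evaluation X.Opensᵒᵖ Ab.{u}).obj (op W)) :=
    ⟨fun _ _ _ => inferInstance⟩
  comp_preservesFiniteLimits (Scheme.Modules.toPresheaf X) ((evaluation X.Opensᵒᵖ Ab.{u}).obj (op W))

instance : HasFiniteBiproducts X.Modules := Abelian.hasFiniteBiproducts

instance (W : X.Opens) : (sectionsFunctor W).Additive where
  map_add := rfl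

lemma app_injective_of_mono {M N : X.Modules} (i : M ⟶ N) [Mono i] (W : X.Opens) :
    Function.Injective (i.app W) :=
  (AddCommGrpCat.mono_iff_injective _).1
    (inferInstanceAs (Mono ((sectionsFunctor W).map i)))

lemma exists_kernel_ι_app_eq {M N : X.Modules} (φ : M ⟶ N) (W : X.Opens) (x : Γ(M, W))
    (hx : φ.app W x = 0) : ∃ y, (kernel.ι φ).app W y = x := by
  have h : (ShortComplex.mk _ _ (kernel.condition φ)).Exact :=
    ShortComplex.exact_of_f_is_kernel _ (kernelIsKernel φ)
  have h2 := h.map_of_mono_of_preservesKernel (sectionsFunctor W) inferInstance inferInstance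
  exact (ShortComplex.ab_exact_iff _).1 h2 x hx

lemma kernel_app_apply {M N : X.Modules} (φ : M ⟶ N) (W : X.Opens) (y : Γ(kernel φ, W)) :
    φ.app W ((kernel.ι φ).app W y) = 0 :=
  congr(Scheme.Modules.Hom.app $(kernel.condition φ) W y)

/-- To extend a section of the kernel, extend a multiple by `f ^ n` to a section `s` of `M`. As `φ
s` vanishes on the basic open subset, a further power `f ^ m` kills it, so `f ^ m • s` lies in the
kernel; the total exponent is `m + n`. -/
lemma LocalizesOn.kernel {M N : X.Modules} (φ : M ⟶ N) {W : X.Opens} (hM : LocalizesOn M W)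
    (hN : LocalizesOn N W) : LocalizesOn (kernel φ) W := by
  intro f
  have inj (W : X.Opens) := app_injective_of_mono (kernel.ι φ) W
  refine ⟨fun x hx => ?_, fun y => ?_⟩
  · obtain ⟨n, hn⟩ := (hM f).1 ((kernel.ι φ).app W x) (by
      rw [← app_map, hx, map_zero])
    refine ⟨n, inj W ?_⟩
    rw [Scheme.Modules.Hom.app_smul, hn, map_zero]
  · obtain ⟨n, s, hs⟩ := (hM f).2 ((kernel.ι φ).app _ y)
    obtain ⟨m, hm⟩ := (hN f).1 (φ.app W s) (by
      rw [← app_map, hs, Scheme.Modules.Hom.app_smul, kernel_app_apply, smul_zero])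
    obtain ⟨t, ht⟩ := exists_kernel_ι_app_eq φ W (f ^ m • s) (by
      rw [Scheme.Modules.Hom.app_smul, hm])
    refine ⟨m + n, t, inj _ ?_⟩
    rw [app_map, ht, Scheme.Modules.map_smul, hs, Scheme.Modules.Hom.app_smul, smul_smul,
      map_pow, pow_add]

instance isQuasicoherent_kernel {M N : X.Modules} [M.IsQuasicoherent] [N.IsQuasicoherent]
    (φ : M ⟶ N) : (kernel φ).IsQuasicoherent :=
  isQuasicoherent_of_forall_localizesOn fun _ hU =>
    (localizesOn_of_isQuasicoherent M hU).kernel φ (localizesOn_of_isQuasicoherent N hU)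

section Biproduct

variable {ι : Type} [Finite ι] (M : ι → X.Modules)

lemma sum_app {M N : X.Modules} {ι : Type*} (s : Finset ι) (f : ι → (M ⟶ N)) (W : X.Opens)
    (x : Γ(M, W)) : (∑ i ∈ s, f i).app W x = ∑ i ∈ s, (f i).app W x := by
  classical
  induction s using Finset.induction_on with
  | empty => rfl
  | insert a s ha ih => rw [Finset.sum_insert ha, Finset.sum_insert ha, ← ih]; rfl

lemma biproduct_lift_π_app {N : X.Modules} (f : ∀ i, N ⟶ M i) (i : ι) (W : X.Opens) (x : Γ(N, W)) :
    (biproduct.π M i).app W ((biproduct.lift f).app W x) = (f i).app W x :=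
  congr(Scheme.Modules.Hom.app $(biproduct.lift_π f i) W x)

lemma biproduct_app_total [Fintype ι] (W : X.Opens) (x : Γ(⨁ M, W)) :
    ∑ i, (biproduct.ι M i).app W ((biproduct.π M i).app W x) = x := by
  have h := congr(Scheme.Modules.Hom.app $(biproduct.total (f := M)) W x)
  rw [sum_app] at h
  exact h

lemma biproduct_app_ext {W : X.Opens} {x y : Γ(⨁ M, W)}
    (h : ∀ i, (biproduct.π M i).app W x = (biproduct.π M i).app W y) : x = y := by
  cases nonempty_fintype ι
  rw [← biproduct_app_total M W x, ← biproduct_app_total M W y]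
  simp only [h]

lemma LocalizesOn.biproduct {W : X.Opens} (h : ∀ i, LocalizesOn (M i) W) :
    LocalizesOn (⨁ M) W := by
  cases nonempty_fintype ι
  intro f
  refine ⟨fun x hx => ?_, fun y => ?_⟩
  · choose n hn using fun i => (h i f).1 ((biproduct.π M i).app W x) (by
      rw [← app_map, hx, map_zero])
    -- The sum of the exponents serves as a common upper bound for them.
    refine ⟨∑ i, n i, biproduct_app_ext M fun i => ?_⟩
    obtain ⟨k, hk⟩ := Nat.exists_eq_add_of_le (Finset.single_le_sum
      (f := n) (fun _ _ => Nat.zero_le _) (Finset.mem_univ i))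
    rw [Scheme.Modules.Hom.app_smul, hk, add_comm, pow_add, mul_smul, hn, smul_zero, map_zero]
  · choose n s hs using fun i => (h i f).2 ((biproduct.π M i).app _ y)
    have hk (i) := Nat.exists_eq_add_of_le (Finset.single_le_sum
      (f := n) (fun _ _ => Nat.zero_le _) (Finset.mem_univ i))
    choose k hk using hk
    refine ⟨∑ i, n i, ∑ i, (biproduct.ι M i).app W (f ^ k i • s i), ?_⟩
    rw [map_sum]
    refine Eq.trans ?_ (congrArg (_ • ·) (biproduct_app_total M _ y))
    rw [Finset.smul_sum]
    refine Finset.sum_congr rfl fun i _ => ?_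
    rw [← app_map, Scheme.Modules.map_smul, hs, Scheme.Modules.Hom.app_smul,
      Scheme.Modules.Hom.app_smul, smul_smul, map_pow, ← pow_add, hk i, add_comm]

instance isQuasicoherent_biproduct [∀ i, (M i).IsQuasicoherent] : (⨁ M).IsQuasicoherent :=
  isQuasicoherent_of_forall_localizesOn fun _ hU => LocalizesOn.biproduct M fun i =>
    localizesOn_of_isQuasicoherent (M i) hU

lemma isCoherentModule_of_finite {M : X.Modules} [M.IsQuasicoherent] {ι : Type} {U : ι → X.Opens}
    (hU : ∀ i, IsAffineOpen (U i)) (hcov : iSup U = ⊤)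
    (h : ∀ i, Module.Finite Γ(X, U i) Γ(M, U i)) : IsCoherentModule M :=
  isCoherentModule_of_localizesOn (ι := ULift.{u} ι) (U := fun i => U i.down) (fun i => hU i.down)
    ((Equiv.ulift.iSup_comp (g := U)).trans hcov)
    (fun i => localizesOn_of_isQuasicoherent M (hU i.down)) fun i => h i.down

lemma isCoherentModule_of_forall_finite {M : X.Modules} [M.IsQuasicoherent]
    (h : ∀ U, IsAffineOpen U → Module.Finite Γ(X, U) Γ(M, U)) : IsCoherentModule M :=
  isCoherentModule_of_localizesOn (ι := X.affineOpens) (U := fun i => i.1) (fun i => i.2)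
    (iSup_affineOpens_eq_top X)
    (fun i => localizesOn_of_isQuasicoherent M i.2) fun i => h i.1 i.2

lemma IsCoherentModule.biproduct (h : ∀ i, IsCoherentModule (M i)) : IsCoherentModule (⨁ M) := by
  cases nonempty_fintype ι
  have hq (i : ι) : (M i).IsQuasicoherent := (h i).1
  refine isCoherentModule_of_forall_finite fun U hU => ?_
  have hf (i : ι) : Module.Finite Γ(X, U) Γ(M i, U) := (h i).finite hU
  refine Module.Finite.of_surjective
    (∑ i, (appₗ U (biproduct.ι M i)) ∘ₗ LinearMap.proj (R := Γ(X, U)) (φ := fun i => Γ(M i, U)) i)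
    fun x => ⟨fun i => (biproduct.π M i).app U x, ?_⟩
  rw [LinearMap.sum_apply]
  exact biproduct_app_total M U x

end Biproduct

end Sections

section Generation

open ModuleFunctor TensorProduct

variable {X : Scheme.{u}} {U V : X.Opens} (hU : IsAffineOpen U) (hV : IsAffineOpen V) (h : V ≤ U)

include hU hV in
/-- The sections of a quasi-coherent module on `V` are spanned by restrictions of sections on `U`
for affine open subsets `V ≤ U`. -/
lemma mem_span_range_map (M : X.Modules) [M.IsQuasicoherent] (y : Γ(M, V)) :
    y ∈ Submodule.span Γ(X, V) (Set.range (M.presheaf.map (homOfLE h).op)) := by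
  let _ := restrictAlgebra h
  let B := Γ(X, V)
  -- The value of `underline M` at the scheme `V` is computed twice: as `Γ(X, V) ⊗ Γ(M, U)` over the
  -- ring of `U`, and as `Γ(M, V)` over the ring of `V`.
  let g := specOverRestrict hU hV h (B := Γ(X, V)) (B' := Γ(X, V)) (RingHom.id _) (fun a => rfl)
  have hg : IsIso g := by
    have : IsIso ((Over.forget X).map g) := by
      change IsIso (Spec.map (𝟙 _))
      infer_instance
    exact isIso_of_reflects_iso g (Over.forget X)
  let F := (underline X).obj M
  let σ : F.val hU Γ(X, V) →+ F.val hV Γ(X, V) := F.res g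
  have hσ : Function.Bijective σ := F.res_bijective g
  let e := valEquiv hV Γ(X, V) M
  have he (y : Γ(M, V)) : e ((1 : Γ(X, V)) ⊗ₜ y) = toVal hV Γ(X, V) M y :=
    (valEquiv_tmul hV M 1 y).trans (one_smul _ _)
  have key (t : Γ(X, V) ⊗[Γ(X, U)] Γ(M, U)) : ∃ z ∈ Submodule.span Γ(X, V)
      (Set.range (M.presheaf.map (homOfLE h).op)),
        σ (valEquiv hU Γ(X, V) M t) = toVal hV Γ(X, V) M z := by
    induction t with
    | zero => exact ⟨0, Submodule.zero_mem _, by simp only [map_zero]⟩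
    | add x y hx hy =>
      obtain ⟨a, ha, ha'⟩ := hx
      obtain ⟨b, hb, hb'⟩ := hy
      exact ⟨a + b, Submodule.add_mem _ ha hb, by simp only [map_add, ha', hb']⟩
    | tmul b x =>
      refine ⟨b • M.presheaf.map (homOfLE h).op x, Submodule.smul_mem _ _
        (Submodule.subset_span ⟨x, rfl⟩), ?_⟩
      rw [valEquiv_tmul, (toVal hV Γ(X, V) M).map_smul]
      refine (res_specOverRestrict_smul hU hV h _ _ F b _).trans ?_
      exact congrArg (HSMul.hSMul b) (res_specOverRestrict_toVal hU hV h (RingHom.id Γ(X, V)) _ M x)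
  obtain ⟨x, hx⟩ := hσ.2 (toVal hV Γ(X, V) M y)
  obtain ⟨t, rfl⟩ := (valEquiv hU Γ(X, V) M).surjective x
  obtain ⟨z, hz, hzt⟩ := key t
  have h1 : toVal hV Γ(X, V) M y = toVal hV Γ(X, V) M z := hx.symm.trans hzt
  rw [← he, ← he] at h1
  have h2 := congrArg (TensorProduct.lid Γ(X, V) Γ(M, V)) (e.injective h1)
  rw [TensorProduct.lid_tmul, TensorProduct.lid_tmul, one_smul, one_smul] at h2
  rwa [h2]

lemma modules_eq_of_affine (P : X.Modules) {W : X.Opens} {x y : Γ(P, W)}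
    (h : ∀ (U : X.Opens) (_ : IsAffineOpen U) (hU : U ≤ W),
      P.presheaf.map (homOfLE hU).op x = P.presheaf.map (homOfLE hU).op y) : x = y := by
  refine TopCat.Sheaf.eq_of_locally_eq' (C := Ab.{u}) ⟨P.presheaf, P.isSheaf⟩
    (fun U : {U : X.affineOpens // U.1 ≤ W} => U.1.1) W (fun U => homOfLE U.2) ?_ x y
    fun U => h U.1.1 U.1.2 U.2
  intro w hw
  obtain ⟨U, hU, hwU, hUW⟩ := X.isBasis_affineOpens.exists_subset_of_mem_open hw W.isOpen
  obtain ⟨U, hU, rfl⟩ := hU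
  exact TopologicalSpace.Opens.mem_iSup.2 ⟨⟨⟨U, hU⟩, hUW⟩, hwU⟩

lemma hom_ext_of_affine {M P : X.Modules} {φ ψ : M ⟶ P}
    (h : ∀ U, IsAffineOpen U → ∀ x, φ.app U x = ψ.app U x) : φ = ψ := by
  ext W x
  refine modules_eq_of_affine P fun U hU hUW => ?_
  rw [← app_map, ← app_map, h U hU]

-- Sections of `P` on an affine `W` are detected on `W ⊓ U`, where the sections of `M` are spanned
-- by restrictions of sections on `U`.
include hU in
lemma ExtendsFrom.hom_eq_zero [X.IsSeparated] {M P : X.Modules} [M.IsQuasicoherent]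
    (hP : ExtendsFrom P U) (φ : M ⟶ P) (h : ∀ x, φ.app U x = 0) : φ = 0 := by
  refine hom_ext_of_affine fun W hW x => (hP W hW).1 ?_
  have h1 : P.presheaf.map (homOfLE (inf_le_left : W ⊓ U ≤ W)).op
    ((0 : M ⟶ P).app W x) = 0 := map_zero _
  rw [h1, ← app_map]
  have h2 := mem_span_range_map hU (isAffineOpen_inf hW hU) inf_le_right M
    (M.presheaf.map (homOfLE inf_le_left).op x)
  refine (Submodule.span_le (p := LinearMap.ker (appₗ (W ⊓ U) φ))).2 ?_ h2
  rintro _ ⟨z, rfl⟩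
  change φ.app _ _ = 0
  rw [app_map, h, map_zero]

end Generation

end

/-! ### Coherent submodules of quasi-coherent modules -/

section

section CoherentSubmodule

variable {X : Scheme.{u}}

/-- On `W ⊓ V` each of the finitely many generators of `G` is a combination of restrictions of
finitely many sections on `V`; all these sections together generate `H`. -/
lemma exists_fg_restrict_mem_span [X.IsSeparated] (P : X.Modules) [P.IsQuasicoherent]
    {V W : X.Opens} (hV : IsAffineOpen V) (hW : IsAffineOpen W)
    (G : Submodule Γ(X, W) Γ(P, W)) (hG : G.FG) :
    ∃ H : Submodule Γ(X, V) Γ(P, V), H.FG ∧ ∀ x ∈ G,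
      P.presheaf.map (homOfLE (inf_le_left : W ⊓ V ≤ W)).op x ∈
        Submodule.span Γ(X, W ⊓ V)
          (P.presheaf.map (homOfLE (inf_le_right : W ⊓ V ≤ V)).op '' (H : Set Γ(P, V))) := by
  obtain ⟨S, rfl⟩ := hG
  have h (s : Γ(P, W)) : ∃ T : Finset Γ(P, V),
      P.presheaf.map (homOfLE (inf_le_left : W ⊓ V ≤ W)).op s ∈
        Submodule.span Γ(X, W ⊓ V)
          (P.presheaf.map (homOfLE (inf_le_right : W ⊓ V ≤ V)).op '' (T : Set Γ(P, V))) := by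
    classical
    obtain ⟨T, hT, hs⟩ := Submodule.mem_span_finite_of_mem_span
      (mem_span_range_map hV (isAffineOpen_inf hW hV) inf_le_right P
        (P.presheaf.map (homOfLE (inf_le_left : W ⊓ V ≤ W)).op s))
    rw [← Set.image_univ] at hT
    obtain ⟨T', -, rfl⟩ := Finset.subset_set_image_iff.1 hT
    rw [Finset.coe_image] at hs
    exact ⟨T', hs⟩
  choose T hT using h
  refine ⟨Submodule.span _ (⋃ s ∈ S, (T s : Set Γ(P, V))), ?_, fun x hx => ?_⟩
  · exact Submodule.fg_span (S.finite_toSet.biUnion fun s _ => (T s).finite_toSet)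
  · induction hx using Submodule.span_induction with
    | mem s hs =>
      refine Submodule.span_mono (Set.image_mono ?_) (hT s)
      exact fun t ht => Submodule.subset_span (Set.mem_biUnion hs ht)
    | zero => rw [map_zero]; exact Submodule.zero_mem _
    | add x y _ _ hx hy => rw [map_add]; exact Submodule.add_mem _ hx hy
    | smul a x _ hx => rw [Scheme.Modules.map_smul]; exact Submodule.smul_mem _ _ hx

/-- Coherent submodules of a quasi-coherent module that contain given finitely generated modules of
sections. -/
theorem exists_coherent_submodule [AlgebraicGeometry.IsNoetherian X] [X.IsSeparated]
    (P : X.Modules) [P.IsQuasicoherent] {κ σ : Type} [Finite κ] [Finite σ]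
    {V : κ → X.Opens} (hV : ∀ k, IsAffineOpen (V k)) (hcov : iSup V = ⊤)
    {W : σ → X.Opens} (hW : ∀ j, IsAffineOpen (W j))
    (G : ∀ j, Submodule Γ(X, W j) Γ(P, W j)) (hG : ∀ j, (G j).FG) :
    ∃ (N : X.Modules) (i : N ⟶ P), IsCoherentModule N ∧ Mono i ∧
      (∀ j, G j ≤ LinearMap.range (appₗ (W j) i)) ∧
      ∀ (M : X.Modules) [M.IsQuasicoherent] (ψ : M ⟶ P),
        (∀ k, LinearMap.range (appₗ (V k) ψ) ≤ LinearMap.range (appₗ (V k) i)) →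
        ∃ ψ' : M ⟶ N, ψ' ≫ i = ψ := by
  choose H₀ hH₀ hGH using fun k j => exists_fg_restrict_mem_span P (hV k) (hW j) (G j) (hG j)
  -- `H k` is finitely generated and spans on `W j ⊓ V k` a module containing the restriction of
  -- each `G j`. The coherent submodule is the largest one whose sections on `V k` lie in `H k` for
  -- all `k`; they need not fill `H k`.
  let H (k : κ) : Submodule Γ(X, V k) Γ(P, V k) := ⨆ j, H₀ k j
  have hH (k) : (H k).FG := Submodule.fg_iSup _ (hH₀ k)
  choose ψ hψ using fun k => exists_hom_extendModule (hV k) (Γ(P, V k) ⧸ H k) P (H k).mkQ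
  have hψH (k) (x : Γ(P, V k)) : (ψ k).app (V k) x = 0 ↔ x ∈ H k := by
    rw [hψ, LinearEquiv.map_eq_zero_iff, Submodule.mkQ_apply, Submodule.Quotient.mk_eq_zero]
  have ext (k) := extendsFrom_extendModule (hV k) (Γ(P, V k) ⧸ H k)
  let Q : κ → X.Modules := fun k => extendModule (hV k) (Γ(P, V k) ⧸ H k)
  -- The conditions become the vanishing of maps to the direct images of `Γ(P, V k) ⧸ H k`, which
  -- makes the submodule quasi-coherent as a kernel.
  let Ψ : P ⟶ ⨁ Q := biproduct.lift ψ
  have hΨ {W : X.Opens} (x : Γ(P, W)) : Ψ.app W x = 0 ↔ ∀ k, (ψ k).app W x = 0 := by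
    refine ⟨fun h k => ?_, fun h => biproduct_app_ext Q fun k => ?_⟩
    · rw [← biproduct_lift_π_app Q ψ k W x]
      exact (congrArg _ h).trans (map_zero _)
    · exact (biproduct_lift_π_app Q ψ k W x).trans ((h k).trans (map_zero _).symm)
  have hQ (k) : (Q k).IsQuasicoherent :=
    inferInstanceAs (extendModule (hV k) (Γ(P, V k) ⧸ H k)).IsQuasicoherent
  refine ⟨kernel Ψ, kernel.ι Ψ, isCoherentModule_of_finite hV hcov fun k => ?_, inferInstance,
    fun j x hx => ?_, fun M _ φ hφ => ?_⟩
  · have := IsLocallyNoetherian.component_noetherian (X := X) ⟨V k, hV k⟩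
    have := isNoetherian_of_fg_of_noetherian (H k) (hH k)
    have hmem (y : Γ(kernel Ψ, V k)) : (kernel.ι Ψ).app (V k) y ∈ H k := by
      rw [← hψH]
      exact (hΨ _).1 (kernel_app_apply Ψ (V k) y) k
    exact Module.Finite.of_injective ((appₗ (V k) (kernel.ι Ψ)).codRestrict (H k) hmem)
      fun x y h => app_injective_of_mono (kernel.ι Ψ) (V k) (congrArg Subtype.val h)
  · refine exists_kernel_ι_app_eq Ψ (W j) x ((hΨ x).2 fun k => ?_)
    -- The target of `ψ k` is a direct image from `V k`, so vanishing on `W j` can be checked on `W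
    -- j ⊓ V k`, where `x` lies in the span of `H k`.
    refine (ext k (W j) (hW j)).1 ((app_map (ψ k) _ x).symm.trans (Eq.trans ?_ (map_zero _).symm))
    refine (Submodule.span_le (p := LinearMap.ker (appₗ (W j ⊓ V k) (ψ k)))).2 ?_ (hGH k j x hx)
    rintro _ ⟨z, hz, rfl⟩
    change (ψ k).app _ _ = 0
    rw [app_map, (hψH k z).2 (le_iSup (H₀ k) j hz), map_zero]
  · have h0 : φ ≫ Ψ = 0 := by
      refine biproduct.hom_ext _ _ fun k => ?_
      rw [Category.assoc, biproduct.lift_π, zero_comp]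
      refine (ext k).hom_eq_zero (hV k) _ fun x => ?_
      obtain ⟨n, hn⟩ := hφ k ⟨x, rfl⟩
      have h1 : (ψ k).app (V k) ((kernel.ι Ψ).app (V k) n) = 0 :=
        (hΨ _).1 (kernel_app_apply Ψ (V k) n) k
      exact (congrArg _ hn).symm.trans h1
    exact ⟨kernel.lift Ψ φ h0, kernel.lift_ι _ _ _⟩

end CoherentSubmodule

end

/-! ### Direct image of the restriction to an affine open, and extension of homomorphisms -/

section

section OpenExtension

lemma exists_hom_Spec {R : CommRingCat.{u}} (N N' : (Spec R).Modules) [N.IsQuasicoherent]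
    (α : moduleSpecΓFunctor.obj N ⟶ moduleSpecΓFunctor.obj N') :
    ∃ ψ : N ⟶ N', ∀ t : moduleSpecΓFunctor.obj N,
      ψ.app ⊤ t = (show moduleSpecΓFunctor.obj N' from α.hom t) := by
  obtain ⟨ψ, hψ⟩ := exists_hom_tilde N _ α
  refine ⟨ψ ≫ N'.fromTildeΓ, fun t => ?_⟩
  exact (congrArg (N'.fromTildeΓ.app ⊤) (hψ t)).trans (fromTildeΓ_app_toOpen N' _)

variable {X : Scheme.{u}} {U V : X.Opens} (hU : IsAffineOpen U) (hV : IsAffineOpen V)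

/-- The direct image of the restriction of modules to an affine open subset. -/
def openExtension : X.Modules ⥤ X.Modules :=
  Scheme.Modules.restrictFunctor hU.fromSpec ⋙ Scheme.Modules.pushforward hU.fromSpec

/-- The canonical map to the direct image of the restriction. -/
def toOpenExtension : 𝟭 X.Modules ⟶ openExtension hU :=
  (Scheme.Modules.restrictAdjunction hU.fromSpec).unit

instance [X.IsSeparated] (P : X.Modules) [P.IsQuasicoherent] :
    ((openExtension hU).obj P).IsQuasicoherent :=
  have : (P.restrict hU.fromSpec).IsQuasicoherent :=
    Scheme.Modules.isQuasicoherent_restrictFunctor hU.fromSpec P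
  isQuasicoherent_pushforward hU.fromSpec (P.restrict hU.fromSpec)

lemma extendsFrom_openExtension (P : X.Modules) : ExtendsFrom ((openExtension hU).obj P) U :=
  fun W _ => map_bijective_of_eq (P.restrict hU.fromSpec)
    (hU.fromSpec.preimage_mono (inf_le_left : W ⊓ U ≤ W))
    (fun x hx => ⟨hx, by
      have : hU.fromSpec x ∈ Set.range hU.fromSpec := ⟨x, rfl⟩
      rwa [hU.range_fromSpec] at this⟩)

lemma toOpenExtension_app_bijective (P : X.Modules) (h : V ≤ U) :
    Function.Bijective (((toOpenExtension hU).app P).app V) :=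
  map_bijective_of_eq P (hU.fromSpec.image_preimage_le V) (fun x hx => by
    have : x ∈ Set.range hU.fromSpec := by
      rw [hU.range_fromSpec]
      exact h hx
    obtain ⟨y, rfl⟩ := this
    exact ⟨y, hx, rfl⟩)

lemma toOpenExtension_naturality {P Q : X.Modules} (φ : P ⟶ Q) :
    φ ≫ (toOpenExtension hU).app Q = (toOpenExtension hU).app P ≫ (openExtension hU).map φ :=
  (toOpenExtension hU).naturality φ

lemma exists_hom_openExtension (P T : X.Modules) [P.IsQuasicoherent]
    (α : Γ(P, U) →ₗ[Γ(X, U)] Γ(T, U)) :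
    ∃ ψ : P ⟶ (openExtension hU).obj T,
      ∀ x, ψ.app U x = ((toOpenExtension hU).app T).app U (α x) := by
  have hP : (P.restrict hU.fromSpec).IsQuasicoherent :=
    Scheme.Modules.isQuasicoherent_restrictFunctor hU.fromSpec P
  let e := LinearEquiv.ofBijective (sectionsToSpec hU P) (sectionsToSpec_bijective hU P)
  obtain ⟨ψ', hψ'⟩ := exists_hom_Spec (R := Γ(X, U)) (P.restrict hU.fromSpec)
    (T.restrict hU.fromSpec)
    (ModuleCat.ofHom (R := Γ(X, U)) (X := (moduleSpecΓFunctor (R := Γ(X, U))).obj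
      (P.restrict hU.fromSpec)) (Y := (moduleSpecΓFunctor (R := Γ(X, U))).obj
      (T.restrict hU.fromSpec)) (sectionsToSpec hU T ∘ₗ α ∘ₗ e.symm.toLinearMap))
  refine ⟨(toOpenExtension hU).app P ≫ (Scheme.Modules.pushforward hU.fromSpec).map ψ',
    fun x => ?_⟩
  refine (restrictAdjunction_unit_comp_app hU.fromSpec ψ' U x).trans ?_
  have h1 := app_map ψ' (homOfLE (le_top : hU.fromSpec ⁻¹ᵁ U ≤ ⊤)) (sectionsToSpec hU P x)
  have h2 : (P.restrict hU.fromSpec).presheaf.map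
      (homOfLE (le_top : hU.fromSpec ⁻¹ᵁ U ≤ ⊤)).op (sectionsToSpec hU P x) =
    P.presheaf.map (homOfLE (hU.fromSpec.image_preimage_le U)).op x := map_map P _ _ x
  have h3 : (T.restrict hU.fromSpec).presheaf.map
      (homOfLE (le_top : hU.fromSpec ⁻¹ᵁ U ≤ ⊤)).op (sectionsToSpec hU T (α x)) =
    T.presheaf.map (homOfLE (hU.fromSpec.image_preimage_le U)).op (α x) := map_map T _ _ (α x)
  refine (congrArg (ψ'.app _) h2).symm.trans (h1.trans (Eq.trans ?_ h3))
  refine congrArg _ ((hψ' _).trans ?_)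
  exact congrArg (fun y => sectionsToSpec hU T (α y)) (e.symm_apply_apply x)

include hU in
/-- Two homomorphisms to a direct image from `U` agree if they agree on `U`. -/
lemma ExtendsFrom.hom_ext [X.IsSeparated] {M P : X.Modules} [M.IsQuasicoherent]
    (hP : ExtendsFrom P U) {φ ψ : M ⟶ P} (h : ∀ x, φ.app U x = ψ.app U x) : φ = ψ := by
  rw [← sub_eq_zero]
  exact hP.hom_eq_zero hU _ fun x => sub_eq_zero.2 (h x)

/-- Extension of homomorphisms to direct images along homomorphisms which are isomorphisms on
`U`. -/
lemma exists_extension_openExtension [X.IsSeparated] {A B T : X.Modules} [A.IsQuasicoherent]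
    [B.IsQuasicoherent] (g : A ⟶ B) (hg : Function.Bijective (g.app U))
    (f : A ⟶ (openExtension hU).obj T) :
    ∃ f' : B ⟶ (openExtension hU).obj T, g ≫ f' = f := by
  let e := LinearEquiv.ofBijective (appₗ U g) hg
  let c := LinearEquiv.ofBijective (appₗ U ((toOpenExtension hU).app T))
    (toOpenExtension_app_bijective hU T le_rfl)
  obtain ⟨f', hf'⟩ := exists_hom_openExtension hU B T
    (c.symm.toLinearMap ∘ₗ appₗ U f ∘ₗ e.symm.toLinearMap)
  refine ⟨f', (extendsFrom_openExtension hU T).hom_ext hU fun x => ?_⟩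
  refine (hf' _).trans ((c.apply_symm_apply _).trans ?_)
  exact congrArg (f.app U) (e.symm_apply_apply x)

lemma openExtension_hom_ext [X.IsSeparated] {A B T : X.Modules} [A.IsQuasicoherent]
    [B.IsQuasicoherent] (g : A ⟶ B) (hg : Function.Bijective (g.app U))
    {f f' : B ⟶ (openExtension hU).obj T} (h : g ≫ f = g ≫ f') : f = f' := by
  refine (extendsFrom_openExtension hU T).hom_ext hU fun x => ?_
  obtain ⟨x, rfl⟩ := hg.2 x
  exact congr(Scheme.Modules.Hom.app $h U x)


end OpenExtension

/-! ### Morphisms out of a functor that is a kernel over an affine open -/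

section KernelOn

open ModuleFunctor TensorProduct

variable {X : Scheme.{u}} {U : X.Opens} (hU : IsAffineOpen U)

instance : (underline X).Additive where
  map_add {M N φ ψ} := by
    refine hom_ext fun Y x => ?_
    have h := (Scheme.Modules.pullback Y.hom).map_add (f := φ) (g := ψ)
    exact congr(Scheme.Modules.Hom.app $h ⊤ x)

include hU in
/-- Two morphisms to the functor of a direct image from `U` agree if they agree on schemes
over `U`. -/
lemma ExtendsFrom.underline_hom_ext [X.IsSeparated] {P : X.Modules} [P.IsQuasicoherent]
    (hP : ExtendsFrom P U) {F : ModuleFunctor X} {s t : F ⟶ (underline X).obj P}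
    (h : ∀ (B : Type u) [CommRing B] [Algebra Γ(X, U) B] (x : F.val hU B),
      valEv hU s B x = valEv hU t B x) : s = t := by
  refine ModuleFunctor.hom_ext fun Y x => ?_
  rw [← sub_eq_zero]
  refine hP.eq_zero hU _ fun Z g hZ => ?_
  rw [map_sub, ← ev_res, ← ev_res, sub_eq_zero]
  refine (underline_isLocal P).eq_of_locally_eq fun z => ?_
  obtain ⟨B, _, _, a, ha, hz⟩ := exists_specOver hU Z z (hZ z)
  refine ⟨_, a, ha, hz, ?_⟩
  rw [← ev_res, ← ev_res]
  exact h B _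

/-- `ι` identifies `F` with the kernel of `φ` on all schemes over `U`. -/
def IsKernelOn {F : ModuleFunctor X} {P R : X.Modules} (ι : F ⟶ (underline X).obj P) (φ : P ⟶ R)
    (U : X.Opens) : Prop :=
  ∀ Y : Over X, (∀ y, Y.hom y ∈ U) → Function.Injective (ev ι Y) ∧
    ∀ x, ev ((underline X).map φ) Y x = 0 ↔ ∃ s, ev ι Y s = x

lemma lTensor_eq_zero_iff {P R : X.Modules} [P.IsQuasicoherent] [R.IsQuasicoherent] (φ : P ⟶ R)
    {B : Type u} [CommRing B] [Algebra Γ(X, U) B] (y : B ⊗[Γ(X, U)] Γ(P, U)) :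
    LinearMap.lTensor B (appₗ U φ) y = 0 ↔
      ev ((underline X).map φ) (specOver hU B) (valEquiv hU B P y) = 0 := by
  rw [← LinearEquiv.map_eq_zero_iff (valEquiv hU B R), ← valEv_valEquiv]
  rfl

include hU in
/-- A homomorphism vanishing on the kernel of `φ`, for all schemes over `U`, factors through `φ`
on sections over `U`. -/
lemma exists_comp_appₗ_eq [AlgebraicGeometry.IsNoetherian X] {P R T : X.Modules}
    [P.IsQuasicoherent] [R.IsQuasicoherent] [T.IsQuasicoherent] (φ : P ⟶ R) (ψ : P ⟶ T)
    (hP : Module.Finite Γ(X, U) Γ(P, U)) (hR : Module.Finite Γ(X, U) Γ(R, U))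
    (h : ∀ (B : Type u) [CommRing B] [Algebra Γ(X, U) B]
      (x : ((underline X).obj P).Sec (specOver hU B)),
      ev ((underline X).map φ) (specOver hU B) x = 0 →
      ev ((underline X).map ψ) (specOver hU B) x = 0) :
    ∃ θ : Γ(R, U) →ₗ[Γ(X, U)] Γ(T, U), θ ∘ₗ appₗ U φ = appₗ U ψ := by
  have := IsLocallyNoetherian.component_noetherian (X := X) ⟨U, hU⟩
  refine exists_comp_eq_of_ker_lTensor_algebra_le (appₗ U φ) (appₗ U ψ) fun B _ _ y hy => ?_
  rw [lTensor_eq_zero_iff hU] at hy ⊢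
  exact h B _ hy

-- A factorization on sections over `U` persists after tensoring with any algebra, and every scheme
-- over `U` is locally the spectrum of one. Together with `exists_comp_appₗ_eq` this makes vanishing
-- on the kernel equivalent to factoring.
include hU in
lemma ev_eq_zero_of_comp_appₗ_eq {P R T : X.Modules}
    [P.IsQuasicoherent] [R.IsQuasicoherent] [T.IsQuasicoherent] (φ : P ⟶ R) (ψ : P ⟶ T)
    (θ : Γ(R, U) →ₗ[Γ(X, U)] Γ(T, U)) (h : θ ∘ₗ appₗ U φ = appₗ U ψ) {Y : Over X}
    (hY : ∀ y, Y.hom y ∈ U) (x : ((underline X).obj P).Sec Y)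
    (hx : ev ((underline X).map φ) Y x = 0) : ev ((underline X).map ψ) Y x = 0 := by
  refine (underline_isLocal T).eq_of_locally_eq fun y => ?_
  obtain ⟨B, _, _, a, ha, hy⟩ := exists_specOver hU Y y (hY y)
  refine ⟨_, a, ha, hy, ?_⟩
  rw [map_zero, ← ev_res]
  obtain ⟨z, hz⟩ := (valEquiv hU B P).surjective (((underline X).obj P).res a x)
  have h1 : ev ((underline X).map φ) (specOver hU B) (valEquiv hU B P z) = 0 := by
    refine (congrArg _ hz).trans ?_
    rw [ev_res, hx, map_zero]
  refine (congrArg _ hz).symm.trans ?_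
  rw [← lTensor_eq_zero_iff] at h1 ⊢
  rw [← h, LinearMap.lTensor_comp, LinearMap.comp_apply, h1, map_zero]

/-- A morphism on a kernel is, over an affine open subset, induced by a homomorphism of modules. -/
theorem IsKernelOn.exists_extension [AlgebraicGeometry.IsNoetherian X] [X.IsSeparated]
    {F : ModuleFunctor X} {P R : X.Modules} [P.IsQuasicoherent] [R.IsQuasicoherent]
    {ι : F ⟶ (underline X).obj P} {φ : P ⟶ R} (h : IsKernelOn ι φ U)
    (hP : Module.Finite Γ(X, U) Γ(P, U)) (hR : Module.Finite Γ(X, U) Γ(R, U))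
    (T : X.Modules) [T.IsQuasicoherent] (t : F ⟶ (underline X).obj T) :
    ∃ ψ : P ⟶ (openExtension hU).obj T,
      t ≫ (underline X).map ((toOpenExtension hU).app T) = ι ≫ (underline X).map ψ := by
  classical
  have := IsLocallyNoetherian.component_noetherian (X := X) ⟨U, hU⟩
  have hker (B : Type u) [CommRing B] [Algebra Γ(X, U) B] := h (specOver hU B)
    (specOver_hom_mem hU B)
  have hex (B : Type u) [CommRing B] [Algebra Γ(X, U) B] (y : B ⊗[Γ(X, U)] Γ(P, U))
      (hy : LinearMap.lTensor B (appₗ U φ) y = 0) :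
      ∃ s : F.val hU B, valEv hU ι B s = valEquiv hU B P y :=
    ((hker B).2 _).1 ((lTensor_eq_zero_iff hU φ y).1 hy)
  have huniq (B : Type u) [CommRing B] [Algebra Γ(X, U) B] {s s' : F.val hU B}
      (hs : valEv hU ι B s = valEv hU ι B s') : s = s' := (hker B).1 hs
  -- The algebraic theorem wants a map on all of `B ⊗ Γ(P, U)` but looks only at its values on the
  -- kernel; elsewhere the value `0` is arbitrary.
  let t' (B : Type u) [CommRing B] [Algebra Γ(X, U) B] (y : B ⊗[Γ(X, U)] Γ(P, U)) :
      B ⊗[Γ(X, U)] Γ(T, U) :=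
    if hy : LinearMap.lTensor B (appₗ U φ) y = 0 then
      (valEquiv hU B T).symm (valEv hU t B (hex B y hy).choose) else 0
  have ht' (B : Type u) [CommRing B] [Algebra Γ(X, U) B] (y : B ⊗[Γ(X, U)] Γ(P, U))
      (hy : LinearMap.lTensor B (appₗ U φ) y = 0) (s : F.val hU B)
      (hs : valEv hU ι B s = valEquiv hU B P y) :
      t' B y = (valEquiv hU B T).symm (valEv hU t B s) := by
    have h1 : t' B y = (valEquiv hU B T).symm (valEv hU t B (hex B y hy).choose) := dif_pos hy
    rw [h1, huniq B ((hex B y hy).choose_spec.trans hs.symm)]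
  obtain ⟨α, hα⟩ := exists_lTensor_eq_of_natural_algebra (appₗ U φ) t' (by
    intro B _ _ b y hy
    obtain ⟨s, hs⟩ := hex B y hy
    have hy' : LinearMap.lTensor B (appₗ U φ) (b • y) = 0 := by
      rw [lTensor_smul_algebra, hy, smul_zero]
    rw [ht' B y hy s hs, ht' B (b • y) hy' (b • s) (by rw [map_smul, hs, map_smul]), map_smul,
      map_smul]) (by
    intro B C _ _ _ _ g y hy
    obtain ⟨s, hs⟩ := hex B y hy
    have hy' : LinearMap.lTensor C (appₗ U φ) (LinearMap.rTensor _ g.toLinearMap y) = 0 := by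
      rw [lTensor_rTensor_comm_apply, hy, map_zero]
    rw [ht' B y hy s hs, ht' C _ hy' (F.valMap hU g s) (by
      rw [valEv_valMap, hs, valMap_valEquiv]), valEv_valMap, LinearEquiv.symm_apply_eq,
      ← valMap_valEquiv, LinearEquiv.apply_symm_apply])
  obtain ⟨ψ, hψ⟩ := exists_hom_openExtension hU P T α
  -- The target is a direct image from `U`, so the equality of morphisms on all `X`-schemes follows
  -- from equality at algebras over the ring of `U`.
  refine ⟨ψ, (extendsFrom_openExtension hU T).underline_hom_ext hU fun B _ _ s => ?_⟩
  obtain ⟨y, hy⟩ := (valEquiv hU B P).surjective (valEv hU ι B s)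
  have hy0 : LinearMap.lTensor B (appₗ U φ) y = 0 := by
    rw [lTensor_eq_zero_iff hU]
    exact ((hker B).2 _).2 ⟨s, hy.symm⟩
  have h1 := (ht' B y hy0 s hy.symm).symm.trans (hα B y hy0)
  rw [LinearEquiv.symm_apply_eq] at h1
  have h2 : appₗ U ψ = appₗ U ((toOpenExtension hU).app T) ∘ₗ α := LinearMap.ext hψ
  change valEv hU ((underline X).map _) B (valEv hU t B s) =
    valEv hU ((underline X).map ψ) B (valEv hU ι B s)
  rw [h1, ← hy, valEv_valEquiv, valEv_valEquiv, h2, LinearMap.lTensor_comp, LinearMap.comp_apply]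

end KernelOn

end

/-! ### Finite biproducts and `underline` -/

section

section UnderlineBiproduct

open ModuleFunctor

variable {X : Scheme.{u}}

lemma ev_add {F G : ModuleFunctor X} (s t : F ⟶ G) {Y : Over X} (x : F.Sec Y) :
    ev (s + t) Y x = ev s Y x + ev t Y x := rfl

lemma ev_sub {F G : ModuleFunctor X} (s t : F ⟶ G) {Y : Over X} (x : F.Sec Y) :
    ev (s - t) Y x = ev s Y x - ev t Y x := by
  rw [eq_sub_iff_add_eq, ← ev_add, sub_add_cancel]

lemma ev_zero {F G : ModuleFunctor X} {Y : Over X} (x : F.Sec Y) :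
    ev (0 : F ⟶ G) Y x = 0 := rfl

lemma ev_sum {F G : ModuleFunctor X} {κ : Type*} (s : Finset κ) (t : κ → (F ⟶ G)) {Y : Over X}
    (x : F.Sec Y) : ev (∑ k ∈ s, t k) Y x = ∑ k ∈ s, ev (t k) Y x := by
  classical
  induction s using Finset.induction_on with
  | empty => rfl
  | insert a s ha ih => rw [Finset.sum_insert ha, Finset.sum_insert ha, ← ih]; rfl

lemma ev_map_comp {P Q R : X.Modules} (φ : P ⟶ Q) (ψ : Q ⟶ R) {Y : Over X}
    (x : ((underline X).obj P).Sec Y) :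
    ev ((underline X).map (φ ≫ ψ)) Y x =
      ev ((underline X).map ψ) Y (ev ((underline X).map φ) Y x) := by
  rw [Functor.map_comp]
  rfl

variable {κ : Type} [Finite κ] (M : κ → X.Modules)

lemma ev_biproduct_total [Fintype κ] {Y : Over X} (x : ((underline X).obj (⨁ M)).Sec Y) :
    ∑ k, ev ((underline X).map (biproduct.ι M k)) Y
      (ev ((underline X).map (biproduct.π M k)) Y x) = x := by
  have h : ∑ k, (underline X).map (biproduct.π M k ≫ biproduct.ι M k) = 𝟙 _ := by
    rw [← Functor.map_sum, biproduct.total, CategoryTheory.Functor.map_id]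
  have h2 := congrArg (fun t => ev t Y x) h
  simp only [ev_sum, ev_map_comp] at h2
  exact h2

lemma ev_biproduct_ext {Y : Over X} {x y : ((underline X).obj (⨁ M)).Sec Y}
    (h : ∀ k, ev ((underline X).map (biproduct.π M k)) Y x =
      ev ((underline X).map (biproduct.π M k)) Y y) : x = y := by
  cases nonempty_fintype κ
  rw [← ev_biproduct_total M x, ← ev_biproduct_total M y]
  simp only [h]

lemma ev_biproduct_lift_eq_zero_iff {N : X.Modules} (f : ∀ k, N ⟶ M k) {Y : Over X}
    (x : ((underline X).obj N).Sec Y) :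
    ev ((underline X).map (biproduct.lift f)) Y x = 0 ↔
      ∀ k, ev ((underline X).map (f k)) Y x = 0 := by
  have h (k) : ev ((underline X).map (biproduct.π M k)) Y
      (ev ((underline X).map (biproduct.lift f)) Y x) = ev ((underline X).map (f k)) Y x := by
    rw [← ev_map_comp, biproduct.lift_π]
  refine ⟨fun h0 k => ?_, fun h0 => ev_biproduct_ext M fun k => ?_⟩
  · rw [← h, h0, map_zero]
  · rw [h, h0, map_zero]

end UnderlineBiproduct

/-! ### Replacing locally finite equations by coherent ones -/

section CoherentKernel

open ModuleFunctor

lemma exists_comp_eq_of_range_le {A M N P : Type*} [CommRing A] [AddCommGroup M] [Module A M]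
    [AddCommGroup N] [Module A N] [AddCommGroup P] [Module A P] {i : N →ₗ[A] P}
    (hi : Function.Injective i) (f : M →ₗ[A] P) (h : LinearMap.range f ≤ LinearMap.range i) :
    ∃ g : M →ₗ[A] N, i ∘ₗ g = f := by
  let e := LinearEquiv.ofInjective i hi
  refine ⟨e.symm.toLinearMap ∘ₗ f.codRestrict _ fun x => h ⟨x, rfl⟩, LinearMap.ext fun x => ?_⟩
  exact congrArg Subtype.val (e.apply_symm_apply _)

variable {X : Scheme.{u}} [AlgebraicGeometry.IsNoetherian X] [X.IsSeparated] {κ : Type} [Finite κ]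
  {U : κ → X.Opens} (hU : ∀ l, IsAffineOpen (U l)) (hcov : iSup U = ⊤)

omit [X.IsSeparated] [AlgebraicGeometry.IsNoetherian X] [Finite κ] in
include hU hcov in
lemma eq_of_eq_on_cover {F : ModuleFunctor X} (hF : F.IsLocal) {Y : Over X} {x x' : F.Sec Y}
    (h : ∀ l (B : Type u) [CommRing B] [Algebra Γ(X, U l) B] (a : specOver (hU l) B ⟶ Y),
      F.res a x = F.res a x') : x = x' := by
  refine hF.eq_of_locally_eq fun y => ?_
  obtain ⟨l, hl⟩ := TopologicalSpace.Opens.mem_iSup.1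
    (hcov.ge (TopologicalSpace.Opens.mem_top (Y.hom y)))
  obtain ⟨B, _, _, a, ha, hy⟩ := exists_specOver (hU l) Y y hl
  exact ⟨_, a, ha, hy, h l B a⟩

-- The hypothesis says that over `U l` the equation `ψ l` implies all the others, so there `ψ m`
-- factors through `ψ l` by some `θ l m`. The targets `T m`, finitely generated only over `U m`, are
-- replaced by coherent submodules containing the images of all `θ l m`.
include hU hcov in
lemma exists_coherent_kernel {M : X.Modules} (hM : IsCoherentModule M) (T : κ → X.Modules)
    [∀ l, (T l).IsQuasicoherent] (hT' : ∀ l, Module.Finite Γ(X, U l) Γ(T l, U l))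
    (ψ : ∀ l, M ⟶ T l)
    (h : ∀ l (B : Type u) [CommRing B] [Algebra Γ(X, U l) B]
      (x : ((underline X).obj M).Sec (specOver (hU l) B)),
      ev ((underline X).map (ψ l)) _ x = 0 → ∀ m, ev ((underline X).map (ψ m)) _ x = 0) :
    ∃ (N : X.Modules) (χ : M ⟶ N), IsCoherentModule N ∧
      ∀ (Y : Over X) (x : ((underline X).obj M).Sec Y),
        ev ((underline X).map χ) Y x = 0 ↔ ∀ l, ev ((underline X).map (ψ l)) Y x = 0 := by
  have hMq := hM.1
  choose θ hθ using fun l m => exists_comp_appₗ_eq (hU l) (ψ l) (ψ m) (hM.finite (hU l)) (hT' l)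
    fun B _ _ x hx => h l B x hx m
  have hN (m) := exists_coherent_submodule (T m) hU hcov hU (fun l => LinearMap.range (θ l m))
    (fun l => by rw [LinearMap.range_eq_map]; exact (hT' l).fg_top.map (θ l m))
  choose N i hN hi hθi hfac using hN
  have hNq (m) : (N m).IsQuasicoherent := (hN m).1
  choose χ hχ using fun m => hfac m M (ψ m) fun k => by
    rw [← hθ k m]
    exact (LinearMap.range_comp_le_range _ _).trans (hθi m k)
  refine ⟨⨁ N, biproduct.lift χ, IsCoherentModule.biproduct N hN, fun Y x => ?_⟩
  rw [ev_biproduct_lift_eq_zero_iff]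
  refine ⟨fun h0 m => ?_, fun h0 m => ?_⟩
  · rw [← hχ m, ev_map_comp, h0 m, map_zero]
  -- This direction is not formal, since `N m → T m` may lose injectivity after base change. Over `U
  -- l` the map `θ l m` takes values in `N m`, so `χ m` itself factors through `ψ l`.
  · refine eq_of_eq_on_cover hU hcov (underline_isLocal _) fun l B _ _ a => ?_
    rw [map_zero, ← ev_res]
    obtain ⟨θ', hθ'⟩ := exists_comp_eq_of_range_le (i := appₗ (U l) (i m))
      (app_injective_of_mono (i m) (U l)) (θ l m) (hθi m l)
    refine ev_eq_zero_of_comp_appₗ_eq (hU l) (ψ l) (χ m) θ' ?_ (specOver_hom_mem (hU l) B) _ ?_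
    · refine LinearMap.ext fun z => app_injective_of_mono (i m) (U l) ?_
      have h1 : (i m).app (U l) (θ' ((ψ l).app (U l) z)) = (ψ m).app (U l) z :=
        (LinearMap.congr_fun hθ' _).trans (LinearMap.congr_fun (hθ l m) z)
      exact h1.trans congr(Scheme.Modules.Hom.app $(hχ m) (U l) z).symm
    · rw [ev_res, h0 l, map_zero]

omit [AlgebraicGeometry.IsNoetherian X] [X.IsSeparated] in
lemma finite_sections_biproduct {V : X.Opens} {K : Type} [Finite K] (T : K → X.Modules)
    (h : ∀ k, Module.Finite Γ(X, V) Γ(T k, V)) : Module.Finite Γ(X, V) Γ(⨁ T, V) := by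
  cases nonempty_fintype K
  refine Module.Finite.of_surjective
    (∑ i, (appₗ V (biproduct.ι T i)) ∘ₗ LinearMap.proj (R := Γ(X, V)) (φ := fun i => Γ(T i, V)) i)
    fun x => ⟨fun i => (biproduct.π T i).app V x, ?_⟩
  rw [LinearMap.sum_apply]
  exact biproduct_app_total T V x

end CoherentKernel

end

/-! ### Lifting morphisms to coherent submodules -/

section

section Lift

open ModuleFunctor

variable {X : Scheme.{u}}

lemma IsKernelOn.mono {F : ModuleFunctor X} {P R : X.Modules} {ι : F ⟶ (underline X).obj P}
    {φ : P ⟶ R} {U V : X.Opens} (h : IsKernelOn ι φ U) (hVU : V ≤ U) : IsKernelOn ι φ V :=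
  fun Y hY => h Y fun y => hVU (hY y)

/-- Lifting of a morphism along a morphism that is determined by a jointly injective family. -/
lemma exists_hom_of_jointly_injective {F G : ModuleFunctor X} (hG : G.IsLocal) {κ : Type*}
    {H : κ → ModuleFunctor X} (hH : ∀ l, (H l).IsLocal) (a : ∀ l, G ⟶ H l) (b : ∀ l, F ⟶ H l)
    (ha : ∀ (Y : Over X) (x x' : G.Sec Y), (∀ l, ev (a l) Y x = ev (a l) Y x') → x = x')
    (hex : ∀ (Y : Over X) (s : F.Sec Y) (y : Y.left), ∃ (Z : Over X) (g : Z ⟶ Y),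
      IsOpenImmersion g.left ∧ y ∈ Set.range g.left ∧
        ∃ x, ∀ l, ev (a l) Z x = ev (b l) Z (F.res g s)) :
    ∃ t : F ⟶ G, ∀ l, t ≫ a l = b l := by
  have key (Y : Over X) (s : F.Sec Y) : ∃ x : G.Sec Y, ∀ l, ev (a l) Y x = ev (b l) Y s := by
    refine (hG.exists_of_locally (Y := Y)
      (fun {Z} g x => ∀ l, ev (a l) Z x = ev (b l) Z (F.res g s)) ?_ ?_ (hex Y s)).elim
        fun x hx => ⟨x, fun l => (hH l).eq_of_locally_eq fun y => ?_⟩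
    · intro Z W g h x hx l
      rw [ev_res, hx, ← ev_res, res_comp]
    · intro Z g x x' hx hx'
      exact ha _ _ _ fun l => (hx l).trans (hx' l).symm
    · obtain ⟨Z, g, hg, hy, h⟩ := hx y
      exact ⟨Z, g, hg, hy, by rw [← ev_res, ← ev_res, h l]⟩
  choose f hf using key
  refine ⟨mkHom (fun Y =>
    { toFun := f Y
      map_add' := fun s s' => ha Y _ _ fun l => by simp only [map_add, hf]
      map_smul' := fun r s => ha Y _ _ fun l => by simp only [map_smul, hf, RingHom.id_apply] })
    (fun {Y Z} g s => ha Z _ _ fun l => ?_), fun l => ModuleFunctor.hom_ext fun Y s => hf Y s l⟩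
  exact (hf Z _ l).trans ((ev_res _ _ _).trans ((congrArg _ (hf Y s l)).symm.trans
    (ev_res _ _ _).symm))

instance (T : X.Modules) [h : T.IsQuasicoherent] : ((𝟭 X.Modules).obj T).IsQuasicoherent := h

variable {κ : Type} {U : κ → X.Opens} (hU : ∀ l, IsAffineOpen (U l)) (hcov : iSup U = ⊤)

include hcov in
lemma toOpenExtension_jointly_injective [X.IsSeparated] (T : X.Modules) [T.IsQuasicoherent]
    {Y : Over X} {x x' : ((underline X).obj T).Sec Y}
    (h : ∀ l, ev ((underline X).map ((toOpenExtension (hU l)).app T)) Y x =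
      ev ((underline X).map ((toOpenExtension (hU l)).app T)) Y x') : x = x' := by
  refine eq_of_eq_on_cover hU hcov (underline_isLocal T) fun l B _ _ a => ?_
  refine (ev_underline_map_bijective (hU l) ((toOpenExtension (hU l)).app T)
    (toOpenExtension_app_bijective (hU l) T le_rfl) (specOver_hom_mem (hU l) B)).1 ?_
  refine (ev_res _ _ _).trans ((congrArg _ (h l)).trans (ev_res _ _ _).symm)

/-- The map from `T` to the direct image from `U` is bijective on sections over `V ≤ U`, so maps to
a direct image from `V` extend along it. -/
lemma exists_transition [X.IsSeparated] {U V : X.Opens} (hU : IsAffineOpen U)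
    (hV : IsAffineOpen V) (hVU : V ≤ U) (T : X.Modules) [T.IsQuasicoherent] :
    ∃ ρ : (openExtension hU).obj T ⟶ (openExtension hV).obj T,
      (toOpenExtension hU).app T ≫ ρ = (toOpenExtension hV).app T :=
  exists_extension_openExtension (A := T) (B := (openExtension hU).obj T) hV
    ((toOpenExtension hU).app T)
    (toOpenExtension_app_bijective hU T hVU) _

lemma openExtension_map_app_injective {U : X.Opens} (hU : IsAffineOpen U) {N P : X.Modules}
    (i : N ⟶ P) [Mono i] : Function.Injective (((openExtension hU).map i).app U) := by
  intro x x' h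
  obtain ⟨y, rfl⟩ := (toOpenExtension_app_bijective hU N le_rfl).2 x
  obtain ⟨y', rfl⟩ := (toOpenExtension_app_bijective hU N le_rfl).2 x'
  have h1 (y : Γ(N, U)) : ((openExtension hU).map i).app U (((toOpenExtension hU).app N).app U y) =
      ((toOpenExtension hU).app P).app U (i.app U y) :=
    congr(Scheme.Modules.Hom.app $(toOpenExtension_naturality hU i) U y).symm
  rw [h1, h1] at h
  exact congrArg _ (app_injective_of_mono i U ((toOpenExtension_app_bijective hU P le_rfl).1 h))

/-- Comparison of lifts of a morphism to direct images from two open subsets. -/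
lemma exists_overlap [AlgebraicGeometry.IsNoetherian X] [X.IsSeparated] {F : ModuleFunctor X}
    {U₁ U₂ : X.Opens} (hU₁ : IsAffineOpen U₁) (hU₂ : IsAffineOpen U₂)
    {P₁ R₁ P₂ : X.Modules} [P₁.IsQuasicoherent] [R₁.IsQuasicoherent] [P₂.IsQuasicoherent]
    {ι₁ : F ⟶ (underline X).obj P₁} {φ₁ : P₁ ⟶ R₁} (h₁ : IsKernelOn ι₁ φ₁ U₁)
    (hP₁ : ∀ V, IsAffineOpen V → V ≤ U₁ → Module.Finite Γ(X, V) Γ(P₁, V))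
    (hR₁ : ∀ V, IsAffineOpen V → V ≤ U₁ → Module.Finite Γ(X, V) Γ(R₁, V))
    (ι₂ : F ⟶ (underline X).obj P₂) (P : X.Modules) [P.IsQuasicoherent]
    (t : F ⟶ (underline X).obj P)
    (ψ₁ : P₁ ⟶ (openExtension hU₁).obj P) (ψ₂ : P₂ ⟶ (openExtension hU₂).obj P)
    (hψ₁ : t ≫ (underline X).map ((toOpenExtension hU₁).app P) = ι₁ ≫ (underline X).map ψ₁)
    (hψ₂ : t ≫ (underline X).map ((toOpenExtension hU₂).app P) = ι₂ ≫ (underline X).map ψ₂) :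
    ∃ G : Submodule Γ(X, U₁ ⊓ U₂) Γ(P, U₁ ⊓ U₂), G.FG ∧
      ∀ (N : X.Modules) [N.IsQuasicoherent] (i : N ⟶ P) [Mono i],
        G ≤ LinearMap.range (appₗ (U₁ ⊓ U₂) i) →
      ∀ (ψ₁' : P₁ ⟶ (openExtension hU₁).obj N) (ψ₂' : P₂ ⟶ (openExtension hU₂).obj N),
        ψ₁' ≫ (openExtension hU₁).map i = ψ₁ → ψ₂' ≫ (openExtension hU₂).map i = ψ₂ →
      ∀ (Z : Over X), (∀ z, Z.hom z ∈ U₁ ⊓ U₂) → ∀ (s : F.Sec Z) (u : ((underline X).obj N).Sec Z),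
        ev ((underline X).map ((toOpenExtension hU₁).app N)) Z u =
          ev (ι₁ ≫ (underline X).map ψ₁') Z s →
        ev ((underline X).map ((toOpenExtension hU₂).app N)) Z u =
          ev (ι₂ ≫ (underline X).map ψ₂') Z s := by
  have hV := isAffineOpen_inf hU₁ hU₂
  set V := U₁ ⊓ U₂
  have hV₁ : V ≤ U₁ := inf_le_left
  have hV₂ : V ≤ U₂ := inf_le_right
  -- Over the overlap `V`, the functor `F` is a kernel inside `P₁`, so `ι₂` is induced by a
  -- homomorphism `γ` on `P₁`. This puts both lifts on the same module.
  obtain ⟨γ, hγ⟩ := (h₁.mono hV₁).exists_extension hV (hP₁ V hV hV₁) (hR₁ V hV hV₁) P₂ ι₂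
  obtain ⟨ρ₁, hρ₁⟩ := exists_transition hU₁ hV hV₁ P
  obtain ⟨ρ₂, hρ₂⟩ := exists_transition hU₂ hV hV₂ P
  obtain ⟨χ, hχ⟩ := exists_extension_openExtension hV ((toOpenExtension hV).app P₂)
    (toOpenExtension_app_bijective hV P₂ le_rfl) (ψ₂ ≫ ρ₂)
  -- Both sides are `t` followed by passage to the direct image from `V`.
  have hD : ι₁ ≫ (underline X).map (ψ₁ ≫ ρ₁) = ι₁ ≫ (underline X).map (γ ≫ χ) := by
    have e1 : ι₁ ≫ (underline X).map (ψ₁ ≫ ρ₁) =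
        t ≫ (underline X).map ((toOpenExtension hV).app P) := by
      rw [← hρ₁, Functor.map_comp, Functor.map_comp, reassoc_of% hψ₁]
    have e2 : ι₁ ≫ (underline X).map (γ ≫ χ) =
        t ≫ (underline X).map ((toOpenExtension hV).app P) := by
      rw [← hρ₂, Functor.map_comp, Functor.map_comp, reassoc_of% hψ₂, ← reassoc_of% hγ,
        ← Functor.map_comp, ← Functor.map_comp, hχ]
    rw [e1, e2]
  -- The two lifts need not agree on `P₁`, but their difference vanishes on the kernel of `φ₁` and
  -- so factors through `R₁`. The range of the factorization, read in `Γ(P, V)`, is the module `G`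
  -- that a submodule of `P` must contain.
  obtain ⟨θ, hθ⟩ := exists_comp_appₗ_eq hV φ₁ (ψ₁ ≫ ρ₁ - γ ≫ χ) (hP₁ V hV hV₁) (hR₁ V hV hV₁)
    (fun B _ _ x hx => by
      obtain ⟨s, rfl⟩ := ((h₁.mono hV₁ _ (specOver_hom_mem hV B)).2 x).1 hx
      rw [Functor.map_sub, ev_sub, sub_eq_zero]
      exact congrArg (fun t => ev t _ s) hD)
  let c := LinearEquiv.ofBijective (appₗ V ((toOpenExtension hV).app P))
    (toOpenExtension_app_bijective hV P le_rfl)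
  have hfin := hR₁ V hV hV₁
  refine ⟨LinearMap.range (c.symm.toLinearMap ∘ₗ θ), ?_, ?_⟩
  · rw [LinearMap.range_eq_map]
    exact hfin.fg_top.map _
  intro N _ i _ hG ψ₁' ψ₂' hψ₁' hψ₂' Z hZ s u hu
  obtain ⟨σ₁, hσ₁⟩ := exists_transition hU₁ hV hV₁ N
  obtain ⟨σ₂, hσ₂⟩ := exists_transition hU₂ hV hV₂ N
  obtain ⟨χ', hχ'⟩ := exists_extension_openExtension hV ((toOpenExtension hV).app P₂)
    (toOpenExtension_app_bijective hV P₂ le_rfl) (ψ₂' ≫ σ₂)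
  have hσρ {U : X.Opens} (hU : IsAffineOpen U) (hVU : V ≤ U)
      (σ : (openExtension hU).obj N ⟶ (openExtension hV).obj N)
      (ρ : (openExtension hU).obj P ⟶ (openExtension hV).obj P)
      (hσ : (toOpenExtension hU).app N ≫ σ = (toOpenExtension hV).app N)
      (hρ : (toOpenExtension hU).app P ≫ ρ = (toOpenExtension hV).app P) :
      σ ≫ (openExtension hV).map i = (openExtension hU).map i ≫ ρ := by
    refine openExtension_hom_ext (A := N) (B := (openExtension hU).obj N) hV
      ((toOpenExtension hU).app N) (toOpenExtension_app_bijective hU N hVU) ?_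
    rw [reassoc_of% hσ, ← toOpenExtension_naturality, ← reassoc_of% (toOpenExtension_naturality
      hU i), hρ]
  have hχχ : χ' ≫ (openExtension hV).map i = χ := by
    refine openExtension_hom_ext (A := P₂) (B := (openExtension hV).obj P₂) hV
      ((toOpenExtension hV).app P₂) (toOpenExtension_app_bijective hV P₂ le_rfl) ?_
    rw [reassoc_of% hχ', hσρ hU₂ hV₂ σ₂ ρ₂ hσ₂ hρ₂, reassoc_of% hψ₂', hχ]
  have hDi : (ψ₁' ≫ σ₁ - γ ≫ χ') ≫ (openExtension hV).map i = ψ₁ ≫ ρ₁ - γ ≫ χ := by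
    rw [Preadditive.sub_comp, Category.assoc, Category.assoc, hχχ,
      hσρ hU₁ hV₁ σ₁ ρ₁ hσ₁ hρ₁, reassoc_of% hψ₁']
  obtain ⟨θ', hθ'⟩ := exists_comp_eq_of_range_le (i := appₗ V i) (app_injective_of_mono i V) _ hG
  -- Injectivity of `i` on sections over `V`, which needs no base change, shows that already in `N`
  -- the difference of the lifts factors through `φ₁`. Hence it vanishes on `F` at all schemes over
  -- `V`.
  have hD' : appₗ V ((toOpenExtension hV).app N) ∘ₗ θ' ∘ₗ appₗ V φ₁ =
      appₗ V (ψ₁' ≫ σ₁ - γ ≫ χ') := by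
    refine LinearMap.ext fun x => openExtension_map_app_injective hV i ?_
    have h1 : ((openExtension hV).map i).app V
        (((toOpenExtension hV).app N).app V (θ' (φ₁.app V x))) =
        ((toOpenExtension hV).app P).app V (i.app V (θ' (φ₁.app V x))) :=
      congr(Scheme.Modules.Hom.app $(toOpenExtension_naturality hV i) V _).symm
    have h2 : i.app V (θ' (φ₁.app V x)) = c.symm (θ (φ₁.app V x)) := LinearMap.congr_fun hθ' _
    refine h1.trans ((congrArg _ h2).trans ((c.apply_symm_apply _).trans ?_))
    refine (LinearMap.congr_fun hθ x).trans ?_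
    exact congr(Scheme.Modules.Hom.app $hDi V x).symm
  have h3 := ev_eq_zero_of_comp_appₗ_eq hV φ₁ (ψ₁' ≫ σ₁ - γ ≫ χ')
    (appₗ V ((toOpenExtension hV).app N) ∘ₗ θ') hD' hZ (ev ι₁ Z s)
    (((h₁.mono hV₁ Z hZ).2 _).2 ⟨s, rfl⟩)
  rw [Functor.map_sub, ev_sub, sub_eq_zero, ev_map_comp, ev_map_comp] at h3
  -- Bijectivity of `σ₂` on `V` allows the comparison to be made in the direct image from `V`.
  have hbij : Function.Bijective (σ₂.app V) := by
    have h4 := toOpenExtension_app_bijective hV N le_rfl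
    rw [← hσ₂] at h4
    exact (Function.Bijective.of_comp_iff (σ₂.app V)
      (toOpenExtension_app_bijective hU₂ N hV₂)).1 h4
  refine (ev_underline_map_bijective hV σ₂ hbij hZ).1 ?_
  have e1 (u : ((underline X).obj N).Sec Z) : ev ((underline X).map σ₂) Z
      (ev ((underline X).map ((toOpenExtension hU₂).app N)) Z u) =
      ev ((underline X).map σ₁) Z
      (ev ((underline X).map ((toOpenExtension hU₁).app N)) Z u) := by
    have e := hσ₂.trans hσ₁.symm
    exact (ev_map_comp _ _ u).symm.trans ((congrArg (fun f => ev ((underline X).map f) Z u) e).trans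
      (ev_map_comp _ _ u))
  refine (e1 u).trans ((congrArg _ hu).trans (h3.trans ?_))
  have e2 : ev ((underline X).map γ) Z (ev ι₁ Z s) =
      ev ((underline X).map ((toOpenExtension hV).app P₂)) Z (ev ι₂ Z s) :=
    congrArg (fun t => ev t Z s) hγ.symm
  rw [e2]
  exact (ev_map_comp _ _ _).symm.trans ((congrArg (fun f => ev ((underline X).map f) Z _) hχ').trans
    (ev_map_comp _ _ _))

/-- On schemes over `U`, the functor `F` is the kernel of a homomorphism of quasi-coherent
modules whose sections over affine open subsets of `U` are finitely generated. -/
def HasKernelOn (F : ModuleFunctor X) (U : X.Opens) : Prop :=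
  ∃ (P R : X.Modules) (φ : P ⟶ R) (ι : F ⟶ (underline X).obj P), P.IsQuasicoherent ∧
    R.IsQuasicoherent ∧ (∀ V, IsAffineOpen V → V ≤ U → Module.Finite Γ(X, V) Γ(P, V)) ∧
    (∀ V, IsAffineOpen V → V ≤ U → Module.Finite Γ(X, V) Γ(R, V)) ∧ IsKernelOn ι φ U

variable [Finite κ]

include hU hcov in
/-- A morphism from a functor which is locally the kernel of a homomorphism of coherent modules to
the functor of a quasi-coherent module `P` factors through the functor of a coherent submodule
of `P`. -/
theorem exists_coherent_lift [AlgebraicGeometry.IsNoetherian X] [X.IsSeparated]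
    {F : ModuleFunctor X} (hF : ∀ l, HasKernelOn F (U l)) (P : X.Modules) [P.IsQuasicoherent]
    (t : F ⟶ (underline X).obj P) :
    ∃ (N : X.Modules) (i : N ⟶ P) (t' : F ⟶ (underline X).obj N), IsCoherentModule N ∧
      t' ≫ (underline X).map i = t := by
  choose Q R φ ι hQ hR hQf hRf hι using hF
  choose ψ hψ using fun l => (hι l).exists_extension (hU l) (hQf l _ (hU l) le_rfl)
    (hRf l _ (hU l) le_rfl) P t
  choose G hG hGN using fun l m => exists_overlap (hU l) (hU m) (hι l) (hQf l) (hRf l) (ι m) P t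
    (ψ l) (ψ m) (hψ l) (hψ m)
  let c (l) := LinearEquiv.ofBijective (appₗ (U l) ((toOpenExtension (hU l)).app P))
    (toOpenExtension_app_bijective (hU l) P le_rfl)
  let α (l) : Γ(Q l, U l) →ₗ[Γ(X, U l)] Γ(P, U l) := (c l).symm.toLinearMap ∘ₗ appₗ (U l) (ψ l)
  let Gα (l) : Submodule Γ(X, U l) Γ(P, U l) := LinearMap.range (α l)
  -- `N` must contain the images of the local homomorphisms over each `U l`, so that these lift to
  -- `N`, and the modules `G` over each overlap, so that the lifts agree on `F`.
  obtain ⟨N, i, hN, hi, hGi, -⟩ := exists_coherent_submodule P hU hcov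
    (σ := κ ⊕ κ × κ) (W := Sum.elim U fun p => U p.1 ⊓ U p.2)
    (by rintro (l | p); exacts [hU l, isAffineOpen_inf (hU p.1) (hU p.2)])
    (Sum.rec Gα fun p => G p.1 p.2)
    (by
      rintro (l | p)
      · have := hQf l _ (hU l) le_rfl
        change (LinearMap.range (α l)).FG
        rw [LinearMap.range_eq_map]
        exact this.fg_top.map _
      · exact hG p.1 p.2)
  have hNq : N.IsQuasicoherent := hN.1
  choose α' hα' using fun l => exists_comp_eq_of_range_le (i := appₗ (U l) i)
    (app_injective_of_mono i (U l)) (α l) (hGi (Sum.inl l))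
  choose ψ' hψ' using fun l => exists_hom_openExtension (hU l) (Q l) N (α' l)
  have hψi (l) : ψ' l ≫ (openExtension (hU l)).map i = ψ l := by
    refine (extendsFrom_openExtension (hU l) P).hom_ext (hU l) fun x => ?_
    have h1 : ((openExtension (hU l)).map i).app (U l)
        (((toOpenExtension (hU l)).app N).app (U l) (α' l x)) =
        ((toOpenExtension (hU l)).app P).app (U l) (i.app (U l) (α' l x)) :=
      congr(Scheme.Modules.Hom.app $(toOpenExtension_naturality (hU l) i) (U l) _).symm
    have h2 : i.app (U l) (α' l x) = α l x := LinearMap.congr_fun (hα' l) x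
    exact (congrArg _ (hψ' l x)).trans (h1.trans ((congrArg _ h2).trans
      ((c l).apply_symm_apply _)))
  obtain ⟨t', ht'⟩ := exists_hom_of_jointly_injective (F := F) (underline_isLocal N)
    (H := fun l => (underline X).obj ((openExtension (hU l)).obj N))
    (fun l => underline_isLocal _)
    (fun l => (underline X).map ((toOpenExtension (hU l)).app N))
    (fun l => ι l ≫ (underline X).map (ψ' l))
    (fun Y x x' h => toOpenExtension_jointly_injective hU hcov N h) (by
      intro Y s y
      obtain ⟨l, hl⟩ := TopologicalSpace.Opens.mem_iSup.1
        (hcov.ge (TopologicalSpace.Opens.mem_top (Y.hom y)))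
      obtain ⟨B, _, _, a, ha, hy⟩ := exists_specOver (hU l) Y y hl
      obtain ⟨u, hu⟩ := (ev_underline_map_bijective (hU l) ((toOpenExtension (hU l)).app N)
        (toOpenExtension_app_bijective (hU l) N le_rfl) (specOver_hom_mem (hU l) B)).2
        (ev (ι l ≫ (underline X).map (ψ' l)) _ (F.res a s))
      refine ⟨_, a, ha, hy, u, fun m => ?_⟩
      -- The section `u` is constructed from the `l`-th lift. Agreement with the `m`-th lift is an
      -- identity in a direct image from `U m`, so it is enough to check it on schemes over `U l ⊓ U
      -- m`, where `hGN` applies.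
      rw [← sub_eq_zero]
      refine (extendsFrom_openExtension (hU m) N).eq_zero (hU m) _ fun Z g hZ => ?_
      have hZ' (z : Z.left) : Z.hom z ∈ U l ⊓ U m :=
        ⟨by rw [← over_hom_apply g]; exact specOver_hom_mem (hU l) B _, hZ z⟩
      rw [map_sub, sub_eq_zero]
      refine (ev_res _ g u).symm.trans (Eq.trans ?_ (ev_res (ι m ≫ (underline X).map (ψ' m)) g _))
      refine hGN l m N i (hGi (Sum.inr (l, m))) (ψ' l) (ψ' m) (hψi l) (hψi m) Z hZ' _ _ ?_
      exact (ev_res _ g u).trans ((congrArg _ hu).trans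
        (ev_res (ι l ≫ (underline X).map (ψ' l)) g _).symm))
  refine ⟨N, i, t', hN, ModuleFunctor.hom_ext fun Y s =>
    toOpenExtension_jointly_injective hU hcov P fun l => ?_⟩
  have h : (t' ≫ (underline X).map i) ≫ (underline X).map ((toOpenExtension (hU l)).app P) =
      t ≫ (underline X).map ((toOpenExtension (hU l)).app P) := by
    have h1 := toOpenExtension_naturality (hU l) i
    rw [hψ, ← hψi, Category.assoc, ← Functor.map_comp, h1, Functor.map_comp, Functor.map_comp,
      reassoc_of% (ht' l)]
  exact congrArg (fun t => ev t Y s) h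

include hU hcov in
/-- A functor which is locally the kernel of a homomorphism of coherent modules is a subfunctor
of the functor of a coherent module. -/
theorem exists_coherent_embedding [AlgebraicGeometry.IsNoetherian X] [X.IsSeparated]
    {F : ModuleFunctor X} (hF : F.IsLocal) (hFU : ∀ l, HasKernelOn F (U l)) :
    ∃ (M : X.Modules) (ι : F ⟶ (underline X).obj M), IsCoherentModule M ∧
      ∀ Y, Function.Injective (ev ι Y) := by
  have hFU' := hFU
  choose Q R φ ι hQ hR hQf hRf hι using hFU
  -- Each `ι l` is a morphism on all of `X`, injective over `U l`. After factoring it through a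
  -- coherent module, the sum of the factors is injective over every `U l`, hence everywhere since
  -- `F` is local.
  choose N i t hN hti using fun l => exists_coherent_lift hU hcov hFU' (Q l) (ι l)
  cases nonempty_fintype κ
  refine ⟨⨁ N, ∑ l, t l ≫ (underline X).map (biproduct.ι N l), IsCoherentModule.biproduct N hN,
    fun Y s s' h => ?_⟩
  have hπ (l) : (∑ l, t l ≫ (underline X).map (biproduct.ι N l)) ≫
      (underline X).map (biproduct.π N l) = t l := by
    classical
    simp only [Preadditive.sum_comp, Category.assoc, ← Functor.map_comp, biproduct.ι_π]
    rw [Finset.sum_eq_single l]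
    · simp
    · intro m _ hm
      rw [dif_neg hm, Functor.map_zero, comp_zero]
    · simp
  have ht (l) : ev (ι l) Y s = ev (ι l) Y s' := by
    have h1 := congrArg (ev ((underline X).map (biproduct.π N l)) Y) h
    rw [← ev_comp, ← ev_comp, hπ] at h1
    rw [← hti l, ev_comp, ev_comp, h1]
  refine eq_of_eq_on_cover hU hcov hF fun l B _ _ a => ?_
  refine (hι l _ (specOver_hom_mem (hU l) B)).1 ?_
  rw [ev_res, ev_res, ht l]

end Lift

end

/-! ### Sectionwise limits and finite limits of local kernels -/

section

section Limits

open ModuleFunctor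

variable {X : Scheme.{u}} {J : Type} [SmallCategory J]

/-- The sections of the vertex of `c` are the compatible families of sections. -/
def IsSectionwiseLimit {D : J ⥤ ModuleFunctor X} (c : Cone D) : Prop :=
  ∀ (Y : Over X) (x : ∀ j, (D.obj j).Sec Y),
    (∀ ⦃j j' : J⦄ (f : j ⟶ j'), ev (D.map f) Y (x j) = x j') →
      ∃! s : c.pt.Sec Y, ∀ j, ev (c.π.app j) Y s = x j

lemma isSectionwiseLimit_of_isLimit {D : J ⥤ ModuleFunctor X} {c : Cone D} (hc : IsLimit c) :
    IsSectionwiseLimit c := by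
  intro Y x hx
  have h1 := isLimitOfPreserves (PresheafOfModules.evaluation (globalSections X) (op Y)) hc
  have h2 := isLimitOfPreserves (forget (ModuleCat ((globalSections X).obj (op Y)))) h1
  exact (Types.isLimit_iff _).1 ⟨h2⟩ x fun {j j'} f => hx f

lemma ev_π_naturality {D : J ⥤ ModuleFunctor X} (c : Cone D) {j j' : J} (f : j ⟶ j') {Y : Over X}
    (x : c.pt.Sec Y) : ev (D.map f) Y (ev (c.π.app j) Y x) = ev (c.π.app j') Y x :=
  congrArg (fun t => ev t Y x) (c.w f)

lemma IsSectionwiseLimit.ext {D : J ⥤ ModuleFunctor X} {c : Cone D} (hc : IsSectionwiseLimit c)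
    {Y : Over X} {x x' : c.pt.Sec Y} (h : ∀ j, ev (c.π.app j) Y x = ev (c.π.app j) Y x') :
    x = x' :=
  (hc Y (fun j => ev (c.π.app j) Y x') fun _ _ f => ev_π_naturality c f x').unique h fun _ => rfl

lemma IsSectionwiseLimit.nonempty_isLimit {D : J ⥤ ModuleFunctor X} {c : Cone D}
    (hc : IsSectionwiseLimit c) : Nonempty (IsLimit c) := by
  have key (s : Cone D) (Y : Over X) (x : s.pt.Sec Y) :
      ∃ y : c.pt.Sec Y, ∀ j, ev (c.π.app j) Y y = ev (s.π.app j) Y x :=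
    (hc Y (fun j => ev (s.π.app j) Y x) fun _ _ f => ev_π_naturality s f x).exists
  choose l hl using key
  refine ⟨⟨fun s => mkHom (fun Y =>
    { toFun := l s Y
      map_add' := fun x y => hc.ext fun j => by simp only [map_add, hl]
      map_smul' := fun r x => hc.ext fun j => by simp only [map_smul, hl, RingHom.id_apply] })
    (fun {Y Z} g x => hc.ext fun j => (hl s Z _ j).trans ?_), fun s j => ?_, fun s m hm => ?_⟩⟩
  · refine (ev_res _ _ _).trans ((congrArg _ (hl s Y x j)).symm.trans (ev_res _ _ _).symm)
  · exact ModuleFunctor.hom_ext fun Y x => hl s Y x j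
  · refine ModuleFunctor.hom_ext fun Y x => hc.ext fun j => ?_
    exact (congrArg (fun t => ev t Y x) (hm j)).trans (hl s Y x j).symm

lemma IsSectionwiseLimit.isLocal {D : J ⥤ ModuleFunctor X} {c : Cone D}
    (hc : IsSectionwiseLimit c) (hD : ∀ j, (D.obj j).IsLocal) : c.pt.IsLocal := by
  intro Y Z g hg hy s hs
  have hπ (j : J) {V W : Over X} (g : W ⟶ V) (x : c.pt.Sec V) :
      ev (c.π.app j) W (c.pt.res g x) = (D.obj j).res g (ev (c.π.app j) V x) := ev_res _ g x
  have h1 (j : J) := hD j Y Z g hg hy (fun y => ev (c.π.app j) _ (s y)) fun i i' W a b w => by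
    rw [← hπ, ← hπ, hs i i' W a b w]
  choose t ht htu using fun j => (h1 j)
  obtain ⟨x, hx, -⟩ := hc Y t fun j j' f => htu j' _ fun y => by
    rw [← ev_res, ht]
    exact ev_π_naturality c f _
  have hx' (y : Y.left) : c.pt.res (g y) x = s y := hc.ext fun j => by rw [hπ, hx, ht]
  refine ⟨x, hx', fun x' h => hc.ext fun j => ?_⟩
  rw [hx]
  exact htu j _ fun y => by rw [← hπ, h]

lemma ev_map_sub {P Q : X.Modules} (φ ψ : P ⟶ Q) {Y : Over X} (x : ((underline X).obj P).Sec Y) :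
    ev ((underline X).map (φ - ψ)) Y x =
      ev ((underline X).map φ) Y x - ev ((underline X).map ψ) Y x := by
  rw [Functor.map_sub, ev_sub]

/-- A limit of a finite diagram of functors that are, over `U`, kernels of homomorphisms of
coherent modules has the same property. -/
theorem IsSectionwiseLimit.hasKernelOn [FinCategory J] [AlgebraicGeometry.IsNoetherian X]
    [X.IsSeparated] {D : J ⥤ ModuleFunctor X} {c : Cone D} (hc : IsSectionwiseLimit c)
    {U : X.Opens} (hU : IsAffineOpen U) (hD : ∀ j, HasKernelOn (D.obj j) U) :
    HasKernelOn c.pt U := by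
  classical
  choose P R φ ι hP hR hPf hRf hι using hD
  -- Each transition map of the diagram is extended to the ambient modules, at the price of
  -- replacing the target by the direct image of its restriction to `U`.
  choose χ hχ using fun (p : Σ j j' : J, j ⟶ j') => (hι p.1).exists_extension hU
    (hPf p.1 U hU le_rfl) (hRf p.1 U hU le_rfl) (P p.2.1) (D.map p.2.2 ≫ ι p.2.1)
  let T : J ⊕ (Σ j j' : J, j ⟶ j') → X.Modules :=
    Sum.elim R fun p => (openExtension hU).obj (P p.2.1)
  -- The limit is cut out in `⨁ P` by two kinds of equations: each component lies in its kernel, and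
  -- the components are compatible along each arrow.
  let ψ : ∀ k, (⨁ P) ⟶ T k := Sum.rec (fun j => biproduct.π P j ≫ φ j) fun p =>
    biproduct.π P p.1 ≫ χ p - biproduct.π P p.2.1 ≫ (toOpenExtension hU).app (P p.2.1)
  let i : c.pt ⟶ (underline X).obj (⨁ P) :=
    ∑ j, (c.π.app j ≫ ι j) ≫ (underline X).map (biproduct.ι P j)
  have hiπ (j : J) : i ≫ (underline X).map (biproduct.π P j) = c.π.app j ≫ ι j := by
    simp only [i, Preadditive.sum_comp, Category.assoc, ← Functor.map_comp, biproduct.ι_π]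
    rw [Finset.sum_eq_single j]
    · simp
    · intro m _ hm
      rw [dif_neg hm, Functor.map_zero, comp_zero, comp_zero]
    · simp
  have hi (j : J) {Y : Over X} (s : c.pt.Sec Y) :
      ev ((underline X).map (biproduct.π P j)) Y (ev i Y s) = ev (ι j) Y (ev (c.π.app j) Y s) :=
    congrArg (fun t => ev t Y s) (hiπ j)
  have hTq : ∀ k, (T k).IsQuasicoherent := by
    rintro (j | p)
    · exact hR j
    · exact inferInstanceAs (((openExtension hU).obj (P p.2.1)).IsQuasicoherent)
  have hTf (V : X.Opens) (hV : IsAffineOpen V) (hVU : V ≤ U) :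
      ∀ k, Module.Finite Γ(X, V) Γ(T k, V) := by
    rintro (j | p)
    · exact hRf j V hV hVU
    · have : Module.Finite Γ(X, V) Γ((𝟭 X.Modules).obj (P p.2.1), V) := hPf p.2.1 V hV hVU
      exact Module.Finite.of_surjective (appₗ V ((toOpenExtension hU).app (P p.2.1)))
        (toOpenExtension_app_bijective hU _ hVU).2
  refine ⟨⨁ P, ⨁ T, biproduct.lift ψ, i, isQuasicoherent_biproduct P, isQuasicoherent_biproduct T,
    fun V hV hVU => finite_sections_biproduct P fun j => hPf j V hV hVU,
    fun V hV hVU => finite_sections_biproduct T (hTf V hV hVU), fun Y hY => ⟨fun s s' h => ?_,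
      fun x => ?_⟩⟩
  · refine hc.ext fun j => (hι j Y hY).1 ?_
    rw [← hi, ← hi, h]
  rw [ev_biproduct_lift_eq_zero_iff]
  have hχ' (p : Σ j j' : J, j ⟶ j') (s : (D.obj p.1).Sec Y) :
      ev ((underline X).map (χ p)) Y (ev (ι p.1) Y s) =
        ev ((underline X).map ((toOpenExtension hU).app (P p.2.1))) Y
          (ev (ι p.2.1) Y (ev (D.map p.2.2) Y s)) :=
    congrArg (fun t => ev t Y s) (hχ p).symm
  have hψl (j : J) : ev ((underline X).map (ψ (Sum.inl j))) Y x =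
      ev ((underline X).map (φ j)) Y (ev ((underline X).map (biproduct.π P j)) Y x) :=
    ev_map_comp _ _ _
  have hψr (p : Σ j j' : J, j ⟶ j') :
      (ev ((underline X).map (ψ (Sum.inr p))) Y x :
        ((underline X).obj ((openExtension hU).obj (P p.2.1))).Sec Y) = ev ((underline X).map (χ p)) Y (ev ((underline X).map (biproduct.π P p.1)) Y x) -
      ev ((underline X).map ((toOpenExtension hU).app (P p.2.1))) Y
        (ev ((underline X).map (biproduct.π P p.2.1)) Y x) :=
    (ev_map_sub _ _ x).trans (congrArg₂ _ (ev_map_comp _ _ _) (ev_map_comp _ _ _))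
  constructor
  · intro h
    choose s hs using fun j => ((hι j Y hY).2 _).1 ((hψl j).symm.trans (h (Sum.inl j)))
    obtain ⟨t, ht, -⟩ := hc Y s fun j j' f => by
      have h1 := (hψr ⟨j, j', f⟩).symm.trans (h (Sum.inr ⟨j, j', f⟩))
      replace h1 := sub_eq_zero.1 h1
      dsimp only at h1
      rw [← hs, ← hs] at h1
      -- Over `U` the passage to the direct image is injective, so the equation for an arrow gives
      -- compatibility of the sections themselves.
      have h2 := (ev_underline_map_bijective hU _
        (toOpenExtension_app_bijective hU (P j') le_rfl) hY).1 ((hχ' ⟨j, j', f⟩ _).symm.trans h1)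
      exact (hι j' Y hY).1 h2
    refine ⟨t, ev_biproduct_ext P fun j => ?_⟩
    rw [hi, ht, hs]
  · rintro ⟨s, rfl⟩ (j | p)
    · rw [hψl, hi]
      exact ((hι j Y hY).2 _).2 ⟨_, rfl⟩
    · refine (hψr p).trans (sub_eq_zero.2 ?_)
      rw [hi, hi, hχ', ev_π_naturality]

end Limits

/-! ### Images in functors of coherent modules -/

section CoherentImage

open ModuleFunctor

variable {X : Scheme.{u}} [AlgebraicGeometry.IsNoetherian X] [X.IsSeparated]

/-- Over `U` the morphism `f` is induced by a linear map `α` on the ambient module `Q`. The image of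
the kernel of `φ` under `α` is the kernel of the map from `M` to the pushout of `φ` and `α`, and
that pushout is extended to `X` by direct image. -/
lemma exists_image_equation {U : X.Opens} (hU : IsAffineOpen U) {M : X.Modules}
    (hM : IsCoherentModule M) {F : ModuleFunctor X} (hF : HasKernelOn F U)
    (f : F ⟶ (underline X).obj M) :
    ∃ (T : X.Modules) (ψ : M ⟶ T), T.IsQuasicoherent ∧ Module.Finite Γ(X, U) Γ(T, U) ∧
      f ≫ (underline X).map ψ = 0 ∧
      ∀ (B : Type u) [CommRing B] [Algebra Γ(X, U) B]
        (x : ((underline X).obj M).Sec (specOver hU B)),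
        ev ((underline X).map ψ) _ x = 0 → ∃ s, ev f _ s = x := by
  obtain ⟨Q, R, φ, ι, hQ, hR, hQf, hRf, hι⟩ := hF
  have hMq := hM.1
  have hMf := hM.finite hU
  have hRf' := hRf U hU le_rfl
  obtain ⟨χ, hχ⟩ := hι.exists_extension hU (hQf U hU le_rfl) hRf' M f
  let c := LinearEquiv.ofBijective (appₗ U ((toOpenExtension hU).app M))
    (toOpenExtension_app_bijective hU M le_rfl)
  let α : Γ(Q, U) →ₗ[Γ(X, U)] Γ(M, U) := c.symm.toLinearMap ∘ₗ appₗ U χ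
  have hα : appₗ U χ = appₗ U ((toOpenExtension hU).app M) ∘ₗ α :=
    LinearMap.ext fun x => (c.apply_symm_apply _).symm
  obtain ⟨T, _, _, hT, τ, hτ⟩ := exists_ker_lTensor_eq_map_ker (appₗ U φ) α
  obtain ⟨ψ, hψ⟩ := exists_hom_extendModule hU T M τ
  have hψ' : appₗ U ψ = (extendModuleEquiv hU T).toLinearMap ∘ₗ τ := LinearMap.ext hψ
  have key (B : Type u) [CommRing B] [Algebra Γ(X, U) B]
      (x : ((underline X).obj M).Sec (specOver hU B)) :
      ev ((underline X).map ψ) _ x = 0 ↔ ∃ s, ev f _ s = x := by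
    obtain ⟨y, rfl⟩ := (valEquiv hU B M).surjective x
    refine (lTensor_eq_zero_iff hU ψ y).symm.trans ?_
    have e1 : LinearMap.lTensor B (appₗ U ψ) y = 0 ↔ LinearMap.lTensor B τ y = 0 := by
      rw [hψ', LinearMap.lTensor_comp, LinearMap.comp_apply]
      exact LinearEquiv.map_eq_zero_iff (LinearEquiv.lTensor B (extendModuleEquiv hU T))
    have e2 (z) : ev ((underline X).map χ) (specOver hU B) (valEquiv hU B Q z) =
        ev ((underline X).map ((toOpenExtension hU).app M)) (specOver hU B)
          (valEquiv hU B M (LinearMap.lTensor B α z)) := by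
      refine (valEv_valEquiv hU χ z).trans (Eq.trans ?_
        (valEv_valEquiv hU ((toOpenExtension hU).app M) _).symm)
      rw [hα, LinearMap.lTensor_comp, LinearMap.comp_apply]
    have e3 (s : F.Sec (specOver hU B)) : ev ((underline X).map ((toOpenExtension hU).app M)) _
        (ev f _ s) = ev ((underline X).map χ) _ (ev ι _ s) := congrArg (fun t => ev t _ s) hχ
    have hinj := (ev_underline_map_bijective hU _
      (toOpenExtension_app_bijective hU M le_rfl) (specOver_hom_mem hU B)).1
    rw [e1, hτ]
    constructor
    · rintro ⟨z, hz, rfl⟩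
      obtain ⟨s, hs⟩ := ((hι _ (specOver_hom_mem hU B)).2 _).1 ((lTensor_eq_zero_iff hU φ z).1 hz)
      exact ⟨s, hinj ((e3 s).trans ((congrArg _ hs).trans (e2 z)))⟩
    · rintro ⟨s, hs⟩
      obtain ⟨z, hz⟩ := (valEquiv hU B Q).surjective (ev ι _ s)
      refine ⟨z, (lTensor_eq_zero_iff hU φ z).2 (((hι _ (specOver_hom_mem hU B)).2 _).2
        ⟨s, hz.symm⟩), (valEquiv hU B M).injective (hinj ?_)⟩
      exact (e2 z).symm.trans ((congrArg _ hz).trans ((e3 s).symm.trans (congrArg _ hs)))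
  refine ⟨extendModule hU T, ψ, inferInstance,
    Module.Finite.equiv (extendModuleEquiv hU T), ?_, fun B _ _ x hx => (key B x).1 hx⟩
  -- `f ≫ ψ` vanishes on all of `X`, not only over `U`, because its target is a direct image from
  -- `U`.
  refine (extendsFrom_extendModule hU T).underline_hom_ext hU fun B _ _ s => ?_
  exact (key B _).2 ⟨s, rfl⟩

variable {κ : Type} [Finite κ] {U : κ → X.Opens} (hU : ∀ l, IsAffineOpen (U l))
  (hcov : iSup U = ⊤)

include hU hcov in
/-- The image of a morphism to the functor of a coherent module is given by coherent equations. -/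
theorem exists_coherent_image {M : X.Modules} (hM : IsCoherentModule M) {F : ModuleFunctor X}
    (hF : ∀ l, HasKernelOn F (U l)) (f : F ⟶ (underline X).obj M) :
    ∃ (N : X.Modules) (χ : M ⟶ N), IsCoherentModule N ∧ f ≫ (underline X).map χ = 0 ∧
      ∀ (Y : Over X) (x : ((underline X).obj M).Sec Y), ev ((underline X).map χ) Y x = 0 →
        ∀ y : Y.left, ∃ (Z : Over X) (g : Z ⟶ Y), IsOpenImmersion g.left ∧
          y ∈ Set.range g.left ∧ ∃ s, ev f Z s = ((underline X).obj M).res g x := by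
  choose T ψ hTq hTf hfψ hψ using fun l => exists_image_equation (hU l) hM (hF l) f
  have hfψ' (m) {Y : Over X} (s : F.Sec Y) : ev ((underline X).map (ψ m)) Y (ev f Y s) = 0 :=
    congrArg (fun t => ev t Y s) (hfψ m)
  -- Over `U l`, a solution of the `l`-th equation comes from a section of `F`, on which all the
  -- equations hold. This is the mutual implication needed to replace the targets by coherent
  -- modules.
  obtain ⟨N, χ, hN, hχ⟩ := exists_coherent_kernel hU hcov hM T hTf ψ
    (fun l B _ _ x hx m => by
      obtain ⟨s, rfl⟩ := hψ l B x hx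
      exact hfψ' m s)
  refine ⟨N, χ, hN, ModuleFunctor.hom_ext fun Y s => (hχ Y _).2 fun m => hfψ' m s,
    fun Y x hx y => ?_⟩
  obtain ⟨l, hl⟩ := TopologicalSpace.Opens.mem_iSup.1
    (hcov.ge (TopologicalSpace.Opens.mem_top (Y.hom y)))
  obtain ⟨B, _, _, a, ha, hy⟩ := exists_specOver (hU l) Y y hl
  refine ⟨_, a, ha, hy, hψ l B _ ?_⟩
  rw [ev_res, (hχ Y x).1 hx l, map_zero]

/-- Functors isomorphic to the kernel of a homomorphism of coherent modules. -/
def IsCoherentKernel (F : ModuleFunctor X) : Prop :=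
  ∃ (M N : X.Modules) (φ : M ⟶ N) (ι : F ⟶ (underline X).obj M), IsCoherentModule M ∧
    IsCoherentModule N ∧ IsKernelOn ι φ ⊤

-- `F` is embedded into `underline M` with `M` coherent, and its sheaf image there is cut out by a
-- coherent homomorphism `χ`. A solution of `χ` lifts to `F` locally; the lifts are unique by
-- injectivity and glue because `F` is local.
include hU hcov in
lemma isCoherentKernel_of_hasKernelOn {F : ModuleFunctor X} (hF : F.IsLocal)
    (hFU : ∀ l, HasKernelOn F (U l)) : IsCoherentKernel F := by
  obtain ⟨M, ι, hM, hι⟩ := exists_coherent_embedding hU hcov hF hFU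
  obtain ⟨N, χ, hN, hιχ, hχ⟩ := exists_coherent_image hU hcov hM hFU ι
  refine ⟨M, N, χ, ι, hM, hN, fun Y _ => ⟨hι Y, fun x => ⟨fun hx => ?_, ?_⟩⟩⟩
  · refine (hF.exists_of_locally (Y := Y)
      (fun {Z} g s => ev ι Z s = ((underline X).obj M).res g x) ?_ ?_ (hχ Y x hx)).elim
        fun s hs => ⟨s, (underline_isLocal M).eq_of_locally_eq fun y => ?_⟩
    · intro Z W g h s hs
      rw [ev_res, hs, ← res_comp]
    · intro Z g s t hs ht
      exact hι Z (hs.trans ht.symm)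
    · obtain ⟨Z, g, hg, hy, h⟩ := hs y
      exact ⟨Z, g, hg, hy, by rw [← ev_res, h]⟩
  · rintro ⟨s, rfl⟩
    exact congrArg (fun t => ev t Y s) hιχ

end CoherentImage

end

/-! ### Iterated finite limits and finite affine covers -/

section

section IteratedLimits

variable {C : Type u} [Category.{v} C] (S : ObjectProperty C)

instance (n : ℕ) : (limitLevel S (n + 1)).IsClosedUnderIsomorphisms where
  of_iso := by
    rintro F G e ⟨J, _, _, ⟨h⟩⟩
    exact ⟨J, inferInstance, inferInstance, ⟨h.ofIso e⟩⟩

/-- Every object is the limit of the diagram consisting of it alone. -/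
lemma limitLevel_le_succ (n : ℕ) : limitLevel S n ≤ limitLevel S (n + 1) := by
  intro F hF
  let D : Discrete PUnit.{1} ⥤ C := (Functor.const _).obj F
  refine ⟨Discrete PUnit.{1}, inferInstance, inferInstance, ⟨⟨⟨D, 𝟙 _, ?_⟩, fun _ => hF⟩⟩⟩
  exact
    { lift s := s.π.app ⟨⟨⟩⟩
      fac s j := Category.comp_id _
      uniq s m hm := (Category.comp_id m).symm.trans (hm ⟨⟨⟩⟩) }

lemma limitLevel_monotone : Monotone (limitLevel S) :=
  monotone_nat_of_le_succ (limitLevel_le_succ S)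

instance (J : Type) [SmallCategory J] [FinCategory J] :
    (IsIteratedFiniteLimit S).IsClosedUnderLimitsOfShape J where
  limitsOfShape_le := by
    rintro F ⟨h⟩
    choose n hn using h.prop_diag_obj
    -- A finite diagram has all its objects in a common level, the supremum of their levels; the
    -- limit lies one level higher.
    exact ⟨Finset.univ.sup n + 1, J, inferInstance, inferInstance,
      ⟨⟨h.toLimitPresentation, fun j =>
        limitLevel_monotone S (Finset.le_sup (Finset.mem_univ j)) _ (hn j)⟩⟩⟩

variable {S}

/-- To show that all iterated finite limits satisfy a property, it suffices to check the objects
in the class and the closure under finite limits. -/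
lemma isIteratedFiniteLimit_le {P : ObjectProperty C} (hS : S ≤ P)
    (hP : ∀ (J : Type) [SmallCategory J] [FinCategory J], P.limitsOfShape J ≤ P) :
    IsIteratedFiniteLimit S ≤ P := by
  rintro F ⟨n, hn⟩
  induction n generalizing F with
  | zero => exact hS _ hn
  | succ n ih =>
    obtain ⟨J, _, _, ⟨h⟩⟩ := hn
    exact hP J _ ⟨h.ofLE ih⟩

lemma isIteratedFiniteLimit_of_mem {F : C} (h : S F) : IsIteratedFiniteLimit S F := ⟨0, h⟩

instance : (IsIteratedFiniteLimit S).IsClosedUnderIsomorphisms where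
  of_iso := by
    rintro F G e ⟨n, hn⟩
    -- Level `0` is `S` itself and need not be closed under isomorphisms; one level up there is
    -- closure.
    exact ⟨n + 1, (limitLevel S (n + 1)).prop_of_iso e (limitLevel_le_succ S n _ hn)⟩

end IteratedLimits

section AffineCover

lemma exists_finite_affine_refinement (X : Scheme.{u}) [CompactSpace X] {n : ℕ}
    (U : Fin n → X.Opens) (hU : iSup U = ⊤) :
    ∃ (m : ℕ) (V : Fin m → X.Opens) (i : Fin m → Fin n), (∀ l, IsAffineOpen (V l)) ∧
      iSup V = ⊤ ∧ ∀ l, V l ≤ U (i l) := by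
  have h (x : X) : ∃ (W : X.affineOpens) (k : Fin n), x ∈ W.1 ∧ W.1 ≤ U k := by
    obtain ⟨k, hk⟩ := TopologicalSpace.Opens.mem_iSup.1
      (hU.ge (TopologicalSpace.Opens.mem_top x))
    obtain ⟨_, ⟨W, hWa, rfl⟩, hx, hW⟩ := X.isBasis_affineOpens.exists_subset_of_mem_open
      (show x ∈ (U k : Set X) from hk) (U k).isOpen
    exact ⟨⟨W, hWa⟩, k, hx, hW⟩
  choose W k hx hW using h
  obtain ⟨t, ht⟩ := isCompact_univ.elim_finite_subcover (fun x => ((W x).1 : Set X))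
    (fun x => (W x).1.isOpen) fun x _ => Set.mem_iUnion.2 ⟨x, hx x⟩
  let e := t.equivFin.symm
  refine ⟨_, fun l => (W (e l)).1, fun l => k (e l), fun l => (W (e l)).2, ?_, fun l => hW _⟩
  refine top_le_iff.1 fun x _ => TopologicalSpace.Opens.mem_iSup.2 ?_
  obtain ⟨y, hy, hxy⟩ := Set.mem_iUnion₂.1 (ht (Set.mem_univ x))
  refine ⟨t.equivFin ⟨y, hy⟩, ?_⟩
  simpa [e] using hxy

lemma exists_finite_affine_cover (X : Scheme.{u}) [CompactSpace X] :
    ∃ (m : ℕ) (V : Fin m → X.Opens), (∀ l, IsAffineOpen (V l)) ∧ iSup V = ⊤ := by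
  obtain ⟨m, V, -, h1, h2, -⟩ := exists_finite_affine_refinement X (n := 1) (fun _ => ⊤)
    (by simp)
  exact ⟨m, V, h1, h2⟩

end AffineCover

/-! ### Kernels on sections and locally surjective morphisms -/

section KernelFork

open ModuleFunctor

variable {X : Scheme.{u}}

/-- A subfunctor which is the kernel on sections is a kernel. -/
lemma nonempty_isLimit_kernelFork {F G H : ModuleFunctor X} {ι : F ⟶ G} {f : G ⟶ H}
    (w : ι ≫ f = 0) (hι : ∀ Y, Function.Injective (ev ι Y))
    (hf : ∀ Y x, ev f Y x = 0 → ∃ s, ev ι Y s = x) :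
    Nonempty (IsLimit (KernelFork.ofι ι w)) := by
  refine IsSectionwiseLimit.nonempty_isLimit fun Y x hx => ?_
  have h0 := hx WalkingParallelPairHom.left
  have h1 := hx WalkingParallelPairHom.right
  obtain ⟨s, hs⟩ := hf Y (x WalkingParallelPair.zero) (h0.trans h1.symm)
  refine ⟨s, ?_, fun s' hs' => hι Y ((hs' WalkingParallelPair.zero).trans hs.symm)⟩
  rintro (_ | _)
  · exact hs
  · refine Eq.trans ?_ h0
    exact (ev_π_naturality (KernelFork.ofι ι w) WalkingParallelPairHom.left s).symm.trans
      (congrArg _ hs)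

lemma ev_injective_of_isLimit {F G H : ModuleFunctor X} {ι : F ⟶ G} {f : G ⟶ H} {w : ι ≫ f = 0}
    (h : IsLimit (KernelFork.ofι ι w)) (Y : Over X) : Function.Injective (ev ι Y) := by
  intro s s' hs
  refine (isSectionwiseLimit_of_isLimit h).ext (Y := Y) ?_
  rintro (_ | _)
  · exact hs
  · refine (ev_π_naturality (KernelFork.ofι ι w) WalkingParallelPairHom.left s).symm.trans
      (Eq.trans ?_ (ev_π_naturality (KernelFork.ofι ι w) WalkingParallelPairHom.left s'))
    exact congrArg _ hs

lemma exists_ev_eq_of_isLimit {F G H : ModuleFunctor X} {ι : F ⟶ G} {f : G ⟶ H} {w : ι ≫ f = 0}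
    (h : IsLimit (KernelFork.ofι ι w)) {Y : Over X} (x : G.Sec Y) (hx : ev f Y x = 0) :
    ∃ s, ev ι Y s = x := by
  obtain ⟨s, hs, -⟩ := isSectionwiseLimit_of_isLimit h Y
    (fun | .zero => x | .one => (0 : H.Sec Y)) (by
      rintro _ _ (_ | _ | _)
      · exact hx
      · rfl
      · rename_i j
        cases j
        · rfl
        · rfl)
  exact ⟨s, hs .zero⟩

lemma ev_injective_of_mono {F G : ModuleFunctor X} (f : F ⟶ G) [Mono f] (Y : Over X) :
    Function.Injective (ev f Y) :=
  (ModuleCat.mono_iff_injective _).1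
    (inferInstanceAs (Mono ((PresheafOfModules.evaluation (globalSections X) (op Y)).map f)))

lemma exists_open_pullback {W Y Z : Over X} (a : W ⟶ Y) [IsOpenImmersion a.left] (g : Z ⟶ Y)
    (z : Z.left) (hz : g.left z ∈ Set.range a.left) :
    ∃ (Z' : Over X) (b : Z' ⟶ Z) (c : Z' ⟶ W), IsOpenImmersion b.left ∧
      z ∈ Set.range b.left ∧ c ≫ a = b ≫ g := by
  let O : Z.left.Opens := g.left ⁻¹ᵁ a.left.opensRange
  have hO := range_overOpenι Z O
  obtain ⟨c, hc⟩ := exists_over_lift a (overOpenι Z O ≫ g) (by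
    rintro _ ⟨w, rfl⟩
    have : (overOpenι Z O).left w ∈ Set.range (overOpenι Z O).left := ⟨w, rfl⟩
    rw [hO] at this
    exact this)
  exact ⟨_, overOpenι Z O, c, inferInstance, by rw [hO]; exact hz, hc⟩

/-- A section which is, locally, in the image of `f`. -/
def IsLocallyInRange {F G : ModuleFunctor X} (f : F ⟶ G) {Y : Over X} (x : G.Sec Y) : Prop :=
  ∀ y : Y.left, ∃ (Z : Over X) (g : Z ⟶ Y), IsOpenImmersion g.left ∧ y ∈ Set.range g.left ∧
    ∃ s, ev f Z s = G.res g x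

lemma ev_eq_zero_of_isLocallyInRange {F G H : ModuleFunctor X} (hH : H.IsLocal) {f : F ⟶ G}
    {h : G ⟶ H} (hfh : f ≫ h = 0) {Y : Over X} {x : G.Sec Y} (hx : IsLocallyInRange f x) :
    ev h Y x = 0 := by
  refine hH.eq_of_locally_eq fun y => ?_
  obtain ⟨Z, g, hg, hy, s, hs⟩ := hx y
  refine ⟨Z, g, hg, hy, ?_⟩
  rw [map_zero, ← ev_res, ← hs]
  exact congrArg (fun t => ev t Z s) hfh

/-- A morphism to a local functor that vanishes on the kernel of a locally surjective morphism
factors through it. -/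
lemma exists_factor_of_locally_surjective {G K H : ModuleFunctor X} (hH : H.IsLocal) (q : G ⟶ K)
    (hq : ∀ (Y : Over X) (x : K.Sec Y), IsLocallyInRange q x)
    (h : G ⟶ H) (hh : ∀ Y x, ev q Y x = 0 → ev h Y x = 0) :
    ∃ k : K ⟶ H, q ≫ k = h := by
  have huniq {Y : Over X} {s s' : G.Sec Y} (e : ev q Y s = ev q Y s') : ev h Y s = ev h Y s' := by
    rw [← sub_eq_zero, ← map_sub] at e ⊢
    exact hh _ _ e
  have key (Y : Over X) (x : K.Sec Y) : ∃ t : H.Sec Y, ∀ (Z : Over X) (g : Z ⟶ Y) (s : G.Sec Z),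
      ev q Z s = K.res g x → ev h Z s = H.res g t := by
    refine (hH.exists_of_locally (Y := Y)
      -- The value at `x` is glued from the values of `h` on local preimages of `x` under `q`, which
      -- do not depend on the preimage because `h` kills the kernel of `q`.
      (fun {Z} g t => ∃ s, ev q Z s = K.res g x ∧ ev h Z s = t) ?_ ?_ ?_).elim fun t ht =>
        ⟨t, fun Z g s hs => hH.eq_of_locally_eq fun z => ?_⟩
    · rintro Z W g h t ⟨s, hs, rfl⟩
      exact ⟨G.res h s, by rw [ev_res, hs, res_comp], by rw [ev_res]⟩
    · rintro Z g t t' ⟨s, hs, rfl⟩ ⟨s', hs', rfl⟩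
      exact huniq (hs.trans hs'.symm)
    · intro y
      obtain ⟨Z, g, hg, hy, s, hs⟩ := hq Y x y
      exact ⟨Z, g, hg, hy, _, s, hs, rfl⟩
    · obtain ⟨W, a, ha, hy, s', hs', hs''⟩ := ht (g.left z)
      obtain ⟨Z', b, c, hb, hz, e⟩ := exists_open_pullback a g z hy
      refine ⟨Z', b, hb, hz, ?_⟩
      rw [← ev_res, ← res_comp, ← e, res_comp, ← hs'', ← ev_res]
      refine huniq ?_
      rw [ev_res, ev_res, hs, hs', ← res_comp, ← res_comp, e]
  choose k hk using key
  have hkq {Y : Over X} (x : K.Sec Y) (t : H.Sec Y) (ht : ∀ (Z : Over X) (g : Z ⟶ Y) (s : G.Sec Z),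
      ev q Z s = K.res g x → ev h Z s = H.res g t) : k Y x = t := by
    refine hH.eq_of_locally_eq fun y => ?_
    obtain ⟨Z, g, hg, hy, s, hs⟩ := hq Y x y
    exact ⟨Z, g, hg, hy, (hk Y x Z g s hs).symm.trans (ht Z g s hs)⟩
  refine ⟨mkHom (fun Y =>
    { toFun := k Y
      map_add' := fun x x' => hkq _ _ fun Z g s hs => ?_
      map_smul' := fun r x => hkq _ _ fun Z g s hs => ?_ })
    (fun {Y Z} g x => hkq _ _ fun W a s hs => ?_), ModuleFunctor.hom_ext fun Y s =>
      hkq _ _ fun Z g s' hs => ?_⟩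
  · refine hH.eq_of_locally_eq fun z => ?_
    obtain ⟨W, a, ha, hz, s', hs'⟩ := hq Z (K.res g x) z
    refine ⟨W, a, ha, hz, ?_⟩
    rw [← res_comp] at hs'
    have h1 := hk Y x W (a ≫ g) s' hs'
    -- If `s` lifts `x + x'` and `s'` lifts `x` locally, then their difference lifts `x'`; no
    -- separate lift of `x'` is chosen.
    have h2 := hk Y x' W (a ≫ g) (G.res a s - s') (by
      rw [map_sub, ev_res, hs, hs', ← res_comp, map_add, add_sub_cancel_left])
    rw [← ev_res, ← res_comp, map_add, ← h1, ← h2, map_sub, add_sub_cancel]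
  · refine hH.eq_of_locally_eq fun z => ?_
    obtain ⟨W, a, ha, hz, s', hs'⟩ := hq Z (K.res g x) z
    refine ⟨W, a, ha, hz, ?_⟩
    rw [← res_comp] at hs'
    have h1 := hk Y x W (a ≫ g) s' hs'
    have h2 : ev h W (G.res a s) = ev h W (((a ≫ g).left.appTop r) • s') := huniq (by
      rw [ev_res, hs, LinearMap.map_smul, hs', ← res_comp, res_smul])
    rw [← ev_res, ← res_comp, h2, map_smul, h1, RingHom.id_apply, res_smul]
  · rw [← res_comp] at hs ⊢
    exact hk Y x W (a ≫ g) s hs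
  · rw [← ev_res]
    exact huniq (hs.trans (ev_res q g s).symm)

end KernelFork

/-! ### Module-coherent functors are coherent kernels -/

section CoherentCharacterization

open ModuleFunctor

variable {X : Scheme.{u}} [AlgebraicGeometry.IsNoetherian X] [X.IsSeparated]

omit [AlgebraicGeometry.IsNoetherian X] [X.IsSeparated] in
lemma IsCoherentModule.isQuasicoherent {M : X.Modules} (hM : IsCoherentModule M) :
    M.IsQuasicoherent := hM.1

omit [AlgebraicGeometry.IsNoetherian X] [X.IsSeparated] in
lemma IsCoherentKernel.hasKernelOn {F : ModuleFunctor X} (hF : IsCoherentKernel F)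
    (U : X.Opens) : HasKernelOn F U := by
  obtain ⟨M, N, φ, ι, hM, hN, h⟩ := hF
  have := hM.isQuasicoherent
  have := hN.isQuasicoherent
  exact ⟨M, N, φ, ι, hM.1, hN.1, fun V hV _ => hM.finite hV, fun V hV _ => hN.finite hV,
    h.mono le_top⟩

omit [AlgebraicGeometry.IsNoetherian X] [X.IsSeparated] in
lemma IsKernelOn.isLocal {F : ModuleFunctor X} {M N : X.Modules} {φ : M ⟶ N}
    {ι : F ⟶ (underline X).obj M} (h : IsKernelOn ι φ ⊤) : F.IsLocal := by
  have w : ι ≫ (underline X).map φ = 0 :=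
    ModuleFunctor.hom_ext fun Y s => ((h Y fun _ => trivial).2 _).2 ⟨s, rfl⟩
  obtain ⟨hl⟩ := nonempty_isLimit_kernelFork w (fun Y => (h Y fun _ => trivial).1)
    fun Y x hx => ((h Y fun _ => trivial).2 x).1 hx
  refine (isSectionwiseLimit_of_isLimit hl).isLocal ?_
  rintro (_ | _)
  · exact underline_isLocal M
  · exact underline_isLocal N

omit [AlgebraicGeometry.IsNoetherian X] [X.IsSeparated] in
lemma IsCoherentKernel.isLocal {F : ModuleFunctor X} (hF : IsCoherentKernel F) : F.IsLocal := by
  obtain ⟨M, N, φ, ι, hM, hN, h⟩ := hF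
  exact h.isLocal

/-- Coherent kernels are closed under finite limits: a limit of sheaves is a sheaf, over each affine
open it is a kernel of modules with finitely generated sections, and
`isCoherentKernel_of_hasKernelOn` makes this global. Induction over the levels reduces to this and
to `underline M`, the kernel of zero. -/
lemma IsModuleCoherent.isCoherentKernel {F : ModuleFunctor X} (hF : IsModuleCoherent X F) :
    IsCoherentKernel F := by
  refine isIteratedFiniteLimit_le (P := fun F : ModuleFunctor X => IsCoherentKernel F) ?_ ?_ F hF
  · rintro F ⟨M, hM, ⟨e⟩⟩
    refine ⟨M, M, 0, e.hom, hM, hM, fun Y _ => ⟨?_, fun x => ⟨fun _ => ⟨ev e.inv Y x, ?_⟩, fun _ => ?_⟩⟩⟩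
    · exact ev_injective_of_mono e.hom Y
    · rw [← ev_comp, e.inv_hom_id, ev_id]
    · rw [Functor.map_zero, ev_zero]
  · rintro J _ _ F ⟨h⟩
    obtain ⟨m, V, hV, hcov⟩ := exists_finite_affine_cover X
    have hc := isSectionwiseLimit_of_isLimit h.isLimit
    exact isCoherentKernel_of_hasKernelOn hV hcov (hc.isLocal fun j => (h.prop_diag_obj j).isLocal)
      fun l => hc.hasKernelOn (hV l) fun j => (h.prop_diag_obj j).hasKernelOn _

omit [AlgebraicGeometry.IsNoetherian X] [X.IsSeparated] in
lemma isModuleCoherent_underline {M : X.Modules} (hM : IsCoherentModule M) :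
    IsModuleCoherent X ((underline X).obj M) :=
  isIteratedFiniteLimit_of_mem ⟨M, hM, ⟨Iso.refl _⟩⟩

omit [AlgebraicGeometry.IsNoetherian X] [X.IsSeparated] in
lemma isIteratedFiniteLimit_of_isLimit_kernelFork (S : ObjectProperty (ModuleFunctor X))
    {F G H : ModuleFunctor X} {ι : F ⟶ G}
    {f : G ⟶ H} {w : ι ≫ f = 0} (h : IsLimit (KernelFork.ofι ι w))
    (hG : IsIteratedFiniteLimit S G) (hH : IsIteratedFiniteLimit S H) :
    IsIteratedFiniteLimit S F :=
  (IsIteratedFiniteLimit S).limitsOfShape_le WalkingParallelPair _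
    ⟨⟨⟨parallelPair f 0, (KernelFork.ofι ι w).π, h⟩, by rintro (_ | _); exacts [hG, hH]⟩⟩

omit [AlgebraicGeometry.IsNoetherian X] [X.IsSeparated] in
lemma IsKernelOn.exists_isLimit {F : ModuleFunctor X} {M N : X.Modules} {φ : M ⟶ N}
    {ι : F ⟶ (underline X).obj M} (h : IsKernelOn ι φ ⊤) :
    ∃ w : ι ≫ (underline X).map φ = 0, Nonempty (IsLimit (KernelFork.ofι ι w)) := by
  have w : ι ≫ (underline X).map φ = 0 :=
    ModuleFunctor.hom_ext fun Y s => ((h Y fun _ => trivial).2 _).2 ⟨s, rfl⟩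
  exact ⟨w, nonempty_isLimit_kernelFork w (fun Y => (h Y fun _ => trivial).1)
    fun Y x hx => ((h Y fun _ => trivial).2 x).1 hx⟩

omit [AlgebraicGeometry.IsNoetherian X] [X.IsSeparated] in
lemma IsCoherentKernel.isModuleCoherent {F : ModuleFunctor X} (hF : IsCoherentKernel F) :
    IsModuleCoherent X F := by
  obtain ⟨M, N, φ, ι, hM, hN, h⟩ := hF
  obtain ⟨w, ⟨hl⟩⟩ := h.exists_isLimit
  exact isIteratedFiniteLimit_of_isLimit_kernelFork _ hl (isModuleCoherent_underline hM)
    (isModuleCoherent_underline hN)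

/-- A module-coherent functor is the kernel of a homomorphism of coherent modules. -/
theorem IsModuleCoherent.exists_iso_kernel {F : ModuleFunctor X} (hF : IsModuleCoherent X F) :
    ∃ (M N : X.Modules) (φ : M ⟶ N), IsCoherentModule M ∧ IsCoherentModule N ∧
      Nonempty (F ≅ kernel ((underline X).map φ)) := by
  obtain ⟨M, N, φ, ι, hM, hN, h⟩ := hF.isCoherentKernel
  obtain ⟨w, ⟨hl⟩⟩ := h.exists_isLimit
  exact ⟨M, N, φ, hM, hN, ⟨hl.conePointUniqueUpToIso (limit.isLimit _)⟩⟩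

/-- Every subfunctor of a module-coherent functor which is the image of a module-coherent functor
is the kernel of a morphism to the functor of a coherent module. -/
lemma IsModuleCoherent.exists_image {F G : ModuleFunctor X} (hF : IsModuleCoherent X F)
    (hG : IsModuleCoherent X G) (f : F ⟶ G) :
    ∃ (N : X.Modules) (j : G ⟶ (underline X).obj N), IsCoherentModule N ∧ f ≫ j = 0 ∧
      ∀ (Y : Over X) (x : G.Sec Y), ev j Y x = 0 → IsLocallyInRange f x := by
  obtain ⟨M, N, φ, ι, hM, hN, h⟩ := hG.isCoherentKernel
  obtain ⟨m, V, hV, hcov⟩ := exists_finite_affine_cover X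
  obtain ⟨N', χ, hN', hfχ, hχ⟩ := exists_coherent_image hV hcov hM
    (fun l => hF.isCoherentKernel.hasKernelOn (V l)) (f ≫ ι)
  refine ⟨N', ι ≫ (underline X).map χ, hN', by rw [← hfχ, Category.assoc], fun Y x hx y => ?_⟩
  obtain ⟨Z, g, hg, hy, s, hs⟩ := hχ Y (ev ι Y x) hx y
  refine ⟨Z, g, hg, hy, s, (h Z fun _ => trivial).1 ?_⟩
  rw [ev_res]
  exact hs

end CoherentCharacterization

/-! ### The category of module-coherent functors is abelian -/

section Abelian

open ModuleFunctor

variable {X : Scheme.{u}} [AlgebraicGeometry.IsNoetherian X] [X.IsSeparated]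

instance (J : Type) [SmallCategory J] [FinCategory J] :
    (IsModuleCoherent X).IsClosedUnderLimitsOfShape J :=
  inferInstanceAs ((IsIteratedFiniteLimit _).IsClosedUnderLimitsOfShape J)

omit [AlgebraicGeometry.IsNoetherian X] [X.IsSeparated] in
lemma mono_hom_of_mono {F G : (IsModuleCoherent X).FullSubcategory} (f : F ⟶ G) [Mono f] :
    Mono f.hom :=
  inferInstanceAs (Mono ((IsModuleCoherent X).ι.map f))

/-- The cokernel of `f` is the sheaf image of a morphism `j` whose kernel is the sheaf image of `f`,
and that sheaf image is itself the kernel of a second morphism `j'`. Morphisms from `G` that vanish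
on `f` descend because `G → Ker j'` is locally surjective and every module-coherent functor is
local. -/
lemma hasCokernels_isModuleCoherent : HasCokernels (IsModuleCoherent X).FullSubcategory where
  has_colimit {F G} f := by
    obtain ⟨N, j, hN, hfj, hj⟩ := F.2.exists_image G.2 f.hom
    obtain ⟨N', j', hN', hjj', hj'⟩ :=
      G.2.exists_image (isModuleCoherent_underline hN) j
    let K : (IsModuleCoherent X).FullSubcategory := ⟨kernel j',
      isIteratedFiniteLimit_of_isLimit_kernelFork _ (w := kernel.condition j') (kernelIsKernel j')
        (isModuleCoherent_underline hN) (isModuleCoherent_underline hN')⟩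
    have hinj := ev_injective_of_isLimit (w := kernel.condition j') (kernelIsKernel j')
    let q : G.obj ⟶ kernel j' := kernel.lift j' j hjj'
    have hqi : q ≫ kernel.ι j' = j := kernel.lift_ι _ _ _
    have hqi' {Y : Over X} (s : G.obj.Sec Y) : ev (kernel.ι j') Y (ev q Y s) = ev j Y s :=
      congrArg (fun t => ev t Y s) hqi
    have hq (Y : Over X) (x : (kernel j').Sec Y) : IsLocallyInRange q x := by
      intro y
      obtain ⟨Z, g, hg, hy, s, hs⟩ := hj' Y (ev (kernel.ι j') Y x)
        (congrArg (fun t => ev t Y x) (kernel.condition j')) y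
      refine ⟨Z, g, hg, hy, s, hinj Z ?_⟩
      exact (hqi' s).trans (hs.trans (ev_res _ _ _).symm)
    have hfq : f.hom ≫ q = 0 := by
      rw [← cancel_mono (kernel.ι j'), Category.assoc, hqi, hfj, zero_comp]
    have hdesc {H : (IsModuleCoherent X).FullSubcategory} (h : G ⟶ H) (hfh : f ≫ h = 0) :
        ∃ k : K ⟶ H, (ObjectProperty.homMk q : G ⟶ K) ≫ k = h := by
      obtain ⟨k, hk⟩ := exists_factor_of_locally_surjective H.2.isCoherentKernel.isLocal q hq h.hom
        fun Y x hx => ev_eq_zero_of_isLocallyInRange H.2.isCoherentKernel.isLocal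
          (congrArg InducedCategory.Hom.hom hfh) (hj Y x (by rw [← hqi', hx, map_zero]))
      exact ⟨ObjectProperty.homMk k, InducedCategory.hom_ext hk⟩
    have hepi {H : (IsModuleCoherent X).FullSubcategory} (k k' : K ⟶ H)
        (h : (ObjectProperty.homMk q : G ⟶ K) ≫ k = (ObjectProperty.homMk q : G ⟶ K) ≫ k') :
        k = k' := by
      refine InducedCategory.hom_ext (ModuleFunctor.hom_ext fun Y x => ?_)
      refine H.2.isCoherentKernel.isLocal.eq_of_locally_eq fun y => ?_
      obtain ⟨Z, g, hg, hy, s, hs⟩ := hq Y x y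
      refine ⟨Z, g, hg, hy, ?_⟩
      rw [← ev_res, ← ev_res]
      refine (congrArg _ hs).symm.trans (Eq.trans ?_ (congrArg _ hs))
      exact congrArg (fun t => ev (InducedCategory.Hom.hom t) Z s) h
    exact ⟨⟨⟨_, CokernelCofork.IsColimit.ofπ (ObjectProperty.homMk q : G ⟶ K)
      (InducedCategory.hom_ext hfq) (fun h hfh => (hdesc h hfh).choose)
      (fun h hfh => (hdesc h hfh).choose_spec)
      fun h hfh k hk => hepi _ _ (hk.trans (hdesc h hfh).choose_spec.symm)⟩⟩⟩

/-- A monomorphism is injective on sections, so local preimages are unique and glue. Hence its sheaf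
image, which is the kernel of some `j`, is `F` itself. -/
lemma isNormalMonoCategory_isModuleCoherent :
    IsNormalMonoCategory (IsModuleCoherent X).FullSubcategory where
  normalMonoOfMono {F G} f _ := by
    obtain ⟨N, j, hN, hfj, hj⟩ := F.2.exists_image G.2 f.hom
    have := mono_hom_of_mono f
    have hinj := ev_injective_of_mono f.hom
    obtain ⟨hl⟩ := nonempty_isLimit_kernelFork hfj hinj fun Y x hx => by
      have hF := F.2.isCoherentKernel.isLocal
      have hG := G.2.isCoherentKernel.isLocal
      refine (hF.exists_of_locally (Y := Y)
        (fun {Z} g s => ev f.hom Z s = G.obj.res g x) ?_ ?_ (hj Y x hx)).elim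
          fun s hs => ⟨s, hG.eq_of_locally_eq fun y => ?_⟩
      · intro Z W g h s hs
        rw [ev_res, hs, ← res_comp]
      · intro Z g s t hs ht
        exact hinj Z (hs.trans ht.symm)
      · obtain ⟨Z, g, hg, hy, h⟩ := hs y
        exact ⟨Z, g, hg, hy, by rw [← ev_res, h]⟩
    let N' : (IsModuleCoherent X).FullSubcategory := ⟨_, isModuleCoherent_underline hN⟩
    have hlift {H : (IsModuleCoherent X).FullSubcategory} (h : H ⟶ G)
        (w : h ≫ (ObjectProperty.homMk j : G ⟶ N') = 0) : ∃ k : H ⟶ F, k ≫ f = h := by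
      obtain ⟨k, hk⟩ := KernelFork.IsLimit.lift' hl h.hom (congrArg InducedCategory.Hom.hom w)
      exact ⟨ObjectProperty.homMk k, InducedCategory.hom_ext hk⟩
    exact ⟨⟨N', ObjectProperty.homMk j, InducedCategory.hom_ext hfj,
      KernelFork.IsLimit.ofι f _ (fun h w => (hlift h w).choose)
        (fun h w => (hlift h w).choose_spec)
        fun h w k hk => (cancel_mono f).1 (hk.trans (hlift h w).choose_spec.symm)⟩⟩

/-- The morphism `j` whose kernel is the sheaf image of `f` satisfies `f ≫ j = 0`, so it is zero
when `f` is an epimorphism. Thus `f` is locally surjective, and a locally surjective morphism is the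
cokernel of its kernel. -/
lemma isNormalEpiCategory_isModuleCoherent :
    IsNormalEpiCategory (IsModuleCoherent X).FullSubcategory where
  normalEpiOfEpi {F G} f _ := by
    obtain ⟨N, j, hN, hfj, hj⟩ := F.2.exists_image G.2 f.hom
    let N' : (IsModuleCoherent X).FullSubcategory := ⟨_, isModuleCoherent_underline hN⟩
    have hj0 : j = 0 := by
      have h : f ≫ (ObjectProperty.homMk j : G ⟶ N') = f ≫ 0 := by
        rw [comp_zero]
        exact InducedCategory.hom_ext hfj
      exact congrArg InducedCategory.Hom.hom ((cancel_epi f).1 h)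
    have hf (Y : Over X) (x : G.obj.Sec Y) : IsLocallyInRange f.hom x :=
      hj Y x (congrArg (fun t => ev t Y x) hj0)
    let K : (IsModuleCoherent X).FullSubcategory := ⟨kernel f.hom,
      isIteratedFiniteLimit_of_isLimit_kernelFork _ (w := kernel.condition f.hom)
        (kernelIsKernel f.hom) F.2 G.2⟩
    have hdesc {H : (IsModuleCoherent X).FullSubcategory} (h : F ⟶ H)
        (w : (ObjectProperty.homMk (kernel.ι f.hom) : K ⟶ F) ≫ h = 0) : ∃ k : G ⟶ H, f ≫ k = h := by
      have hw : kernel.ι f.hom ≫ h.hom = 0 := congrArg InducedCategory.Hom.hom w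
      obtain ⟨k, hk⟩ := exists_factor_of_locally_surjective H.2.isCoherentKernel.isLocal f.hom hf
        h.hom fun Y x hx => by
          obtain ⟨s, rfl⟩ := exists_ev_eq_of_isLimit (w := kernel.condition f.hom)
            (kernelIsKernel f.hom) x hx
          exact congrArg (fun t => ev t Y s) hw
      exact ⟨ObjectProperty.homMk k, InducedCategory.hom_ext hk⟩
    exact ⟨⟨K, ObjectProperty.homMk (kernel.ι f.hom),
      InducedCategory.hom_ext (kernel.condition f.hom),
      CokernelCofork.IsColimit.ofπ f _ (fun h w => (hdesc h w).choose)
        (fun h w => (hdesc h w).choose_spec)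
        fun h w k hk => (cancel_epi f).1 (hk.trans (hdesc h w).choose_spec.symm)⟩⟩

variable (X) in
/-- The category of module-coherent functors, with the addition of morphisms of module-valued
functors, is abelian. -/
theorem exists_abelian_isModuleCoherent :
    ∃ A : Abelian (IsModuleCoherent X).FullSubcategory,
      A.toPreadditive = Preadditive.fullSubcategory _ := by
  have h1 := isNormalMonoCategory_isModuleCoherent (X := X)
  have h2 := isNormalEpiCategory_isModuleCoherent (X := X)
  have h3 := hasCokernels_isModuleCoherent (X := X)
  -- Finite products and kernels are inherited from closure under finite limits.
  have h4 : HasFiniteProducts (IsModuleCoherent X).FullSubcategory := ⟨fun n => inferInstance⟩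
  have h5 : HasKernels (IsModuleCoherent X).FullSubcategory := inferInstance
  exact ⟨{
    toPreadditive := Preadditive.fullSubcategory _
    normalMonoOfMono := h1.normalMonoOfMono
    normalEpiOfEpi := h2.normalEpiOfEpi }, rfl⟩

end Abelian

end

/-! ### Restriction and extension of functors along a morphism -/

section

section Along

open ModuleFunctor

variable {X U : Scheme.{u}} (j : U ⟶ X)

/-- The restriction of module-valued functors along a morphism of schemes. -/
def restrictAlong : ModuleFunctor X ⥤ ModuleFunctor U :=
  PresheafOfModules.pushforward₀ (Over.map j) (globalSections X)

/-- The projection `U ×_X Y ⟶ Y`. -/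
def baseChangeπ (Y : Over X) : (Over.map j).obj ((Over.pullback j).obj Y) ⟶ Y :=
  (Over.mapPullbackAdj j).counit.app Y

/-- The extension of module-valued functors along a morphism `U ⟶ X`, with values
`Y ↦ G (U ×_X Y)`. -/
def extendAlong : ModuleFunctor U ⥤ ModuleFunctor X :=
  PresheafOfModules.pushforward (F := Over.pullback j) (S := globalSections X)
    (R := globalSections U)
    (Functor.whiskerRight (NatTrans.op (Over.mapPullbackAdj j).counit) (globalSections X))

/-- The canonical morphism to the extension of the restriction. -/
def toExtendAlong : 𝟭 (ModuleFunctor X) ⟶ restrictAlong j ⋙ extendAlong j where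
  app F := mkHom (F := F) (G := (extendAlong j).obj ((restrictAlong j).obj F)) (fun Y =>
    { toFun := F.res (baseChangeπ j Y)
      map_add' := map_add _
      map_smul' := F.res_smul (baseChangeπ j Y) }) (fun {Y Z} g x => by
        change F.res (baseChangeπ j Z) (F.res g x) =
          F.res ((Over.map j).map ((Over.pullback j).map g)) (F.res (baseChangeπ j Y) x)
        rw [← F.res_comp, ← F.res_comp]
        exact congrArg (fun a => F.res a x) ((Over.mapPullbackAdj j).counit.naturality g).symm)
  naturality F G t := ModuleFunctor.hom_ext fun Y x => (ev_res t (baseChangeπ j Y) x).symm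

instance (J : Type) [SmallCategory J] : PreservesLimitsOfShape J (restrictAlong j) where
  preservesLimit := ⟨fun hc => IsSectionwiseLimit.nonempty_isLimit fun T x hx =>
    isSectionwiseLimit_of_isLimit hc ((Over.map j).obj T) x hx⟩

instance (J : Type) [SmallCategory J] : PreservesLimitsOfShape J (extendAlong j) where
  preservesLimit := ⟨fun hc => IsSectionwiseLimit.nonempty_isLimit fun Y x hx =>
    isSectionwiseLimit_of_isLimit hc ((Over.pullback j).obj Y) x hx⟩

/-- The restriction along a composition. -/
def restrictAlongComp {V : Scheme.{u}} (k : V ⟶ U) {l : V ⟶ X} (w : k ≫ j = l)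
    (F : ModuleFunctor X) :
    (restrictAlong k).obj ((restrictAlong j).obj F) ≅ (restrictAlong l).obj F := by
  let e (T : Over V) : (Over.map l).obj T ⟶ (Over.map j).obj ((Over.map k).obj T) :=
    Over.homMk (𝟙 T.left) (by simp [← w])
  have he (T : Over V) : IsIso (e T) := by
    have : IsIso ((Over.forget X).map (e T)) := inferInstanceAs (IsIso (𝟙 T.left))
    exact isIso_of_reflects_iso (e T) (Over.forget X)
  have hres {T T' : Over V} (g : T' ⟶ T) (x : F.Sec ((Over.map j).obj ((Over.map k).obj T))) :
      F.res (e T') (F.res ((Over.map j).map ((Over.map k).map g)) x) =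
        F.res ((Over.map l).map g) (F.res (e T) x) := by
    have h : e T' ≫ (Over.map j).map ((Over.map k).map g) = (Over.map l).map g ≫ e T := by
      ext
      simp [e]
    rw [← F.res_comp, ← F.res_comp, h]
  let t : (restrictAlong k).obj ((restrictAlong j).obj F) ⟶ (restrictAlong l).obj F :=
    mkHom (F := (restrictAlong k).obj ((restrictAlong j).obj F)) (G := (restrictAlong l).obj F)
      (fun T =>
        { toFun := F.res (e T)
          map_add' := map_add _
          map_smul' := fun r x => F.res_smul (e T) r x }) (fun {T T'} g x => hres g x)
  have : IsIso t := isIso_of_bijective t fun T => F.res_bijective (e T)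
  exact asIso t

end Along

section UnderlineRestrict

open ModuleFunctor

variable {X U : Scheme.{u}} (j : U ⟶ X) [IsOpenImmersion j]

lemma comparison_pullbackOpenIso (M : X.Modules) {T T' : Over U} (g : T' ⟶ T) :
    comparison M ((Over.map j).map g) ≫ (Scheme.Modules.pushforward g.left).map
        ((pullbackOpenIso T'.hom j).hom.app M) =
      (pullbackOpenIso T.hom j).hom.app M ≫ comparison (M.restrict j) g := by
  refine pullback_hom_ext (Y := (Over.map j).obj T) M fun V x => ?_
  change ((pullbackOpenIso T'.hom j).hom.app M).app _
    ((comparison M ((Over.map j).map g)).app _ (pullSection M ((Over.map j).obj T) V x)) =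
    (comparison (M.restrict j) g).app _ (((pullbackOpenIso T.hom j).hom.app M).app _
      (pullSection M ((Over.map j).obj T) V x))
  have h1 := comparison_pullSection M ((Over.map j).map g) V x
  have h2 := pullbackOpenIso_pullUnit T.hom j M V x
  have h3 := pullbackOpenIso_pullUnit T'.hom j M V x
  have h4 := comparison_pullSection (M.restrict j) g (j ⁻¹ᵁ V)
    (M.presheaf.map (homOfLE (j.image_preimage_le V)).op x)
  have e : g.left ⁻¹ᵁ (T.hom ≫ j) ⁻¹ᵁ V ≤ (T'.hom ≫ j) ⁻¹ᵁ V := by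
    rw [← Over.w g]; exact le_rfl
  have h5 := app_map ((pullbackOpenIso T'.hom j).hom.app M) (homOfLE e) (pullUnit (T'.hom ≫ j) M V x)
  refine (congrArg _ h1).trans (h5.trans ((congrArg _ h3).trans (h4.symm.trans ?_)))
  exact congrArg _ h2.symm

/-- The restriction of the functor of `M` to an open subscheme is the functor of the restriction
of `M`. -/
def underlineRestrictIso :
    underline X ⋙ restrictAlong j ≅ Scheme.Modules.restrictFunctor j ⋙ underline U := by
  let t (M : X.Modules) : (restrictAlong j).obj ((underline X).obj M) ⟶
      (underline U).obj (M.restrict j) :=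
    mkHom (F := (restrictAlong j).obj ((underline X).obj M)) (G := (underline U).obj (M.restrict j))
      (fun T =>
        { toFun := ((pullbackOpenIso T.hom j).hom.app M).app ⊤
          map_add' := map_add _
          map_smul' := ((pullbackOpenIso T.hom j).hom.app M).app_smul (U := ⊤) })
      (fun {T T'} g x => congr(Scheme.Modules.Hom.app $(comparison_pullbackOpenIso j M g) ⊤ x))
  have ht (M) : IsIso (t M) := isIso_of_bijective _ fun T =>
    ConcreteCategory.bijective_of_isIso (((pullbackOpenIso T.hom j).hom.app M).app ⊤)
  refine NatIso.ofComponents (fun M => @asIso _ _ _ _ (t M) (ht M)) fun {M N} f =>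
    ModuleFunctor.hom_ext fun T x => ?_
  exact congr(Scheme.Modules.Hom.app $((pullbackOpenIso T.hom j).hom.naturality f) ⊤ x)

end UnderlineRestrict

end

/-! ### Open immersions: base change, restriction of coherence, comparison with direct images -/

section

section BaseChange

open ModuleFunctor

variable {X U : Scheme.{u}} (j : U ⟶ X)

lemma baseChangeπ_left (Y : Over X) : (baseChangeπ j Y).left = pullback.fst Y.hom j := by
  simp [baseChangeπ]

instance [IsOpenImmersion j] (Y : Over X) : IsOpenImmersion (baseChangeπ j Y).left := by
  rw [baseChangeπ_left]
  exact inferInstanceAs (IsOpenImmersion (pullback.fst Y.hom j))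

lemma range_baseChangeπ [IsOpenImmersion j] (Y : Over X) :
    Set.range (baseChangeπ j Y).left = Y.hom ⁻¹' Set.range j := by
  rw [baseChangeπ_left]
  exact IsOpenImmersion.range_pullbackFst j Y.hom

lemma baseChange_hom_mem_range (Y : Over X) (z) :
    ((Over.map j).obj ((Over.pullback j).obj Y)).hom z ∈ Set.range j :=
  ⟨((Over.pullback j).obj Y).hom z, by simp [Over.map_obj_hom]⟩

lemma isIso_baseChangeπ [IsOpenImmersion j] (Y : Over X) (hY : ∀ y, Y.hom y ∈ Set.range j) :
    IsIso (baseChangeπ j Y) := by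
  have : IsIso ((Over.forget X).map (baseChangeπ j Y)) := by
    refine isIso_of_isOpenImmersion_of_opensRange_eq_top (baseChangeπ j Y).left ?_
    refine TopologicalSpace.Opens.ext ((range_baseChangeπ j Y).trans ?_)
    exact Set.eq_univ_of_forall hY
  exact isIso_of_reflects_iso _ (Over.forget X)

/-- The preimage of a class closed under finite limits under a limit-preserving functor is again
closed, so only the objects of `S` have to be checked. -/
lemma IsIteratedFiniteLimit.map {C D : Type*} [Category* C] [Category* D] (Φ : C ⥤ D)
    [∀ (J : Type) [SmallCategory J], PreservesLimitsOfShape J Φ] {S : ObjectProperty C}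
    {S' : ObjectProperty D} (h : ∀ F, S F → IsIteratedFiniteLimit S' (Φ.obj F)) {F : C}
    (hF : IsIteratedFiniteLimit S F) : IsIteratedFiniteLimit S' (Φ.obj F) :=
  isIteratedFiniteLimit_le (P := (IsIteratedFiniteLimit S').inverseImage Φ) h
    (fun J _ _ => ((IsIteratedFiniteLimit S').inverseImage Φ).limitsOfShape_le J) F hF

variable [IsOpenImmersion j]

lemma finite_restrict (M : X.Modules) (W : U.Opens) [h : Module.Finite Γ(X, j ''ᵁ W) Γ(M, j ''ᵁ W)] :
    Module.Finite Γ(U, W) Γ(M.restrict j, W) := by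
  let f : Γ(M, j ''ᵁ W) →ₛₗ[(j.appIso W).hom.hom] Γ(M.restrict j, W) :=
    { toFun x := x
      map_add' _ _ := rfl
      map_smul' r x := congrArg (· • (show Γ(M, j ''ᵁ W) from x))
        (ConcreteCategory.congr_hom (j.appIso W).hom_inv_id r).symm }
  exact Module.Finite.of_surjective f fun x => ⟨x, rfl⟩

lemma IsCoherentModule.restrict {M : X.Modules} (hM : IsCoherentModule M) :
    IsCoherentModule (M.restrict j) := by
  have := hM.isQuasicoherent
  have : (M.restrict j).IsQuasicoherent := Scheme.Modules.isQuasicoherent_restrictFunctor j M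
  refine isCoherentModule_of_forall_finite fun W hW => ?_
  have := hM.finite (hW.image_of_isOpenImmersion j)
  exact finite_restrict j M W

lemma IsModuleQuasicoherent.restrictAlong {F : ModuleFunctor X} (hF : IsModuleQuasicoherent X F) :
    IsModuleQuasicoherent U ((restrictAlong j).obj F) := by
  refine IsIteratedFiniteLimit.map (CoherentFunctors.restrictAlong j) ?_ hF
  rintro F ⟨M, hM, ⟨e⟩⟩
  have : M.IsQuasicoherent := hM
  exact isIteratedFiniteLimit_of_mem ⟨M.restrict j,
    Scheme.Modules.isQuasicoherent_restrictFunctor j M,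
    ⟨(CoherentFunctors.restrictAlong j).mapIso e ≪≫ (underlineRestrictIso j).app M⟩⟩

lemma IsModuleCoherent.restrictAlong {F : ModuleFunctor X} (hF : IsModuleCoherent X F) :
    IsModuleCoherent U ((restrictAlong j).obj F) := by
  refine IsIteratedFiniteLimit.map (CoherentFunctors.restrictAlong j) ?_ hF
  rintro F ⟨M, hM, ⟨e⟩⟩
  exact isIteratedFiniteLimit_of_mem ⟨M.restrict j, hM.restrict j,
    ⟨(CoherentFunctors.restrictAlong j).mapIso e ≪≫ (underlineRestrictIso j).app M⟩⟩

/-- The comparison of the functor of a direct image with the extension of functors. -/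
def pushforwardToExtend : Scheme.Modules.pushforward j ⋙ underline X ⟶
    underline U ⋙ extendAlong j where
  app M := (toExtendAlong j).app ((underline X).obj ((Scheme.Modules.pushforward j).obj M)) ≫
    (extendAlong j).map ((underlineRestrictIso j).hom.app ((Scheme.Modules.pushforward j).obj M) ≫
      (underline U).map ((Scheme.Modules.restrictAdjunction j).counit.app M))
  naturality M N f := by
    have h1 := (toExtendAlong j).naturality
      ((underline X).map ((Scheme.Modules.pushforward j).map f))
    have h2 := (underlineRestrictIso j).hom.naturality ((Scheme.Modules.pushforward j).map f)
    have h3 := (Scheme.Modules.restrictAdjunction j).counit.naturality f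
    dsimp only [Functor.comp_map, Functor.id_map] at h1 h2 h3 ⊢
    rw [reassoc_of% h1, Category.assoc, ← Functor.map_comp, ← Functor.map_comp, reassoc_of% h2,
      Category.assoc, ← Functor.map_comp, ← Functor.map_comp, h3]

end BaseChange

/-! ### Extension of functors from an affine open -/

section ExtendAffine

open ModuleFunctor

variable {X : Scheme.{u}} {V : X.Opens} (hV : IsAffineOpen V)

lemma extendsFrom_pushforward_fromSpec (M : (Spec Γ(X, V)).Modules) :
    ExtendsFrom ((Scheme.Modules.pushforward hV.fromSpec).obj M) V :=
  fun W _ => map_bijective_of_eq M (hV.fromSpec.preimage_mono (inf_le_left : W ⊓ V ≤ W))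
    (fun x hx => ⟨hx, by
      have : hV.fromSpec x ∈ Set.range hV.fromSpec := ⟨x, rfl⟩
      rwa [hV.range_fromSpec] at this⟩)

/-- The functor of a direct image from `V` takes the same value at `Y` as at the part of `Y` over
`V`, and there it is the functor of `M`. -/
lemma isIso_pushforwardToExtend [X.IsSeparated] (M : (Spec Γ(X, V)).Modules) [M.IsQuasicoherent] :
    IsIso ((pushforwardToExtend hV.fromSpec).app M) := by
  have : IsIso ((toExtendAlong hV.fromSpec).app
      ((underline X).obj ((Scheme.Modules.pushforward hV.fromSpec).obj M))) := by
    refine isIso_of_bijective _ fun Y => ?_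
    refine (extendsFrom_pushforward_fromSpec hV M).res_bijective hV (baseChangeπ hV.fromSpec Y)
      ?_ fun z => ?_
    · rw [range_baseChangeπ, hV.range_fromSpec]
    · have := baseChange_hom_mem_range hV.fromSpec Y z
      rwa [hV.range_fromSpec] at this
  dsimp only [pushforwardToExtend]
  infer_instance

lemma IsModuleQuasicoherent.extendAlong [X.IsSeparated] {G : ModuleFunctor (Spec Γ(X, V))}
    (hG : IsModuleQuasicoherent _ G) :
    IsModuleQuasicoherent X ((extendAlong hV.fromSpec).obj G) := by
  refine IsIteratedFiniteLimit.map (CoherentFunctors.extendAlong hV.fromSpec) ?_ hG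
  rintro G ⟨M, hM, ⟨e⟩⟩
  have : M.IsQuasicoherent := hM
  have := isIso_pushforwardToExtend hV M
  exact isIteratedFiniteLimit_of_mem ⟨(Scheme.Modules.pushforward hV.fromSpec).obj M,
    isQuasicoherent_pushforward hV.fromSpec M,
    ⟨(CoherentFunctors.extendAlong hV.fromSpec).mapIso e ≪≫
      (asIso ((pushforwardToExtend hV.fromSpec).app M)).symm⟩⟩

lemma finite_pushforward_fromSpec {M : (Spec Γ(X, V)).Modules} (hM : IsCoherentModule M)
    (W : X.Opens) (hW : IsAffineOpen W) (hWV : W ≤ V) :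
    Module.Finite Γ(X, W) Γ((Scheme.Modules.pushforward hV.fromSpec).obj M, W) := by
  have hW' : W ≤ hV.fromSpec.opensRange := by
    rw [hV.opensRange_fromSpec]
    exact hWV
  have := hV.fromSpec.isIso_app W hW'
  have := hM.finite (hW.preimage_of_isOpenImmersion hV.fromSpec hW')
  let f : Γ(M, hV.fromSpec ⁻¹ᵁ W) →ₛₗ[(inv (hV.fromSpec.app W)).hom]
      Γ((Scheme.Modules.pushforward hV.fromSpec).obj M, W) :=
    { toFun x := x
      map_add' _ _ := rfl
      map_smul' r x := congrArg (· • (show Γ(M, hV.fromSpec ⁻¹ᵁ W) from x))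
        (ConcreteCategory.congr_hom (IsIso.inv_hom_id (hV.fromSpec.app W)) r).symm }
  exact Module.Finite.of_surjective f fun x => ⟨x, rfl⟩

lemma exists_lift_fromSpec {U : X.Opens} (hVU : V ≤ U) :
    ∃ k : Spec Γ(X, V) ⟶ U, IsOpenImmersion k ∧ k ≫ U.ι = hV.fromSpec := by
  have h : Set.range hV.fromSpec ⊆ Set.range U.ι := by
    rw [hV.range_fromSpec, U.range_ι]
    exact hVU
  have e := IsOpenImmersion.lift_fac U.ι hV.fromSpec h
  refine ⟨IsOpenImmersion.lift U.ι hV.fromSpec h, ?_, e⟩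
  have : IsOpenImmersion (IsOpenImmersion.lift U.ι hV.fromSpec h ≫ U.ι) := by
    rw [e]
    infer_instance
  exact IsOpenImmersion.of_comp _ U.ι

lemma isModuleQuasicoherent_restrictAlong_fromSpec {F : ModuleFunctor X} {U : X.Opens}
    (hVU : V ≤ U) (hF : IsModuleQuasicoherent U (F.restrict U)) :
    IsModuleQuasicoherent _ ((restrictAlong hV.fromSpec).obj F) := by
  obtain ⟨k, _, hk⟩ := exists_lift_fromSpec hV hVU
  have h : IsModuleQuasicoherent U ((restrictAlong U.ι).obj F) := hF
  exact (IsIteratedFiniteLimit _).prop_of_iso (restrictAlongComp U.ι k hk F) (h.restrictAlong k)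

lemma isModuleCoherent_restrictAlong_fromSpec {F : ModuleFunctor X} {U : X.Opens}
    (hVU : V ≤ U) (hF : IsModuleCoherent U (F.restrict U)) :
    IsModuleCoherent _ ((restrictAlong hV.fromSpec).obj F) := by
  obtain ⟨k, _, hk⟩ := exists_lift_fromSpec hV hVU
  have h : IsModuleCoherent U ((restrictAlong U.ι).obj F) := hF
  exact (IsIteratedFiniteLimit _).prop_of_iso (restrictAlongComp U.ι k hk F) (h.restrictAlong k)

/-- A functor whose restriction to an affine open subset `V` is module-coherent is, on schemes over
`V`, the kernel of a homomorphism of quasi-coherent modules with finitely generated sections. -/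
theorem hasKernelOn_of_isModuleCoherent_restrictAlong [AlgebraicGeometry.IsNoetherian X]
    [X.IsSeparated] {F : ModuleFunctor X}
    (hF : IsModuleCoherent _ ((restrictAlong hV.fromSpec).obj F)) : HasKernelOn F V := by
  have := IsLocallyNoetherian.component_noetherian (X := X) ⟨V, hV⟩
  obtain ⟨M, N, φ, ι, hM, hN, hι⟩ := IsModuleCoherent.isCoherentKernel (X := Spec Γ(X, V)) hF
  have := hM.isQuasicoherent
  have := hN.isQuasicoherent
  have := isIso_pushforwardToExtend hV M
  have := isIso_pushforwardToExtend hV N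
  let a := (pushforwardToExtend hV.fromSpec).app M
  let b := (pushforwardToExtend hV.fromSpec).app N
  have hab := (pushforwardToExtend hV.fromSpec).naturality φ
  refine ⟨(Scheme.Modules.pushforward hV.fromSpec).obj M,
    (Scheme.Modules.pushforward hV.fromSpec).obj N, (Scheme.Modules.pushforward hV.fromSpec).map φ,
    (toExtendAlong hV.fromSpec).app F ≫ (extendAlong hV.fromSpec).map ι ≫ inv a,
    isQuasicoherent_pushforward hV.fromSpec M, isQuasicoherent_pushforward hV.fromSpec N,
    finite_pushforward_fromSpec hV hM, finite_pushforward_fromSpec hV hN, fun Y hY => ?_⟩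
  -- For `Y` over `V` the projection from the base change to `Y` is an isomorphism, so the kernel
  -- description on the spectrum of `Γ(X, V)` transfers to `F` at `Y`.
  have hπ : Function.Bijective (F.res (baseChangeπ hV.fromSpec Y)) := by
    have := isIso_baseChangeπ hV.fromSpec Y fun y => by
      rw [hV.range_fromSpec]
      exact hY y
    exact F.res_bijective _
  have ha := ev_injective_of_mono a Y
  have hb := ev_injective_of_mono b Y
  have hι' := hι ((Over.pullback hV.fromSpec).obj Y) fun _ => trivial
  have hainv (x) : ev a Y (ev (inv a) Y x) = x := by
    rw [← ev_comp, IsIso.inv_hom_id, ev_id]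
  have key (s : F.Sec Y) : ev a Y
      (ev ((toExtendAlong hV.fromSpec).app F ≫ (extendAlong hV.fromSpec).map ι ≫ inv a) Y s) =
      ev ι ((Over.pullback hV.fromSpec).obj Y) (F.res (baseChangeπ hV.fromSpec Y) s) :=
    hainv _
  refine ⟨fun s s' h => hπ.1 (hι'.1 ((key s).symm.trans ((congrArg _ h).trans (key s')))),
    fun x => ?_⟩
  have h1 : ev b Y (ev ((underline X).map ((Scheme.Modules.pushforward hV.fromSpec).map φ)) Y x) =
      ev ((underline _).map φ) ((Over.pullback hV.fromSpec).obj Y) (ev a Y x) :=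
    congrArg (fun t => ev t Y x) hab
  rw [← (map_eq_zero_iff _ hb), h1]
  refine (hι'.2 _).trans ⟨?_, ?_⟩
  · rintro ⟨s, hs⟩
    obtain ⟨s, rfl⟩ := hπ.2 s
    exact ⟨s, ha ((key s).trans hs)⟩
  · rintro ⟨s, rfl⟩
    exact ⟨_, (key s).symm⟩

/-- Locally module-coherent functors are module-coherent. -/
theorem IsLocallyModuleCoherent.isModuleCoherent [AlgebraicGeometry.IsNoetherian X]
    [X.IsSeparated] {F : ModuleFunctor X} (hF : IsLocallyModuleCoherent F) :
    IsModuleCoherent X F := by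
  obtain ⟨hsh, n, U, hU, hFU⟩ := hF
  obtain ⟨m, V, i, hV, hcov, hVU⟩ := exists_finite_affine_refinement X U hU
  exact (isCoherentKernel_of_hasKernelOn hV hcov hsh.isLocal fun l =>
    hasKernelOn_of_isModuleCoherent_restrictAlong (hV l)
      (isModuleCoherent_restrictAlong_fromSpec (hV l) (hVU l) (hFU _))).isModuleCoherent

end ExtendAffine

end

/-! ### Gluing of quasi-coherent functors along a finite affine cover -/

section

section Gluing

open ModuleFunctor

variable {X : Scheme.{u}}

lemma ev_piLift {κ : Type} [Finite κ] {F : ModuleFunctor X} {A : κ → ModuleFunctor X}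
    (a : ∀ l, F ⟶ A l) (l : κ) {Y : Over X} (s : F.Sec Y) :
    ev (Pi.π A l) Y (ev (Pi.lift a) Y s) = ev (a l) Y s :=
  congrArg (fun t => ev t Y s) (Pi.lift_π a l)

lemma ev_pi_ext {κ : Type} [Finite κ] {A : κ → ModuleFunctor X} {Y : Over X}
    {x x' : (∏ᶜ A).Sec Y} (h : ∀ l, ev (Pi.π A l) Y x = ev (Pi.π A l) Y x') : x = x' :=
  (isSectionwiseLimit_of_isLimit (limit.isLimit (Discrete.functor A))).ext fun l => h l.as

/-- Comparison of extensions from different open subschemes. -/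
lemma exists_extendAlong_comparison {U U' : Scheme.{u}} (j : U ⟶ X) (j' : U' ⟶ X)
    [IsOpenImmersion j] [IsOpenImmersion j'] (h : Set.range j' ⊆ Set.range j) (F : ModuleFunctor X) :
    ∃ r : (extendAlong j).obj ((restrictAlong j).obj F) ⟶
        (extendAlong j').obj ((restrictAlong j').obj F),
      ∀ (Y : Over X) (x : F.Sec ((Over.map j).obj ((Over.pullback j).obj Y))),
        ∃ e : (Over.map j').obj ((Over.pullback j').obj Y) ⟶
            (Over.map j).obj ((Over.pullback j).obj Y),
          e ≫ baseChangeπ j Y = baseChangeπ j' Y ∧ ev r Y x = F.res e x := by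
  have hlift (Y : Over X) := exists_over_lift (baseChangeπ j Y) (baseChangeπ j' Y) (by
    rw [range_baseChangeπ j Y]
    rintro _ ⟨z, rfl⟩
    refine h ?_
    rw [over_hom_apply]
    exact baseChange_hom_mem_range j' Y z)
  choose e he using hlift
  have hres {Y Z : Over X} (g : Z ⟶ Y) (x : F.Sec ((Over.map j).obj ((Over.pullback j).obj Y))) :
      F.res (e Z) (F.res ((Over.map j).map ((Over.pullback j).map g)) x) =
        F.res ((Over.map j').map ((Over.pullback j').map g)) (F.res (e Y) x) := by
    rw [← F.res_comp, ← F.res_comp]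
    refine congrArg (fun a => F.res a x) (over_openImmersion_cancel (baseChangeπ j Y) ?_)
    have h1 := (Over.mapPullbackAdj j).counit.naturality g
    have h2 := (Over.mapPullbackAdj j').counit.naturality g
    rw [Category.assoc, Category.assoc, he]
    exact (congrArg (e Z ≫ ·) h1).trans ((reassoc_of% (he Z)) g |>.trans h2.symm)
  have hsmul (Y : Over X) (r : Γ(Y.left, ⊤))
      (x : F.Sec ((Over.map j).obj ((Over.pullback j).obj Y))) :
      F.res (e Y) ((baseChangeπ j Y).left.appTop r • x) =
        (baseChangeπ j' Y).left.appTop r • F.res (e Y) x := by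
    rw [res_smul, ← he Y]
    exact congrArg (· • F.res (e Y) x) (ConcreteCategory.congr_hom
      (Scheme.Hom.comp_appTop (e Y).left (baseChangeπ j Y).left) r).symm
  exact ⟨mkHom (F := (extendAlong j).obj ((restrictAlong j).obj F))
    (G := (extendAlong j').obj ((restrictAlong j').obj F))
    (fun Y =>
      { toFun := F.res (e Y)
        map_add' := map_add _
        map_smul' := hsmul Y }) hres, fun Y x => ⟨e Y, he Y, rfl⟩⟩

variable {m : ℕ} {V : Fin m → X.Opens} (hV : ∀ l, IsAffineOpen (V l)) (hcov : iSup V = ⊤)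

include hV hcov in
/-- A Zariski sheaf whose restrictions to the members of a finite affine cover are
module-quasi-coherent is module-quasi-coherent. -/
theorem isModuleQuasicoherent_of_isLocal [X.IsSeparated] {F : ModuleFunctor X} (hF : F.IsLocal)
    (hq : ∀ (W : X.Opens) (hW : IsAffineOpen W) (l : Fin m), W ≤ V l →
      IsModuleQuasicoherent _ ((restrictAlong hW.fromSpec).obj F)) :
    IsModuleQuasicoherent X F := by
  have hVV (p : Fin m × Fin m) := isAffineOpen_inf (hV p.1) (hV p.2)
  let A (l : Fin m) := (extendAlong (hV l).fromSpec).obj ((restrictAlong (hV l).fromSpec).obj F)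
  let B (p : Fin m × Fin m) :=
    (extendAlong (hVV p).fromSpec).obj ((restrictAlong (hVV p).fromSpec).obj F)
  let a (l : Fin m) : F ⟶ A l := (toExtendAlong (hV l).fromSpec).app F
  have hA (l) : IsModuleQuasicoherent X (A l) := (hq _ (hV l) l le_rfl).extendAlong (hV l)
  have hB (p) : IsModuleQuasicoherent X (B p) := (hq _ (hVV p) p.1 inf_le_left).extendAlong (hVV p)
  choose r hr using fun p => exists_extendAlong_comparison (hV p.1).fromSpec (hVV p).fromSpec
    (by rw [(hV p.1).range_fromSpec, (hVV p).range_fromSpec]; exact Set.inter_subset_left) F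
  choose r' hr' using fun p => exists_extendAlong_comparison (hV p.2).fromSpec (hVV p).fromSpec
    (by rw [(hV p.2).range_fromSpec, (hVV p).range_fromSpec]; exact Set.inter_subset_right) F
  -- The Čech difference map: a section of its kernel is a family on the parts of `Y` over the `V l`
  -- which agree on the parts over the intersections.
  let d : (∏ᶜ A) ⟶ ∏ᶜ B := Pi.lift fun p => Pi.π A p.1 ≫ r p - Pi.π A p.2 ≫ r' p
  have hd (p) {Y : Over X} (x : (∏ᶜ A).Sec Y) : ev (Pi.π B p) Y (ev d Y x) =
      ev (r p) Y (ev (Pi.π A p.1) Y x) - ev (r' p) Y (ev (Pi.π A p.2) Y x) :=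
    (ev_piLift _ p x).trans (ev_sub _ _ x)
  have har (p) {Y : Over X} (s : F.Sec Y) : ev (r p) Y (ev (a p.1) Y s) =
      F.res (baseChangeπ (hVV p).fromSpec Y) s := by
    obtain ⟨e, he, h⟩ := hr p Y (F.res (baseChangeπ (hV p.1).fromSpec Y) s)
    rw [← F.res_comp, he] at h
    exact h
  have har' (p) {Y : Over X} (s : F.Sec Y) : ev (r' p) Y (ev (a p.2) Y s) =
      F.res (baseChangeπ (hVV p).fromSpec Y) s := by
    obtain ⟨e, he, h⟩ := hr' p Y (F.res (baseChangeπ (hV p.2).fromSpec Y) s)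
    rw [← F.res_comp, he] at h
    exact h
  have w : Pi.lift a ≫ d = 0 := ModuleFunctor.hom_ext fun Y s => ev_pi_ext fun p => by
    refine (hd p (ev (Pi.lift a) Y s)).trans (Eq.trans ?_ (map_zero _).symm)
    rw [ev_piLift, ev_piLift]
    exact sub_eq_zero.2 ((har p s).trans (har' p s).symm)
  have hmem (Y : Over X) (y : Y.left) : ∃ l, y ∈ Set.range (baseChangeπ (hV l).fromSpec Y).left := by
    obtain ⟨l, hl⟩ := TopologicalSpace.Opens.mem_iSup.1
      (hcov.ge (TopologicalSpace.Opens.mem_top (Y.hom y)))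
    refine ⟨l, ?_⟩
    rw [range_baseChangeπ, (hV l).range_fromSpec]
    exact hl
  obtain ⟨hl⟩ := nonempty_isLimit_kernelFork w (fun Y s s' h => by
    refine hF.eq_of_locally_eq fun y => ?_
    obtain ⟨l, hy⟩ := hmem Y y
    refine ⟨_, baseChangeπ (hV l).fromSpec Y, inferInstance, hy, ?_⟩
    have h1 := congrArg (ev (Pi.π A l) Y) h
    rw [ev_piLift, ev_piLift] at h1
    exact h1) (fun Y x hx => by
    choose l hy using hmem Y
    -- The vanishing of `d x` is a statement about the part of `Y` over `V p.1 ⊓ V p.2`; any scheme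
    -- mapping compatibly to the two members of the cover factors through it.
    have hcomp (p : Fin m × Fin m) {W : Over X}
        (b : W ⟶ (Over.map (hV p.1).fromSpec).obj ((Over.pullback (hV p.1).fromSpec).obj Y))
        (b' : W ⟶ (Over.map (hV p.2).fromSpec).obj ((Over.pullback (hV p.2).fromSpec).obj Y))
        (hb : b ≫ baseChangeπ (hV p.1).fromSpec Y = b' ≫ baseChangeπ (hV p.2).fromSpec Y) :
        F.res b (ev (Pi.π A p.1) Y x) = F.res b' (ev (Pi.π A p.2) Y x) := by
      obtain ⟨e, he, h⟩ := hr p Y (ev (Pi.π A p.1) Y x)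
      obtain ⟨e', he', h'⟩ := hr' p Y (ev (Pi.π A p.2) Y x)
      have h2 := (hd p x).symm.trans ((congrArg _ hx).trans (map_zero _))
      rw [sub_eq_zero] at h2
      have h3 := h.symm.trans (h2.trans h')
      obtain ⟨c, hc⟩ := exists_over_lift (baseChangeπ (hVV p).fromSpec Y)
        (b ≫ baseChangeπ (hV p.1).fromSpec Y) (by
          rw [range_baseChangeπ, (hVV p).range_fromSpec]
          rintro _ ⟨z, rfl⟩
          constructor
          · change Y.hom ((b ≫ baseChangeπ (hV p.1).fromSpec Y).left z) ∈ (V p.1 : Set X)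
            rw [over_hom_apply, ← over_hom_apply b, ← (hV p.1).range_fromSpec]
            exact baseChange_hom_mem_range _ _ _
          · change Y.hom ((b ≫ baseChangeπ (hV p.1).fromSpec Y).left z) ∈ (V p.2 : Set X)
            rw [over_hom_apply, ← over_hom_apply b', ← (hV p.2).range_fromSpec]
            exact baseChange_hom_mem_range _ _ _)
      have e1 : c ≫ e = b := over_openImmersion_cancel (baseChangeπ (hV p.1).fromSpec Y) (by
        rw [Category.assoc, he, hc])
      have e2 : c ≫ e' = b' := over_openImmersion_cancel (baseChangeπ (hV p.2).fromSpec Y) (by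
        rw [Category.assoc, he', hc, hb])
      have e3 := (F.res_comp c e (ev (Pi.π A p.1) Y x)).trans ((congrArg (F.res c) h3).trans
        (F.res_comp c e' (ev (Pi.π A p.2) Y x)).symm)
      rw [e1, e2] at e3
      exact e3
    -- The locality condition is indexed by the points of `Y`, so each point gets a chosen member of
    -- the cover; agreement on the remaining members is deduced afterwards.
    obtain ⟨s, hs, -⟩ := hF Y _ (fun y => baseChangeπ (hV (l y)).fromSpec Y)
      (fun y => inferInstance) hy (fun y => ev (Pi.π A (l y)) Y x)
      fun y y' W b b' hb => hcomp (l y, l y') b b' hb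
    refine ⟨s, ev_pi_ext fun k => (ev_piLift a k s).trans ?_⟩
    change F.res (baseChangeπ (hV k).fromSpec Y) s = _
    refine hF.eq_of_locally_eq fun z => ?_
    let y := (baseChangeπ (hV k).fromSpec Y).left z
    obtain ⟨W, b, c, hb, hz, e⟩ := exists_open_pullback (baseChangeπ (hV (l y)).fromSpec Y)
      (baseChangeπ (hV k).fromSpec Y) z (hy y)
    refine ⟨W, b, hb, hz, ?_⟩
    have h1 := hcomp (k, l y) b c e.symm
    refine Eq.trans ?_ h1.symm
    rw [← F.res_comp, ← e, F.res_comp]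
    exact congrArg (F.res c) (hs y))
  refine isIteratedFiniteLimit_of_isLimit_kernelFork _ hl ?_ ?_
  · exact (IsIteratedFiniteLimit _).prop_pi A hA
  · exact (IsIteratedFiniteLimit _).prop_pi B hB

end Gluing

section LocallyQuasicoherent

variable {X : Scheme.{u}} [AlgebraicGeometry.IsNoetherian X] [X.IsSeparated]

/-- Locally module-quasi-coherent functors are module-quasi-coherent. -/
theorem IsLocallyModuleQuasicoherent.isModuleQuasicoherent {F : ModuleFunctor X}
    (hF : IsLocallyModuleQuasicoherent F) : IsModuleQuasicoherent X F := by
  obtain ⟨hsh, n, U, hU, hFU⟩ := hF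
  obtain ⟨m, V, i, hV, hcov, hVU⟩ := exists_finite_affine_refinement X U hU
  exact isModuleQuasicoherent_of_isLocal hV hcov hsh.isLocal fun W hW l hWV =>
    isModuleQuasicoherent_restrictAlong_fromSpec hW (hWV.trans (hVU l)) (hFU _)

end LocallyQuasicoherent

end

end CoherentFunctors

end

theorem mainTheorem11 (X : Scheme.{u}) [AlgebraicGeometry.IsNoetherian X] [X.IsSeparated] :
    (∀ F : CoherentFunctors.ModuleFunctor X, CoherentFunctors.IsLocallyModuleQuasicoherent F →
      CoherentFunctors.IsModuleQuasicoherent X F) ∧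
    (∀ F : CoherentFunctors.ModuleFunctor X, CoherentFunctors.IsLocallyModuleCoherent F →
      CoherentFunctors.IsModuleCoherent X F) ∧
    (∃ A : Abelian (CoherentFunctors.IsModuleCoherent X).FullSubcategory,
      A.toPreadditive = CategoryTheory.Preadditive.fullSubcategory _) ∧
    (∀ F : CoherentFunctors.ModuleFunctor X, CoherentFunctors.IsModuleCoherent X F →
      ∃ (M N : X.Modules) (φ : M ⟶ N), CoherentFunctors.IsCoherentModule M ∧
        CoherentFunctors.IsCoherentModule N ∧
        Nonempty (F ≅ kernel ((CoherentFunctors.underline X).map φ))) := by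
  exact ⟨fun _ hF => hF.isModuleQuasicoherent, fun _ hF => hF.isModuleCoherent,
    CoherentFunctors.exists_abelian_isModuleCoherent X, fun _ hF => hF.exists_iso_kernel⟩
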